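/- **Theorem (existence of unconstrained moment geodesics).** Let $C_0,C_1\in\mathbb R^{d\times d}$ be symmetric positive semidefinite and let $m_0,m_1\in\mathbb R^d$ satisfy $m_1-m_0\in\operatorname{im}C_0=\operatorname{im}C_1$. Inverses, negative powers and logarithms of symmetric positive semidefinite matrices are taken on the image and extended by $0$ to the kernel. For an absolutely continuous curve $(m,C):[0,1]\to\mathbb R^d\times\mathcal S^d_{\succeq0}$ put $$I(m,C)=\int_0^1\tfrac12\langle\dot m_t,C_t^{-1}\dot m_t\rangle+\tfrac18\operatorname{tr}\big(\dot C_tC_t^{-1}\dot C_tC_t^{-1}\big)\,dt ,$$ where the integrand is $+\infty$ at times at which $\dot m_t\notin\operatorname{im}C_t$ or $\operatorname{im}\dot C_t\not\subseteq\operatorname{im}C_t$. Let $\mathcal D^2=\mathcal D((m_0,C_0),(m_1,C_1))^2$ be the infimum of $I$ over all such curves which take the values $(m_0,C_0)$ at $t=0$ and $(m_1,C_1)$ at $t=1$. An *optimizer* is such a curve with $I(m,C)=\mathcal D^2$. 1. $\mathcal D^2<\infty$, and there is an optimizer $(m,C)$, with $m$ once and $C$ twice differentiable on $[0,1]$, $\dot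 m_t\in\operatorname{im}C_t$ and $\operatorname{im}\dot C_t\subseteq\operatorname{im}C_t$, and a vector $\alpha\in\mathbb R^d$ such that for all $t\in[0,1]$ $$C_t^{-1}\dot m_t=\alpha,\qquad \ddot C_t=\dot C_tC_t^{-1}\dot C_t-2C_t(\alpha\otimes\alpha)C_t. \tag{EL}$$ 2. If $m_0=m_1$, then the unique optimizer is $m_t=m_0$, $C_t=C_0^{1/2}\big(C_0^{-1/2}C_1C_0^{-1/2}\big)^tC_0^{1/2}$ for $t\in[0,1]$, and $$\mathcal D^2=\tfrac18\big\|\log\big(C_0^{-1/2}C_1C_0^{-1/2}\big)\big\|_{\mathrm{HS}}^2 .$$ 3. Let $(e^i)_{i=1}^d$ be an orthonormal basis of $\mathbb R^d$ with $C_k=\sum_i\lambda_i(k)\,e^i\otimes e^i$ for $k\in\{0,1\}$, and let $\delta=m_1-m_0$, $\delta_i=\langle\delta,e^i\rangle$. Put, for those $i$ with $\lambda_i(0)>0$, $$\beta_i=\operatorname{arcosh}\frac{\delta_i^2+\lambda_i(0)+\lambda_i(1)}{2\sqrt{\lambda_i(0)\lambda_i(1)}} ,$$ and, if $\delta_i\neq0$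 (which implies $\lambda_i(0)>0$), $$\tau_i=\log\frac{\lambda_i(0)-\lambda_i(1)-\delta_i^2+\sqrt{(\delta_i^2+\lambda_i(0)+\lambda_i(1))^2-4\lambda_i(0)\lambda_i(1)}}{2|\delta_i|\sqrt{\lambda_i(0)}},\qquad r_i=\frac{\delta_i}{\tanh(\beta_i+\tau_i)-\tanh\tau_i} .$$ Let $m(t)=\sum_i m_i(t)e^i$ and $C(t)=\sum_i\lambda_i(t)\,e^i\otimes e^i$, where for $\delta_i\ne0$ $$m_i(t)=\langle m_0,e^i\rangle+r_i\big(\tanh(\beta_it+\tau_i)-\tanh\tau_i\big),\qquad \lambda_i(t)=\frac{r_i^2}{\cosh^2(\beta_it+\tau_i)},$$ and for $\delta_i=0$: $m_i(t)=\langle m_0,e^i\rangle$, and $\lambda_i(t)=\lambda_i(0)^{1-t}\lambda_i(1)^t$ (which means $\lambda_i(t)=0$ if $\lambda_i(0)=\lambda_i(1)=0$). Then: - $(m,C)$ is an absolutely continuous curve in $\mathbb R^d\times\mathcal S^d_{\succeq0}$ from $(m_0,C_0)$ to $(m_1,C_1)$, and $I(m,C)=\frac12\sum_{i:\lambda_i(0)>0}\beta_i^2$.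 - If $m_1-m_0\in\operatorname{span}\{e^\ell\}$ for some $\ell\in\{1,\dots,d\}$, then $(m,C)$ is an optimizer and solves (EL) for some $\alpha\in\mathbb R^d$, in the sense of part 1. - In particular, $$\mathcal D^2\le\frac12\sum_{i:\lambda_i(0)>0}\Big[\operatorname{arcosh}\frac{\delta_i^2+\lambda_i(0)+\lambda_i(1)}{2\sqrt{\lambda_i(0)\lambda_i(1)}}\Big]^2 ,$$ and if $\lambda_i(0)=\lambda_i(1)=:\lambda_i$ for all $i$, then $$\mathcal D^2\le\frac12\sum_{i:\lambda_i>0}\Big[\operatorname{arcosh}\Big(\frac{\delta_i^2}{2\lambda_i}+1\Big)\Big]^2 .$$ -/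

import Mathlib

open Set MeasureTheory Matrix
open scoped ENNReal

namespace MomentOT

noncomputable section

variable {d : ℕ}

/-- The image of a matrix, as a subspace of `ℝ^d`. -/
def im (A : Matrix (Fin d) (Fin d) ℝ) : Submodule ℝ (Fin d → ℝ) :=
  LinearMap.range A.mulVecLin

/-- The inverse of a symmetric matrix on its image, extended by `0` on its kernel
(the eigenvalue `0` is sent to `0⁻¹ = 0`). For a positive definite matrix it is the inverse. -/
def pinv (C : Matrix (Fin d) (Fin d) ℝ) : Matrix (Fin d) (Fin d) ℝ :=
  cfc (fun x : ℝ => x⁻¹) C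

/-- The power `C ^ s` of a positive semidefinite matrix, by spectral calculus. For `s ≠ 0` the
eigenvalue `0` is sent to `0`, so that negative powers are powers on the image. -/
def spow (C : Matrix (Fin d) (Fin d) ℝ) (s : ℝ) : Matrix (Fin d) (Fin d) ℝ :=
  cfc (fun x : ℝ => x ^ s) C

/-- The logarithm of a positive semidefinite matrix, by spectral calculus; it is the logarithm on
the image and `0` on the kernel (since `Real.log 0 = 0`). -/
def slog (C : Matrix (Fin d) (Fin d) ℝ) : Matrix (Fin d) (Fin d) ℝ :=
  cfc Real.log C

/-- The squared Hilbert–Schmidt norm. -/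
def hsNormSq (A : Matrix (Fin d) (Fin d) ℝ) : ℝ := ∑ i, ∑ j, A i j ^ 2

/-- The time derivative of a curve of matrices, entry by entry. -/
def matDeriv (C : ℝ → Matrix (Fin d) (Fin d) ℝ) (t : ℝ) : Matrix (Fin d) (Fin d) ℝ :=
  Matrix.of fun i j => deriv (fun s => C s i j) t

/-- `MC((m₀,C₀),(m₁,C₁))`: absolutely continuous curves `[0,1] → ℝ^d × S^d_{≽0}` joining
`(m₀,C₀)` to `(m₁,C₁)`. Only the values of `m` and `C` on `[0,1]` matter. -/
structure IsMomentCurve (m₀ : Fin d → ℝ) (C₀ : Matrix (Fin d) (Fin d) ℝ)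
    (m₁ : Fin d → ℝ) (C₁ : Matrix (Fin d) (Fin d) ℝ)
    (m : ℝ → Fin d → ℝ) (C : ℝ → Matrix (Fin d) (Fin d) ℝ) : Prop where
  ac_mean : AbsolutelyContinuousOnInterval m 0 1
  ac_cov : ∀ i j, AbsolutelyContinuousOnInterval (fun t => C t i j) 0 1
  posSemidef : ∀ t ∈ Icc (0 : ℝ) 1, (C t).PosSemidef
  mean_zero : m 0 = m₀
  mean_one : m 1 = m₁
  cov_zero : C 0 = C₀
  cov_one : C 1 = C₁

open Classical in
/-- The action density at a point `C` with velocities `v` of the mean and `X` of the covariance,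
`½⟨v, C⁻¹ v⟩ + ⅛ tr (X C⁻¹ X C⁻¹)`. As for the pseudo-norm `|v|_C`, it is `∞` when a velocity leaves
the image of `C`, where `C⁻¹` is not defined; for positive definite `C` this does not happen. -/
def actionDensity (C : Matrix (Fin d) (Fin d) ℝ) (v : Fin d → ℝ)
    (X : Matrix (Fin d) (Fin d) ℝ) : ℝ≥0∞ :=
  if v ∈ im C ∧ im X ≤ im C then
    ENNReal.ofReal ((1 / 2) * (v ⬝ᵥ (pinv C *ᵥ v)) + (1 / 8) * (X * pinv C * X * pinv C).trace)
  else ⊤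

/-- The action `I(m,C)` of a curve on `[0,1]`. -/
def action (m : ℝ → Fin d → ℝ) (C : ℝ → Matrix (Fin d) (Fin d) ℝ) : ℝ≥0∞ :=
  ∫⁻ t in Ioo (0 : ℝ) 1, actionDensity (C t) (deriv m t) (matDeriv C t)

/-- The value `𝒟((m₀,C₀),(m₁,C₁))²` of the unconstrained moment optimization problem. -/
def distSq (m₀ : Fin d → ℝ) (C₀ : Matrix (Fin d) (Fin d) ℝ)
    (m₁ : Fin d → ℝ) (C₁ : Matrix (Fin d) (Fin d) ℝ) : ℝ≥0∞ :=
  ⨅ (m : ℝ → Fin d → ℝ) (C : ℝ → Matrix (Fin d) (Fin d) ℝ)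
    (_ : IsMomentCurve m₀ C₀ m₁ C₁ m C), action m C

/-- `(m,C)` is an admissible curve that achieves the infimum. -/
def IsOptimal (m₀ : Fin d → ℝ) (C₀ : Matrix (Fin d) (Fin d) ℝ)
    (m₁ : Fin d → ℝ) (C₁ : Matrix (Fin d) (Fin d) ℝ)
    (m : ℝ → Fin d → ℝ) (C : ℝ → Matrix (Fin d) (Fin d) ℝ) : Prop :=
  IsMomentCurve m₀ C₀ m₁ C₁ m C ∧ action m C = distSq m₀ C₀ m₁ C₁

/-- `(m,C)` is differentiable on `[0,1]`, `C` twice so (one-sided at the end points), its velocity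
stays in the image of `C`, and `C⁻¹ ṁ = α`, `C̈ = Ċ C⁻¹ Ċ - 2 C (α ⊗ α) C` on `[0,1]`. -/
def SolvesOptimality (α : Fin d → ℝ) (m : ℝ → Fin d → ℝ)
    (C : ℝ → Matrix (Fin d) (Fin d) ℝ) : Prop :=
  ∃ (m' : ℝ → Fin d → ℝ) (C' : ℝ → Matrix (Fin d) (Fin d) ℝ), ∀ t ∈ Icc (0 : ℝ) 1,
    HasDerivWithinAt m (m' t) (Icc 0 1) t ∧
    (∀ i j, HasDerivWithinAt (fun s => C s i j) (C' t i j) (Icc 0 1) t) ∧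
    m' t ∈ im (C t) ∧ im (C' t) ≤ im (C t) ∧
    pinv (C t) *ᵥ m' t = α ∧
    ∀ i j, HasDerivWithinAt (fun s => C' s i j)
      ((C' t * pinv (C t) * C' t - (2 : ℝ) • (C t * vecMulVec α α * C t)) i j) (Icc 0 1) t

/-! The explicit one-dimensional solutions: `δ` is the displacement of the mean, `a` and `b` are the
initial and the final variance. -/

/-- The constant `β ≥ 0`, with `cosh β = (δ² + a + b) / (2 √(a b))`. -/
def rate (δ a b : ℝ) : ℝ := Real.arcosh ((δ ^ 2 + a + b) / (2 * √(a * b)))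

/-- The constant `τ` (used for `δ ≠ 0`). -/
def phase (δ a b : ℝ) : ℝ :=
  Real.log ((a - b - δ ^ 2 + √((δ ^ 2 + a + b) ^ 2 - 4 * a * b)) / (2 * |δ| * √a))

/-- The constant `r`; it is `0` for `δ = 0`. -/
def amplitude (δ a b : ℝ) : ℝ :=
  δ / (Real.tanh (rate δ a b + phase δ a b) - Real.tanh (phase δ a b))

/-- The displacement `r (tanh (β t + τ) - tanh τ)` of the mean at time `t`. -/
def shift (δ a b t : ℝ) : ℝ :=
  amplitude δ a b *
    (Real.tanh (rate δ a b * t + phase δ a b) - Real.tanh (phase δ a b))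

/-- The variance `(r / cosh (β t + τ))²` at time `t`, and `a^(1-t) b^t` for `δ = 0`. -/
def variance (δ a b t : ℝ) : ℝ :=
  if δ = 0 then a ^ (1 - t) * b ^ t
  else (amplitude δ a b / Real.cosh (rate δ a b * t + phase δ a b)) ^ 2

/-- The matrix `∑ i, a i • eⁱ ⊗ eⁱ`. -/
def diagIn (e : Fin d → Fin d → ℝ) (a : Fin d → ℝ) : Matrix (Fin d) (Fin d) ℝ :=
  ∑ i, a i • vecMulVec (e i) (e i)

/-- The mean of the explicit curve in the basis `e`, with `δ i = ⟨δ, eⁱ⟩`. -/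
def explicitMean (e : Fin d → Fin d → ℝ) (m₀ m₁ a b : Fin d → ℝ) (t : ℝ) : Fin d → ℝ :=
  m₀ + ∑ i, shift ((m₁ - m₀) ⬝ᵥ e i) (a i) (b i) t • e i

/-- The covariance of the explicit curve in the basis `e`. -/
def explicitCov (e : Fin d → Fin d → ℝ) (m₀ m₁ a b : Fin d → ℝ) (t : ℝ) :
    Matrix (Fin d) (Fin d) ℝ :=
  diagIn e fun i => variance ((m₁ - m₀) ⬝ᵥ e i) (a i) (b i) t

/-- The affine-invariant geodesic `C₀^{1/2} (C₀^{-1/2} C₁ C₀^{-1/2})^t C₀^{1/2}`. -/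
def affineGeodesic (C₀ C₁ : Matrix (Fin d) (Fin d) ℝ) (t : ℝ) : Matrix (Fin d) (Fin d) ℝ :=
  spow C₀ (1 / 2) * spow (spow C₀ (-1 / 2) * C₁ * spow C₀ (-1 / 2)) t * spow C₀ (1 / 2)

end

end MomentOT

/-!
Since `im C₀ = im C₁` and `m₁ - m₀` lies in this subspace, the problem can be written in linear
coordinates of the subspace, where the covariances are positive definite. Along a curve of finite
action every quadratic form `f t = ⟨u, C t u⟩` satisfies `(f' / f)² ≤ 8 F` with the action density
`F`, and a Grönwall estimate (`le_exp_mul_of_logDeriv_sq_le`) shows that the kernel of the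
covariance is constant and that the mean moves in the subspace. Hence admissible curves of finite
action correspond to curves of positive definite matrices (`IsChart.lift`, `IsChart.descend`), and
optimizers to minimizers in coordinates (`IsChart.isOptimal`, `IsChart.isMinimal`).

*Existence.* By the same estimate, the curves of a minimizing sequence stay in a compact part of the
positive cone and are equicontinuous. Their limit along an ultrafilter is a minimizer
(`exists_isMinimal`), where lower semicontinuity is replaced by a comparison of short increments
with the limit of the accumulated actions (`PosCurve.energy_le_of_monotone`).

*Optimality conditions.* The action is invariant under translations of the mean and under the
action `(m, C) ↦ (g m, g C gᵀ)` of invertible matrices. Variation along one-parameter groups with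
a time-dependent parameter gives the conserved momenta `C⁻¹ ṁ = α` and
`m ⊗ α + ½ Ċ C⁻¹ = B` (`IsMinimal.exists_momenta`). They are a first order system, so that
minimizers are smooth, and differentiating it once gives the Euler–Lagrange equation
(`IsMinimal.eulerLagrange`).

*Equal means.* Then `α = 0`, and the system becomes `Ċ = G C` with a constant matrix `G`. In
coordinates with `C₀ = 1` and `C₁ = diag μ` it follows that `C t = exp (t G)` with `G` symmetric,
and `G = log C₁` by injectivity of the exponential (`IsMinimal.eq_diagonal_rpow`).

*Displacement along one eigenvector.* Conditioning on this coordinate splits the action density: it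
dominates the density of the variance and the mean of the coordinate plus the density of the Schur
complement (`schur_dens_le`). The curve of Schur complements joins diagonal matrices with constant
mean and is covered by the previous case. The coordinate itself moves in a hyperbolic half plane,
and a Busemann function of the end point of the geodesic is a calibration (`rate_le_lintegral`).
The sum of the two lower bounds is the action of the explicit curve (`energy_diag`).
-/

set_option linter.unusedSectionVars false

namespace MomentOT

open Filter Topology

/-! ### Absolutely continuous functions on `[0,1]` -/

section AbsolutelyContinuous

variable {a b : ℝ}

theorem ac_const {X : Type*} [PseudoMetricSpace X] (c : X) :
    AbsolutelyContinuousOnInterval (fun _ : ℝ => c) a b :=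
  (LipschitzWith.const (α := ℝ) c).lipschitzOnWith.absolutelyContinuousOnInterval

theorem ac_sum {κ : Type*} (s : Finset κ) {f : κ → ℝ → ℝ}
    (hf : ∀ i ∈ s, AbsolutelyContinuousOnInterval (f i) a b) :
    AbsolutelyContinuousOnInterval (fun t => ∑ i ∈ s, f i t) a b := by
  classical
  induction s using Finset.induction_on with
  | empty => simpa using ac_const (0 : ℝ)
  | insert i s hi ih =>
    have h1 := hf i (Finset.mem_insert_self i s)
    have h2 := ih fun j hj => hf j (Finset.mem_insert_of_mem hj)
    simpa [Finset.sum_insert hi] using h1.fun_add h2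

/-- A function whose increments are controlled by those of finitely many absolutely continuous
functions is absolutely continuous. -/
theorem ac_of_dist_le {X Y κ : Type*} [PseudoMetricSpace X] [PseudoMetricSpace Y] (s : Finset κ)
    {g : κ → ℝ → Y} (hg : ∀ i ∈ s, AbsolutelyContinuousOnInterval (g i) a b) {f : ℝ → X} {c : ℝ}
    (hf : ∀ x ∈ uIcc a b, ∀ y ∈ uIcc a b, dist (f x) (f y) ≤ c * ∑ i ∈ s, dist (g i x) (g i y)) :
    AbsolutelyContinuousOnInterval f a b := by
  unfold AbsolutelyContinuousOnInterval at hg ⊢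
  have h := (tendsto_finsetSum s hg).const_mul c
  simp only [Finset.sum_const_zero, mul_zero] at h
  refine squeeze_zero' (Eventually.of_forall fun E => Finset.sum_nonneg fun _ _ => dist_nonneg)
    ?_ h
  refine mem_inf_of_right fun E hE => ?_
  simp only [mem_ofPred_eq]
  rw [Finset.sum_comm, Finset.mul_sum]
  exact Finset.sum_le_sum fun i hi => hf _ (hE.1 i hi).1 _ (hE.1 i hi).2

theorem ac_comp_lipschitzOn {X Y : Type*} [PseudoMetricSpace X] [PseudoMetricSpace Y]
    {f : ℝ → X} (hf : AbsolutelyContinuousOnInterval f a b) {φ : X → Y} {S : Set X} {C : NNReal}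
    (hφ : LipschitzOnWith C φ S) (hS : ∀ t ∈ uIcc a b, f t ∈ S) :
    AbsolutelyContinuousOnInterval (fun t => φ (f t)) a b :=
  ac_of_dist_le (Finset.univ : Finset Unit) (g := fun _ => f) (c := C) (fun _ _ => hf)
    fun x hx y hy => by simpa using hφ.dist_le_mul _ (hS x hx) _ (hS y hy)

/-- Composition of an absolutely continuous function with a `C¹` function on an interval. -/
theorem ac_comp_contDiffOn {f φ : ℝ → ℝ} {lo hi : ℝ}
    (hf : AbsolutelyContinuousOnInterval f a b) (hφ : ContDiffOn ℝ 1 φ (Icc lo hi))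
    (hS : ∀ t ∈ uIcc a b, f t ∈ Icc lo hi) :
    AbsolutelyContinuousOnInterval (fun t => φ (f t)) a b := by
  obtain ⟨C, hC⟩ := hφ.exists_lipschitzOnWith (by decide) (convex_Icc _ _) isCompact_Icc
  exact ac_comp_lipschitzOn hf hC hS

theorem ac_comp_contDiff {f φ : ℝ → ℝ} (hf : AbsolutelyContinuousOnInterval f a b)
    (hφ : ContDiff ℝ 1 φ) : AbsolutelyContinuousOnInterval (fun t => φ (f t)) a b := by
  obtain ⟨C, hC⟩ := hf.exists_bound
  exact ac_comp_contDiffOn (lo := -C) (hi := C) hf hφ.contDiffOn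
    fun t ht => abs_le.mp (hC t ht)

theorem ac_log {f : ℝ → ℝ} (hf : AbsolutelyContinuousOnInterval f a b)
    (h0 : ∀ t ∈ uIcc a b, 0 < f t) :
    AbsolutelyContinuousOnInterval (fun t => Real.log (f t)) a b := by
  obtain ⟨C, hC⟩ := hf.exists_bound
  obtain ⟨x, hx, hmin⟩ := isCompact_uIcc.exists_isMinOn nonempty_uIcc hf.continuousOn
  refine ac_comp_contDiffOn (lo := f x) (hi := C) hf ?_
    fun t ht => ⟨hmin ht, (le_abs_self _).trans (hC t ht)⟩
  intro y hy
  exact (Real.contDiffAt_log.2 ((h0 x hx).trans_le hy.1).ne').contDiffWithinAt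

theorem ac_of_contDiff {f : ℝ → ℝ} (hf : ContDiff ℝ 1 f) :
    AbsolutelyContinuousOnInterval f a b :=
  hf.contDiffOn.absolutelyContinuousOnInterval

theorem ac_pi {κ : Type*} [Fintype κ] {f : ℝ → κ → ℝ} :
    AbsolutelyContinuousOnInterval f a b ↔
      ∀ i, AbsolutelyContinuousOnInterval (fun t => f t i) a b := by
  refine ⟨fun h i => ?_, fun h => ?_⟩
  · exact ac_of_dist_le (Finset.univ : Finset Unit) (g := fun _ => f) (c := 1) (fun _ _ => h)
      fun x _ y _ => by simpa using dist_le_pi_dist (f x) (f y) i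
  · refine ac_of_dist_le (Finset.univ : Finset κ) (g := fun i t => f t i) (c := 1)
      (fun i _ => h i) fun x _ y _ => ?_
    rw [one_mul, dist_pi_le_iff (Finset.sum_nonneg fun _ _ => dist_nonneg)]
    exact fun i => Finset.single_le_sum (f := fun i => dist (f x i) (f y i))
      (fun _ _ => dist_nonneg) (Finset.mem_univ i)

theorem ac_congr {X : Type*} [PseudoMetricSpace X] {f g : ℝ → X}
    (hf : AbsolutelyContinuousOnInterval f a b) (h : ∀ t ∈ uIcc a b, f t = g t) :
    AbsolutelyContinuousOnInterval g a b :=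
  ac_of_dist_le (Finset.univ : Finset Unit) (g := fun _ => f) (c := 1) (fun _ _ => hf)
    fun x hx y hy => by simp [h x hx, h y hy]

theorem ac_hasDerivAt {f : ℝ → ℝ} (hf : AbsolutelyContinuousOnInterval f 0 1) :
    ∀ᵐ t ∂volume.restrict (Ioo (0 : ℝ) 1), HasDerivAt f (deriv f t) t := by
  rw [ae_restrict_iff' measurableSet_Ioo]
  filter_upwards [hf.ae_differentiableAt] with t ht ht1
  exact (ht (by rw [uIcc_of_le zero_le_one]; exact Ioo_subset_Icc_self ht1)).hasDerivAt

theorem ac_mono {X : Type*} [PseudoMetricSpace X] {f : ℝ → X}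
    (hf : AbsolutelyContinuousOnInterval f 0 1) {s t : ℝ}
    (hs : s ∈ Icc (0 : ℝ) 1) (ht : t ∈ Icc (0 : ℝ) 1) :
    AbsolutelyContinuousOnInterval f s t :=
  hf.mono (by rw [uIcc_of_le zero_le_one]; exact uIcc_subset_Icc hs ht)

/-- Almost everywhere on `(0,1)` may be read on a smaller interval of integration. -/
theorem ae_uIoc_of_ae_Ioo {p : ℝ → Prop} (h : ∀ᵐ t ∂volume.restrict (Ioo (0 : ℝ) 1), p t)
    {s t : ℝ} (hs : s ∈ Icc (0 : ℝ) 1) (ht : t ∈ Icc (0 : ℝ) 1) :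
    ∀ᵐ x, x ∈ uIoc s t → p x := by
  rw [ae_restrict_iff' measurableSet_Ioo] at h
  filter_upwards [h, Measure.ae_ne volume 1] with x hx h1 hxs
  refine hx ⟨?_, ?_⟩
  · rcases mem_uIoc.mp hxs with h | h
    · exact hs.1.trans_lt h.1
    · exact ht.1.trans_lt h.1
  · refine lt_of_le_of_ne ?_ h1
    rcases mem_uIoc.mp hxs with h | h
    · exact h.2.trans ht.2
    · exact h.2.trans hs.2

theorem ac_le_of_deriv_nonpos {f : ℝ → ℝ} (hf : AbsolutelyContinuousOnInterval f 0 1)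
    (h : ∀ᵐ t ∂volume.restrict (Ioo (0 : ℝ) 1), deriv f t ≤ 0) {s t : ℝ}
    (hs : s ∈ Icc (0 : ℝ) 1) (ht : t ∈ Icc (0 : ℝ) 1) (hst : s ≤ t) : f t ≤ f s := by
  have h1 := (ac_mono hf hs ht).integral_deriv_eq_sub
  have h2 : ∫ x in s..t, deriv f x ≤ 0 := by
    have := ae_uIoc_of_ae_Ioo h hs ht
    rw [← ae_restrict_iff' measurableSet_uIoc, uIoc_of_le hst] at this
    rw [intervalIntegral.integral_of_le hst]
    exact integral_nonpos_of_ae this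
  linarith

theorem ac_eq_of_deriv_eq_zero {f : ℝ → ℝ} (hf : AbsolutelyContinuousOnInterval f 0 1)
    (h : ∀ᵐ t ∂volume.restrict (Ioo (0 : ℝ) 1), deriv f t = 0) {t : ℝ}
    (ht : t ∈ Icc (0 : ℝ) 1) : f t = f 0 := by
  have h1 := (ac_mono hf ⟨le_rfl, zero_le_one⟩ ht).integral_deriv_eq_sub
  have h2 : ∫ x in (0 : ℝ)..t, deriv f x = 0 := by
    rw [intervalIntegral.integral_zero_ae]
    exact ae_uIoc_of_ae_Ioo h ⟨le_rfl, zero_le_one⟩ ht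
  linarith

theorem intervalIntegrable_of_Ioo {f : ℝ → ℝ} (hf : IntegrableOn f (Ioo 0 1)) {s t : ℝ}
    (hs : s ∈ Icc (0 : ℝ) 1) (ht : t ∈ Icc (0 : ℝ) 1) : IntervalIntegrable f volume s t := by
  have : IntervalIntegrable f volume 0 1 := by
    rwa [intervalIntegrable_iff_integrableOn_Ioo_of_le zero_le_one]
  exact this.mono_set (by rw [uIcc_of_le zero_le_one]; exact uIcc_subset_Icc hs ht)

theorem integral_Ioo_eq (f : ℝ → ℝ) : ∫ t in Ioo (0 : ℝ) 1, f t = ∫ t in (0 : ℝ)..1, f t := by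
  rw [intervalIntegral.integral_of_le zero_le_one, integral_Ioc_eq_integral_Ioo]

/-- If the derivative of an absolutely continuous function agrees almost everywhere with a
continuous function, the function is differentiable on the whole closed interval. -/
theorem ac_hasDerivWithinAt {f g : ℝ → ℝ} (hf : AbsolutelyContinuousOnInterval f 0 1)
    (hg : ContinuousOn g (Icc 0 1))
    (h : ∀ᵐ t ∂volume.restrict (Ioo (0 : ℝ) 1), deriv f t = g t) {t : ℝ}
    (ht : t ∈ Icc (0 : ℝ) 1) : HasDerivWithinAt f (g t) (Icc 0 1) t := by
  set G : ℝ → ℝ := fun s => g (projIcc 0 1 zero_le_one s) with hG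
  have hGc : Continuous G := by
    have := continuousOn_iff_continuous_domRestrict.mp hg
    exact this.comp continuous_projIcc
  have hGg : ∀ s ∈ Icc (0 : ℝ) 1, G s = g s := fun s hs => by
    simp [hG, projIcc_of_mem zero_le_one hs]
  have h0 : (0 : ℝ) ∈ Icc (0 : ℝ) 1 := ⟨le_rfl, zero_le_one⟩
  have key : ∀ s ∈ Icc (0 : ℝ) 1, f s = f 0 + ∫ x in (0 : ℝ)..s, G x := by
    intro s hs
    have h1 := (ac_mono hf h0 hs).integral_deriv_eq_sub
    have h2 : ∫ x in (0 : ℝ)..s, deriv f x = ∫ x in (0 : ℝ)..s, G x := by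
      refine intervalIntegral.integral_congr_ae ?_
      filter_upwards [ae_uIoc_of_ae_Ioo h h0 hs] with x hx hxs
      rw [hx hxs, hGg x]
      rw [uIoc_of_le hs.1] at hxs
      exact ⟨hxs.1.le, hxs.2.trans hs.2⟩
    linarith
  have hd : HasDerivAt (fun s => f 0 + ∫ x in (0 : ℝ)..s, G x) (G t) t :=
    (intervalIntegral.integral_hasDerivAt_right (hGc.intervalIntegrable _ _)
      (hGc.stronglyMeasurableAtFilter _ _) hGc.continuousAt).const_add _
  rw [← hGg t ht]
  exact hd.hasDerivWithinAt.congr key (key t ht)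

end AbsolutelyContinuous

/-! ### Integral inequalities -/

section Inequalities

/-- Cauchy–Schwarz on an interval, in the form `(∫ ρ)² ≤ (t - s) ∫ ρ²`. -/
theorem sq_integral_le {ρ : ℝ → ℝ} {s t : ℝ} (hst : s ≤ t) (h1 : IntervalIntegrable ρ volume s t)
    (h2 : IntervalIntegrable (fun x => ρ x ^ 2) volume s t) :
    (∫ x in s..t, ρ x) ^ 2 ≤ (t - s) * ∫ x in s..t, ρ x ^ 2 := by
  rcases hst.eq_or_lt with rfl | hlt
  · simp
  set J := ∫ x in s..t, ρ x
  set c := J / (t - s) with hc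
  have hts : 0 < t - s := sub_pos.2 hlt
  have h3 : 0 ≤ ∫ x in s..t, (ρ x - c) ^ 2 :=
    intervalIntegral.integral_nonneg hst fun x _ => sq_nonneg _
  have h4 : ∫ x in s..t, (ρ x - c) ^ 2 = (∫ x in s..t, ρ x ^ 2) - 2 * c * J + (t - s) * c ^ 2 := by
    have : ∀ x, (ρ x - c) ^ 2 = (ρ x ^ 2 - 2 * c * ρ x) + c ^ 2 := fun x => by ring
    simp_rw [this]
    rw [intervalIntegral.integral_add (h2.sub (h1.const_mul _)) (by simp),
      intervalIntegral.integral_sub h2 (h1.const_mul _), intervalIntegral.integral_const_mul]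
    rw [intervalIntegral.integral_const, smul_eq_mul]
  have h5 : c * (t - s) = J := by rw [hc]; field_simp
  rw [h4] at h3
  have := mul_nonneg hts.le h3
  have h6 : (t - s) * ((∫ x in s..t, ρ x ^ 2) - 2 * c * J + (t - s) * c ^ 2)
      = (t - s) * (∫ x in s..t, ρ x ^ 2) - J ^ 2 := by
    rw [← h5]; ring
  linarith

/-- `L²` functions on `(0,1)` are integrable. -/
theorem integrableOn_of_sq {ρ : ℝ → ℝ} (hm : AEStronglyMeasurable ρ (volume.restrict (Ioo 0 1)))
    (h2 : IntegrableOn (fun x => ρ x ^ 2) (Ioo 0 1)) : IntegrableOn ρ (Ioo 0 1) := by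
  have h1 : IntegrableOn (fun x => ρ x ^ 2 + 1) (Ioo 0 1) :=
    h2.add (integrableOn_const (by simp))
  refine Integrable.mono' h1 hm (Eventually.of_forall fun x => ?_)
  rw [Real.norm_eq_abs]
  nlinarith [sq_abs (ρ x), sq_nonneg (|ρ x| - 1), abs_nonneg (ρ x)]

theorem integrableOn_of_lintegral_le {f : ℝ → ℝ} {R : ℝ≥0∞}
    (hm : AEStronglyMeasurable f (volume.restrict (Ioo 0 1)))
    (h0 : ∀ᵐ t ∂volume.restrict (Ioo (0 : ℝ) 1), 0 ≤ f t)
    (h : ∫⁻ t in Ioo (0 : ℝ) 1, ENNReal.ofReal (f t) ≤ R) (hR : R ≠ ⊤) :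
    IntegrableOn f (Ioo 0 1) := by
  refine ⟨hm, ?_⟩
  rw [hasFiniteIntegral_iff_ofReal h0]
  exact h.trans_lt hR.lt_top

/-- A Grönwall estimate for the logarithmic derivative: if `(f'/f)² ≤ 8 F` and `∫ F ≤ R`, then `f`
changes by a factor of at most `exp √(8 R |t - s|)`. The function `f` may vanish, and `F` need
not be measurable. -/
theorem le_exp_mul_of_logDeriv_sq_le {f : ℝ → ℝ} {F : ℝ → ℝ≥0∞} {R : ℝ}
    (hf : AbsolutelyContinuousOnInterval f 0 1) (h0 : ∀ t ∈ Icc (0 : ℝ) 1, 0 ≤ f t)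
    (hF : ∀ᵐ t ∂volume.restrict (Ioo (0 : ℝ) 1),
      ENNReal.ofReal ((deriv f t / f t) ^ 2) ≤ ENNReal.ofReal 8 * F t)
    (hR0 : 0 ≤ R) (hR : ∫⁻ t in Ioo (0 : ℝ) 1, F t ≤ ENNReal.ofReal R) {s t : ℝ}
    (hs : s ∈ Icc (0 : ℝ) 1) (ht : t ∈ Icc (0 : ℝ) 1) :
    f t ≤ Real.exp √(8 * R * |t - s|) * f s := by
  have h00 : (0 : ℝ) ∈ Icc (0 : ℝ) 1 := ⟨le_rfl, zero_le_one⟩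
  have h01 : (1 : ℝ) ∈ Icc (0 : ℝ) 1 := ⟨zero_le_one, le_rfl⟩
  have hcont : ContinuousOn f (Icc 0 1) := by
    have := hf.continuousOn; rwa [uIcc_of_le zero_le_one] at this
  set ρ : ℝ → ℝ := fun t => |deriv f t / f t| with hρ
  have hm : AEStronglyMeasurable ρ (volume.restrict (Ioo 0 1)) := by
    have h1 : AEMeasurable f (volume.restrict (Ioo 0 1)) :=
      (hcont.mono Ioo_subset_Icc_self).aemeasurable measurableSet_Ioo
    have h2 : AEMeasurable (deriv f) (volume.restrict (Ioo 0 1)) := (measurable_deriv f).aemeasurable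
    exact (h2.div h1).abs.aestronglyMeasurable
  have hbound : ∫⁻ t in Ioo (0 : ℝ) 1, ENNReal.ofReal (ρ t ^ 2) ≤ ENNReal.ofReal (8 * R) := by
    calc ∫⁻ t in Ioo (0 : ℝ) 1, ENNReal.ofReal (ρ t ^ 2)
        ≤ ∫⁻ t in Ioo (0 : ℝ) 1, ENNReal.ofReal 8 * F t := by
          refine lintegral_mono_ae ?_
          filter_upwards [hF] with t ht
          simpa [hρ, sq_abs] using ht
      _ = ENNReal.ofReal 8 * ∫⁻ t in Ioo (0 : ℝ) 1, F t :=
          lintegral_const_mul' _ _ ENNReal.ofReal_ne_top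
      _ ≤ ENNReal.ofReal 8 * ENNReal.ofReal R := by gcongr
      _ = ENNReal.ofReal (8 * R) := by rw [← ENNReal.ofReal_mul (by norm_num)]
  have hρ2 : IntegrableOn (fun t => ρ t ^ 2) (Ioo 0 1) :=
    integrableOn_of_lintegral_le (hm.pow 2) (Eventually.of_forall fun t => sq_nonneg _) hbound
      ENNReal.ofReal_ne_top
  have hρ1 : IntegrableOn ρ (Ioo 0 1) := integrableOn_of_sq hm hρ2
  have hint : ∀ x ∈ Icc (0 : ℝ) 1, ∀ y ∈ Icc (0 : ℝ) 1, x ≤ y →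
      ∫ z in x..y, ρ z ≤ √(8 * R * |y - x|) := by
    intro x hx y hy hxy
    refine Real.le_sqrt_of_sq_le ?_
    refine (sq_integral_le hxy (intervalIntegrable_of_Ioo hρ1 hx hy)
      (intervalIntegrable_of_Ioo hρ2 hx hy)).trans ?_
    rw [abs_of_nonneg (sub_nonneg.2 hxy), mul_comm]
    refine mul_le_mul_of_nonneg_right ?_ (sub_nonneg.2 hxy)
    have h1 : ∫ z in x..y, ρ z ^ 2 ≤ ∫ z in (0 : ℝ)..1, ρ z ^ 2 :=
      intervalIntegral.integral_mono_interval hx.1 hxy hy.2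
        (Eventually.of_forall fun z => sq_nonneg _) (intervalIntegrable_of_Ioo hρ2 h00 h01)
    have h2 : ENNReal.ofReal (∫ z in (0 : ℝ)..1, ρ z ^ 2) ≤ ENNReal.ofReal (8 * R) := by
      rw [← integral_Ioo_eq, ofReal_integral_eq_lintegral_ofReal hρ2
        (Eventually.of_forall fun z => sq_nonneg _)]
      exact hbound
    exact h1.trans ((ENNReal.ofReal_le_ofReal_iff (by positivity)).1 h2)
  -- The multiplicative derivative bound also holds where `f` vanishes, since `f` is minimal there.
  have hderiv : ∀ᵐ t ∂volume.restrict (Ioo (0 : ℝ) 1), |deriv f t| = ρ t * f t := by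
    rw [ae_restrict_iff' measurableSet_Ioo]
    refine Eventually.of_forall fun t ht => ?_
    have ht' := Ioo_subset_Icc_self ht
    rcases (h0 t ht').eq_or_lt with h | h
    · have hmin : IsLocalMin f t := by
        filter_upwards [Icc_mem_nhds ht.1 ht.2] with x hx
        rw [← h]; exact h0 x hx
      rw [hmin.deriv_eq_zero, ← h]; simp
    · rw [hρ]; simp only
      rw [abs_div, abs_of_pos h, div_mul_cancel₀ _ h.ne']
  set P : ℝ → ℝ := fun t => ∫ x in (0 : ℝ)..t, ρ x with hP
  have hPac : AbsolutelyContinuousOnInterval P 0 1 :=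
    (intervalIntegrable_of_Ioo hρ1 h00 h01).absolutelyContinuousOnInterval_intervalIntegral
      (by simp)
  have hPd : ∀ᵐ t ∂volume.restrict (Ioo (0 : ℝ) 1), HasDerivAt P (ρ t) t := by
    rw [ae_restrict_iff' measurableSet_Ioo]
    filter_upwards [(intervalIntegrable_of_Ioo hρ1 h00 h01).ae_hasDerivAt_integral] with x hx hx1
    have hx2 : x ∈ uIcc (0 : ℝ) 1 := by
      rw [uIcc_of_le zero_le_one]; exact Ioo_subset_Icc_self hx1
    exact hx hx2 0 (by simp)
  have hsub : ∀ x ∈ Icc (0 : ℝ) 1, ∀ y ∈ Icc (0 : ℝ) 1, P y - P x = ∫ z in x..y, ρ z :=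
    fun x hx y hy => intervalIntegral.integral_interval_sub_left
      (intervalIntegrable_of_Ioo hρ1 h00 hy) (intervalIntegrable_of_Ioo hρ1 h00 hx)
  have key : ∀ σ : ℝ, |σ| = 1 → AbsolutelyContinuousOnInterval
      (fun t => σ * (f t * Real.exp (-σ * P t))) 0 1 ∧ ∀ᵐ t ∂volume.restrict (Ioo (0 : ℝ) 1),
        deriv (fun t => σ * (f t * Real.exp (-σ * P t))) t ≤ 0 := by
    intro σ hσ
    constructor
    · exact ((hf.fun_mul (ac_comp_contDiff (hPac.const_mul (-σ)) Real.contDiff_exp)).const_mul σ)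
    · filter_upwards [ac_hasDerivAt hf, hPd, hderiv] with t h1 h2 h3
      have h4 := (h1.mul ((h2.const_mul (-σ)).exp)).const_mul σ
      have h5 : deriv (fun t => σ * (f t * Real.exp (-σ * P t))) t = _ := h4.deriv
      rw [h5]
      have h6 : σ * (deriv f t * Real.exp (-σ * P t) + f t * (Real.exp (-σ * P t) * (-σ * ρ t)))
          = (σ * deriv f t - (σ * σ) * (ρ t * f t)) * Real.exp (-σ * P t) := by ring
      have h7 : σ * σ = 1 := by rw [← abs_mul_abs_self, hσ]; norm_num
      have h8 : σ * deriv f t ≤ |deriv f t| := by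
        refine (le_abs_self _).trans ?_
        rw [abs_mul, hσ, one_mul]
      rw [h6, h7, ← h3]
      exact mul_nonpos_of_nonpos_of_nonneg (by linarith) (Real.exp_pos _).le
  rcases le_total s t with hst | hts
  · have h1 := ac_le_of_deriv_nonpos (key 1 (by norm_num)).1 (key 1 (by norm_num)).2 hs ht hst
    simp only [one_mul, neg_mul] at h1
    have h2 : f t ≤ Real.exp (P t - P s) * f s := by
      have := mul_le_mul_of_nonneg_right h1 (Real.exp_pos (P t)).le
      rw [mul_assoc, ← Real.exp_add, neg_add_cancel, Real.exp_zero, mul_one, mul_assoc,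
        ← Real.exp_add] at this
      rw [mul_comm, sub_eq_neg_add]; exact this
    refine h2.trans (mul_le_mul_of_nonneg_right (Real.exp_le_exp.2 ?_) (h0 s hs))
    rw [hsub s hs t ht]; exact hint s hs t ht hst
  · have h1 := ac_le_of_deriv_nonpos (key (-1) (by norm_num)).1 (key (-1) (by norm_num)).2 ht hs hts
    simp only [neg_mul, one_mul, neg_neg] at h1
    have h1' := neg_le_neg_iff.1 h1
    have h2 : f t ≤ Real.exp (P s - P t) * f s := by
      have := mul_le_mul_of_nonneg_right h1' (Real.exp_pos (-P t)).le
      rw [mul_assoc, ← Real.exp_add, add_neg_cancel, Real.exp_zero, mul_one, mul_assoc,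
        ← Real.exp_add] at this
      rw [mul_comm, sub_eq_add_neg]; exact this
    refine h2.trans (mul_le_mul_of_nonneg_right (Real.exp_le_exp.2 ?_) (h0 s hs))
    rw [hsub t ht s hs, abs_sub_comm]; exact hint t ht s hs hts

/-- Calibration: a lower bound of the density by a derivative is a lower bound of the integral. -/
theorem ofReal_sub_le_lintegral {Ψ f : ℝ → ℝ} (hΨ : AbsolutelyContinuousOnInterval Ψ 0 1)
    (h : ∀ᵐ t ∂volume.restrict (Ioo (0 : ℝ) 1), deriv Ψ t ≤ f t) :
    ENNReal.ofReal (Ψ 1 - Ψ 0) ≤ ∫⁻ t in Ioo (0 : ℝ) 1, ENNReal.ofReal (f t) := by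
  rw [← hΨ.integral_deriv_eq_sub, ← integral_Ioo_eq]
  have hi : IntegrableOn (deriv Ψ) (Ioo 0 1) :=
    (intervalIntegrable_iff_integrableOn_Ioo_of_le zero_le_one).1 hΨ.intervalIntegrable_deriv
  have h1 : ∫ t in Ioo (0 : ℝ) 1, deriv Ψ t ≤ ∫ t in Ioo (0 : ℝ) 1, max (deriv Ψ t) 0 :=
    integral_mono hi hi.pos_part fun t => le_max_left _ _
  refine (ENNReal.ofReal_le_ofReal h1).trans ?_
  rw [ofReal_integral_eq_lintegral_ofReal hi.pos_part
    (Eventually.of_forall fun t => le_max_right _ _)]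
  refine lintegral_mono_ae ?_
  filter_upwards [h] with t ht
  rw [ENNReal.ofReal_le_ofReal_iff']
  by_cases h0 : f t ≤ 0
  · right; exact max_le (ht.trans h0) le_rfl
  · left; exact max_le ht (not_le.1 h0).le

/-- The increments of a monotone function over disjoint intervals add up to at most its total
increment: the images of the intervals do not overlap. -/
theorem sum_sub_le_of_disjWithin {Φ : ℝ → ℝ} (hΦ : MonotoneOn Φ (Icc 0 1))
    {E : ℕ × (ℕ → ℝ × ℝ)} (hE : E ∈ AbsolutelyContinuousOnInterval.disjWithin 0 1) :
    ∑ i ∈ Finset.range E.1, |Φ (E.2 i).2 - Φ (E.2 i).1| ≤ Φ 1 - Φ 0 := by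
  have h00 : (0 : ℝ) ∈ Icc (0 : ℝ) 1 := ⟨le_rfl, zero_le_one⟩
  have h01 : (1 : ℝ) ∈ Icc (0 : ℝ) 1 := ⟨zero_le_one, le_rfl⟩
  obtain ⟨hE1, hE2⟩ := hE
  rw [uIcc_of_le zero_le_one] at hE1
  have hmm : ∀ i ∈ Finset.range E.1, min (E.2 i).1 (E.2 i).2 ∈ Icc (0 : ℝ) 1 ∧
      max (E.2 i).1 (E.2 i).2 ∈ Icc (0 : ℝ) 1 := fun i hi =>
    ⟨⟨le_min (hE1 i hi).1.1 (hE1 i hi).2.1, min_le_of_left_le (hE1 i hi).1.2⟩,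
      ⟨le_max_of_le_left (hE1 i hi).1.1, max_le (hE1 i hi).1.2 (hE1 i hi).2.2⟩⟩
  set I : ℕ → Set ℝ := fun i =>
    Ioo (Φ (min (E.2 i).1 (E.2 i).2)) (Φ (max (E.2 i).1 (E.2 i).2)) with hI
  have hvol : ∀ i ∈ Finset.range E.1,
      volume (I i) = ENNReal.ofReal |Φ (E.2 i).2 - Φ (E.2 i).1| := by
    intro i hi
    rw [hI, Real.volume_Ioo]
    congr 1
    rcases le_total (E.2 i).1 (E.2 i).2 with h | h
    · rw [max_eq_right h, min_eq_left h, abs_of_nonneg]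
      exact sub_nonneg.2 (hΦ (hE1 i hi).1 (hE1 i hi).2 h)
    · rw [max_eq_left h, min_eq_right h, abs_of_nonpos, neg_sub]
      exact sub_nonpos.2 (hΦ (hE1 i hi).2 (hE1 i hi).1 h)
  have hdisj : (Finset.range E.1 : Set ℕ).PairwiseDisjoint I := by
    intro i hi j hj hij
    have h := hE2 hi hj hij
    simp only [Function.onFun, uIoc] at h
    rw [Ioc_disjoint_Ioc] at h
    simp only [Function.onFun, hI]
    rw [Ioo_disjoint_Ioo]
    obtain ⟨a1, a2⟩ := hmm i hi
    obtain ⟨b1, b2⟩ := hmm j hj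
    rcases min_le_iff.1 h with h | h <;> rcases le_max_iff.1 h with h | h
    · exact (min_le_left _ _).trans ((hΦ a2 a1 h).trans (le_max_left _ _))
    · exact (min_le_left _ _).trans ((hΦ a2 b1 h).trans (le_max_right _ _))
    · exact (min_le_right _ _).trans ((hΦ b2 a1 h).trans (le_max_left _ _))
    · exact (min_le_right _ _).trans ((hΦ b2 b1 h).trans (le_max_right _ _))
  have hsub : (⋃ i ∈ Finset.range E.1, I i) ⊆ Icc (Φ 0) (Φ 1) := by
    refine iUnion₂_subset fun i hi x hx => ?_
    obtain ⟨a1, a2⟩ := hmm i hi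
    exact ⟨(hΦ h00 a1 a1.1).trans hx.1.le, hx.2.le.trans (hΦ a2 h01 a2.2)⟩
  have hle := measure_mono (μ := volume) hsub
  rw [measure_biUnion_finset hdisj (fun i _ => measurableSet_Ioo), Finset.sum_congr rfl hvol,
    ← ENNReal.ofReal_sum_of_nonneg (fun _ _ => abs_nonneg _), Real.volume_Icc,
    ENNReal.ofReal_le_ofReal_iff (sub_nonneg.2 (hΦ h00 h01 zero_le_one))] at hle
  exact hle

/-- A function whose squared increments over `[s,t]` are at most `c (t - s) (Φ t - Φ s)`, for a
monotone `Φ`, is absolutely continuous: it lies in the Sobolev space `H¹`. -/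
theorem ac_of_sq_le_monotone {f Φ : ℝ → ℝ} {c : ℝ} (hc : 0 ≤ c) (hΦ : MonotoneOn Φ (Icc 0 1))
    (hf : ∀ s ∈ Icc (0 : ℝ) 1, ∀ t ∈ Icc (0 : ℝ) 1, s ≤ t →
      (f t - f s) ^ 2 ≤ c * ((t - s) * (Φ t - Φ s))) :
    AbsolutelyContinuousOnInterval f 0 1 := by
  have h00 : (0 : ℝ) ∈ Icc (0 : ℝ) 1 := ⟨le_rfl, zero_le_one⟩
  have h01 : (1 : ℝ) ∈ Icc (0 : ℝ) 1 := ⟨zero_le_one, le_rfl⟩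
  have hV : 0 ≤ Φ 1 - Φ 0 := sub_nonneg.2 (hΦ h00 h01 zero_le_one)
  have hf' : ∀ s ∈ Icc (0 : ℝ) 1, ∀ t ∈ Icc (0 : ℝ) 1,
      dist (f s) (f t) ≤ √c * (√(dist s t) * √|Φ t - Φ s|) := by
    intro s hs t ht
    rw [← Real.sqrt_mul dist_nonneg, ← Real.sqrt_mul hc]
    refine Real.le_sqrt_of_sq_le ?_
    rw [Real.dist_eq, sq_abs, Real.dist_eq]
    rcases le_total s t with h | h
    · rw [abs_sub_comm, abs_of_nonneg (sub_nonneg.2 h), abs_of_nonneg (sub_nonneg.2 (hΦ hs ht h))]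
      have := hf s hs t ht h
      nlinarith
    · rw [abs_of_nonneg (sub_nonneg.2 h), abs_sub_comm,
        abs_of_nonneg (sub_nonneg.2 (hΦ ht hs h))]
      exact hf t ht s hs h
  unfold AbsolutelyContinuousOnInterval
  have hlen : Tendsto (fun E : ℕ × (ℕ → ℝ × ℝ) =>
      √c * (√(∑ i ∈ Finset.range E.1, dist (E.2 i).1 (E.2 i).2) * √(Φ 1 - Φ 0)))
      (AbsolutelyContinuousOnInterval.totalLengthFilter ⊓
        𝓟 (AbsolutelyContinuousOnInterval.disjWithin 0 1)) (𝓝 0) := by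
    have h1 : Tendsto (fun E : ℕ × (ℕ → ℝ × ℝ) =>
        ∑ i ∈ Finset.range E.1, dist (E.2 i).1 (E.2 i).2)
        AbsolutelyContinuousOnInterval.totalLengthFilter (𝓝 0) := tendsto_comap
    have h2 := ((Real.continuous_sqrt.tendsto _).comp
      (h1.mono_left (inf_le_left (b := 𝓟 (AbsolutelyContinuousOnInterval.disjWithin 0 1))))
      |>.mul_const √(Φ 1 - Φ 0)).const_mul √c
    simpa using h2
  refine squeeze_zero' (Eventually.of_forall fun E => Finset.sum_nonneg fun _ _ => dist_nonneg)
    ?_ hlen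
  refine mem_inf_of_right fun E hE => ?_
  have hE1 := hE.1
  rw [uIcc_of_le zero_le_one] at hE1
  calc ∑ i ∈ Finset.range E.1, dist (f (E.2 i).1) (f (E.2 i).2)
      ≤ ∑ i ∈ Finset.range E.1,
          √c * (√(dist (E.2 i).1 (E.2 i).2) * √|Φ (E.2 i).2 - Φ (E.2 i).1|) :=
        Finset.sum_le_sum fun i hi => hf' _ (hE1 i hi).1 _ (hE1 i hi).2
    _ = √c * ∑ i ∈ Finset.range E.1,
          √(dist (E.2 i).1 (E.2 i).2) * √|Φ (E.2 i).2 - Φ (E.2 i).1| := by rw [Finset.mul_sum]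
    _ ≤ √c * (√(∑ i ∈ Finset.range E.1, dist (E.2 i).1 (E.2 i).2) *
          √(∑ i ∈ Finset.range E.1, |Φ (E.2 i).2 - Φ (E.2 i).1|)) := by
        gcongr
        exact Real.sum_sqrt_mul_sqrt_le _ (fun _ => dist_nonneg) (fun _ => abs_nonneg _)
    _ ≤ _ := by
        gcongr
        exact sum_sub_le_of_disjWithin hΦ hE

/-- The du Bois-Reymond lemma for an exactly quadratic perturbation of the energy: if the density
`f` may be changed to `f + φ' ℓ + φ'² Q` for each `φ` that vanishes at the end points, and this
never lowers the integral, then `ℓ` is constant. -/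
theorem ae_const_of_variation {f ℓ Q : ℝ → ℝ} {M : ℝ}
    (hf : IntegrableOn f (Ioo 0 1)) (hf0 : ∀ᵐ t ∂volume.restrict (Ioo (0 : ℝ) 1), 0 ≤ f t)
    (hℓ : AEStronglyMeasurable ℓ (volume.restrict (Ioo 0 1)))
    (hQ : AEStronglyMeasurable Q (volume.restrict (Ioo 0 1)))
    (hQ0 : ∀ᵐ t ∂volume.restrict (Ioo (0 : ℝ) 1), 0 ≤ Q t ∧ Q t ≤ M)
    (hℓf : ∀ᵐ t ∂volume.restrict (Ioo (0 : ℝ) 1), ℓ t ^ 2 ≤ 4 * f t * Q t)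
    (hvar : ∀ φ : ℝ → ℝ, AbsolutelyContinuousOnInterval φ 0 1 → φ 0 = 0 → φ 1 = 0 →
      ∫⁻ t in Ioo (0 : ℝ) 1, ENNReal.ofReal (f t) ≤
      ∫⁻ t in Ioo (0 : ℝ) 1,
        ENNReal.ofReal (f t + deriv φ t * ℓ t + deriv φ t ^ 2 * Q t)) :
    ∃ c, ∀ᵐ t ∂volume.restrict (Ioo (0 : ℝ) 1), ℓ t = c := by
  have h00 : (0 : ℝ) ∈ Icc (0 : ℝ) 1 := ⟨le_rfl, zero_le_one⟩
  have h01 : (1 : ℝ) ∈ Icc (0 : ℝ) 1 := ⟨zero_le_one, le_rfl⟩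
  have hℓ2 : IntegrableOn (fun t => ℓ t ^ 2) (Ioo 0 1) := by
    refine Integrable.mono' (hf.const_mul (4 * M)) (hℓ.pow 2) ?_
    filter_upwards [hf0, hQ0, hℓf] with t h1 h2 h3
    rw [Real.norm_eq_abs, abs_of_nonneg (sq_nonneg _)]
    nlinarith [mul_le_mul_of_nonneg_left h2.2 h1]
  have hℓ1 := integrableOn_of_sq hℓ hℓ2
  set c : ℝ := ∫ t in Ioo (0 : ℝ) 1, ℓ t with hc
  set ψ : ℝ → ℝ := fun t => ℓ t - c with hψ
  have hconst : ∀ k : ℝ, IntegrableOn (fun _ : ℝ => k) (Ioo (0 : ℝ) 1) := fun k =>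
    integrableOn_const (by simp)
  have hψ1 : IntegrableOn ψ (Ioo 0 1) := hℓ1.sub (hconst c)
  have hψ0 : ∫ t in Ioo (0 : ℝ) 1, ψ t = 0 := by
    rw [hψ, integral_sub hℓ1 (hconst c)]; simp [hc]
  have hψ2 : IntegrableOn (fun t => ψ t ^ 2) (Ioo 0 1) := by
    have : (fun t => ψ t ^ 2) = fun t => ℓ t ^ 2 - 2 * c * ℓ t + c ^ 2 := by
      funext t; simp only [hψ]; ring
    rw [this]
    exact (hℓ2.sub (hℓ1.const_mul _)).add (hconst _)
  have hψℓ : IntegrableOn (fun t => ψ t * ℓ t) (Ioo 0 1) := by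
    have : (fun t => ψ t * ℓ t) = fun t => ℓ t ^ 2 - c * ℓ t := by
      funext t; simp only [hψ]; ring
    rw [this]
    exact hℓ2.sub (hℓ1.const_mul _)
  have hψQ : IntegrableOn (fun t => ψ t ^ 2 * Q t) (Ioo 0 1) := by
    refine Integrable.mono' (hψ2.const_mul M) ((hψ1.1.pow 2).mul hQ) ?_
    filter_upwards [hQ0] with t h2
    rw [Real.norm_eq_abs, abs_of_nonneg (mul_nonneg (sq_nonneg _) h2.1)]
    nlinarith [mul_le_mul_of_nonneg_left h2.2 (sq_nonneg (ψ t))]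
  set A := ∫ t in Ioo (0 : ℝ) 1, ψ t * ℓ t with hA
  set B := ∫ t in Ioo (0 : ℝ) 1, ψ t ^ 2 * Q t with hB
  have key : ∀ ε : ℝ, 0 ≤ ε * A + ε ^ 2 * B := by
    intro ε
    set φ : ℝ → ℝ := fun t => ε * ∫ x in (0 : ℝ)..t, ψ x with hφ
    have hφac : AbsolutelyContinuousOnInterval φ 0 1 :=
      ((intervalIntegrable_of_Ioo hψ1 h00 h01).absolutelyContinuousOnInterval_intervalIntegral
        (by simp)).const_mul ε
    have hφd : ∀ᵐ t ∂volume.restrict (Ioo (0 : ℝ) 1), deriv φ t = ε * ψ t := by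
      rw [ae_restrict_iff' measurableSet_Ioo]
      filter_upwards [(intervalIntegrable_of_Ioo hψ1 h00 h01).ae_hasDerivAt_integral]
        with x hx hx1
      have hx2 : x ∈ uIcc (0 : ℝ) 1 := by
        rw [uIcc_of_le zero_le_one]; exact Ioo_subset_Icc_self hx1
      exact ((hx hx2 0 (by simp)).const_mul ε).deriv
    have h := hvar φ hφac (by simp [hφ]) (by
      simp only [hφ]; rw [← integral_Ioo_eq, hψ0, mul_zero])
    have hint : IntegrableOn (fun t => f t + ε * (ψ t * ℓ t) + ε ^ 2 * (ψ t ^ 2 * Q t))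
        (Ioo 0 1) := (hf.add (hψℓ.const_mul ε)).add (hψQ.const_mul _)
    have hnn : ∀ᵐ t ∂volume.restrict (Ioo (0 : ℝ) 1),
        0 ≤ f t + ε * (ψ t * ℓ t) + ε ^ 2 * (ψ t ^ 2 * Q t) := by
      filter_upwards [hf0, hQ0, hℓf] with t h1 h2 h3
      -- A quadratic polynomial in `x = ε ψ` with nonpositive discriminant.
      set x := ε * ψ t
      have e : f t + ε * (ψ t * ℓ t) + ε ^ 2 * (ψ t ^ 2 * Q t) = f t + x * ℓ t + x ^ 2 * Q t := by
        simp only [x]; ring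
      rw [e]
      rcases h1.eq_or_lt with h1 | h1
      · have : ℓ t = 0 := by
          rw [← h1] at h3
          exact pow_eq_zero_iff (two_ne_zero) |>.1 (le_antisymm (by simpa using h3) (sq_nonneg _))
        rw [this, ← h1]
        have := mul_nonneg (sq_nonneg x) h2.1
        linarith
      · have : 0 ≤ 4 * f t * (f t + x * ℓ t + x ^ 2 * Q t) := by
          nlinarith [sq_nonneg (2 * f t + x * ℓ t), mul_le_mul_of_nonneg_left h3 (sq_nonneg x)]
        exact nonneg_of_mul_nonneg_right this (by linarith)
    have h' : ∫⁻ t in Ioo (0 : ℝ) 1, ENNReal.ofReal (f t) ≤ ∫⁻ t in Ioo (0 : ℝ) 1,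
        ENNReal.ofReal (f t + ε * (ψ t * ℓ t) + ε ^ 2 * (ψ t ^ 2 * Q t)) := by
      refine h.trans_eq (lintegral_congr_ae ?_)
      filter_upwards [hφd] with t ht
      rw [ht]; congr 1; ring
    have hint1 : IntegrableOn (fun t => f t + ε * (ψ t * ℓ t)) (Ioo 0 1) :=
      hf.add (hψℓ.const_mul ε)
    rw [← ofReal_integral_eq_lintegral_ofReal hf hf0,
      ← ofReal_integral_eq_lintegral_ofReal hint hnn,
      ENNReal.ofReal_le_ofReal_iff (integral_nonneg_of_ae hnn),
      integral_add hint1 (hψQ.const_mul _),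
      integral_add hf (hψℓ.const_mul ε), integral_const_mul, integral_const_mul] at h'
    linarith
  have hA0 : A = 0 := by
    have hB0 : 0 ≤ B := integral_nonneg_of_ae (by
      filter_upwards [hQ0] with t h2
      exact mul_nonneg (sq_nonneg _) h2.1)
    have h := key (-A / (B + 1))
    have h2 : (-A / (B + 1)) * A + (-A / (B + 1)) ^ 2 * B = -(A ^ 2) / (B + 1) ^ 2 := by
      field_simp; ring
    rw [h2] at h
    have h3 : 0 ≤ A ^ 2 / (B + 1) ^ 2 := by positivity
    have h4 : A ^ 2 / (B + 1) ^ 2 = 0 := le_antisymm (by rw [neg_div] at h; linarith) h3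
    have h5 : (B + 1) ^ 2 ≠ 0 := by positivity
    rcases div_eq_zero_iff.1 h4 with h6 | h6
    · exact pow_eq_zero_iff (two_ne_zero) |>.1 h6
    · exact absurd h6 h5
  have hsq : ∫ t in Ioo (0 : ℝ) 1, ψ t ^ 2 = 0 := by
    have : (fun t => ψ t ^ 2) = fun t => ψ t * ℓ t - c * ψ t := by
      funext t; simp only [hψ]; ring
    rw [this, integral_sub hψℓ (hψ1.const_mul c), integral_const_mul, hψ0, ← hA, hA0]; simp
  refine ⟨c, ?_⟩
  have := (integral_eq_zero_iff_of_nonneg (fun t => sq_nonneg (ψ t)) hψ2).1 hsq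
  filter_upwards [this] with t ht
  have : ψ t = 0 := by simpa using ht
  simp only [hψ] at this
  linarith

end Inequalities

/-! ### The quadratic form of the action density -/

theorem posSemidef_transpose_eq {ι : Type*} {A : Matrix ι ι ℝ} (hA : A.PosSemidef) :
    Aᵀ = A := by
  have := hA.1.eq
  rwa [conjTranspose_eq_transpose_of_trivial] at this

section Density

variable {ι κ : Type*} [Fintype ι] [Fintype κ]

/-- The action density `½ ⟨v, A v⟩ + ⅛ tr (X A X A)` as a function of the (generalized) inverse `A`
of the covariance. -/
noncomputable def dens (A : Matrix ι ι ℝ) (v : ι → ℝ) (X : Matrix ι ι ℝ) : ℝ :=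
  (1 / 2) * (v ⬝ᵥ (A *ᵥ v)) + (1 / 8) * (X * A * X * A).trace

/-- The derivative of `s ↦ dens A (v + s w) (X + s Y)` at `s = 0`. -/
noncomputable def densPolar (A : Matrix ι ι ℝ) (v : ι → ℝ) (X : Matrix ι ι ℝ) (w : ι → ℝ)
    (Y : Matrix ι ι ℝ) : ℝ :=
  v ⬝ᵥ (A *ᵥ w) + (1 / 4) * (X * A * Y * A).trace

theorem posSemidef_nonneg {A : Matrix ι ι ℝ} (hA : A.PosSemidef) (v : ι → ℝ) :
    0 ≤ v ⬝ᵥ (A *ᵥ v) := by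
  simpa using hA.dotProduct_mulVec_nonneg v

theorem posDef_pos {A : Matrix ι ι ℝ} (hA : A.PosDef) {v : ι → ℝ} (hv : v ≠ 0) :
    0 < v ⬝ᵥ (A *ᵥ v) := by
  simpa using hA.dotProduct_mulVec_pos hv

theorem posSemidef_of_nonneg {A : Matrix ι ι ℝ} (h1 : Aᵀ = A)
    (h : ∀ v : ι → ℝ, 0 ≤ v ⬝ᵥ (A *ᵥ v)) : A.PosSemidef :=
  PosSemidef.of_dotProduct_mulVec_nonneg
    (by rw [IsHermitian, conjTranspose_eq_transpose_of_trivial, h1]) (by simpa using h)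

theorem posDef_of_pos {A : Matrix ι ι ℝ} (h1 : Aᵀ = A)
    (h : ∀ v : ι → ℝ, v ≠ 0 → 0 < v ⬝ᵥ (A *ᵥ v)) : A.PosDef :=
  PosDef.of_dotProduct_mulVec_pos
    (by rw [IsHermitian, conjTranspose_eq_transpose_of_trivial, h1])
    (by intro x hx; simpa using h x hx)

theorem posSemidef_congr_mul {A : Matrix ι ι ℝ} (hA : A.PosSemidef) (X : Matrix ι κ ℝ) :
    (Xᵀ * A * X).PosSemidef := by
  have := hA.conjTranspose_mul_mul_same X
  rwa [conjTranspose_eq_transpose_of_trivial] at this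

theorem dotProduct_mulVec_comm {A : Matrix ι ι ℝ} (hA : Aᵀ = A) (u v : ι → ℝ) :
    u ⬝ᵥ (A *ᵥ v) = v ⬝ᵥ (A *ᵥ u) := by
  rw [dotProduct_mulVec, ← mulVec_transpose, hA, dotProduct_comm]

theorem dotProduct_congr (A : Matrix ι ι ℝ) (V : Matrix ι κ ℝ) (v w : κ → ℝ) :
    (V *ᵥ v) ⬝ᵥ (A *ᵥ (V *ᵥ w)) = v ⬝ᵥ ((Vᵀ * A * V) *ᵥ w) := by
  rw [← mulVec_mulVec, ← mulVec_mulVec, dotProduct_mulVec v, vecMul_transpose]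

theorem trace_mul_nonneg [DecidableEq ι] {A B : Matrix ι ι ℝ} (hA : A.PosSemidef)
    (hB : B.PosSemidef) : 0 ≤ (A * B).trace := by
  open scoped MatrixOrder in
  obtain ⟨C, rfl⟩ := CStarAlgebra.nonneg_iff_eq_star_mul_self.mp hB.nonneg
  rw [← Matrix.mul_assoc, trace_mul_comm, ← Matrix.mul_assoc, star_eq_conjTranspose]
  exact (hA.mul_mul_conjTranspose_same C).trace_nonneg

theorem trace_form_comm {A : Matrix ι ι ℝ} (X Y : Matrix ι ι ℝ) :
    (X * A * Y * A).trace = (Y * A * X * A).trace := by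
  rw [Matrix.mul_assoc (X * A), trace_mul_comm, ← Matrix.mul_assoc]

theorem dens_nonneg [DecidableEq ι] {A : Matrix ι ι ℝ} (hA : A.PosSemidef) (v : ι → ℝ)
    {X : Matrix ι ι ℝ} (hX : Xᵀ = X) : 0 ≤ dens A v X := by
  have h1 := posSemidef_nonneg hA v
  have h2 : 0 ≤ (X * A * X * A).trace := by
    have := posSemidef_congr_mul hA X
    rw [hX] at this
    exact trace_mul_nonneg this hA
  unfold dens; linarith

theorem trace_le_dens {A : Matrix ι ι ℝ} (hA : A.PosSemidef) (v : ι → ℝ) (X : Matrix ι ι ℝ) :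
    (X * A * X * A).trace ≤ 8 * dens A v X := by
  have h1 := posSemidef_nonneg hA v
  unfold dens; linarith

theorem dens_add_smul {A : Matrix ι ι ℝ} (hA : Aᵀ = A) (v w : ι → ℝ) (X Y : Matrix ι ι ℝ)
    (s : ℝ) : dens A (v + s • w) (X + s • Y)
      = dens A v X + s * densPolar A v X w Y + s ^ 2 * dens A w Y := by
  have h1 : (v + s • w) ⬝ᵥ (A *ᵥ (v + s • w))
      = v ⬝ᵥ (A *ᵥ v) + 2 * s * (v ⬝ᵥ (A *ᵥ w)) + s ^ 2 * (w ⬝ᵥ (A *ᵥ w)) := by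
    simp only [mulVec_add, mulVec_smul, add_dotProduct, dotProduct_add, smul_dotProduct,
      dotProduct_smul, smul_eq_mul, dotProduct_mulVec_comm hA w v]
    ring
  have h2 : ((X + s • Y) * A * (X + s • Y) * A).trace = (X * A * X * A).trace
      + 2 * s * (X * A * Y * A).trace + s ^ 2 * (Y * A * Y * A).trace := by
    simp only [Matrix.add_mul, Matrix.mul_add, Matrix.smul_mul, Matrix.mul_smul, trace_add,
      trace_smul, smul_eq_mul, trace_form_comm Y X]
    ring
  unfold dens densPolar
  rw [h1, h2]; ring

theorem dens_smul (A : Matrix ι ι ℝ) (v : ι → ℝ) (X : Matrix ι ι ℝ) (s : ℝ) :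
    dens A (s • v) (s • X) = s ^ 2 * dens A v X := by
  simp only [dens, mulVec_smul, smul_dotProduct, dotProduct_smul, Matrix.smul_mul,
    Matrix.mul_smul, trace_smul, smul_eq_mul]
  ring

theorem densPolar_sq_le [DecidableEq ι] {A : Matrix ι ι ℝ} (hA : A.PosSemidef) (v w : ι → ℝ)
    {X Y : Matrix ι ι ℝ} (hX : Xᵀ = X) (hY : Yᵀ = Y) :
    densPolar A v X w Y ^ 2 ≤ 4 * dens A v X * dens A w Y := by
  have h := discrim_le_zero (a := dens A w Y) (b := densPolar A v X w Y) (c := dens A v X)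
    fun s => by
      have h1 := dens_nonneg hA (v + s • w) (X := X + s • Y) (by simp [hX, hY])
      rw [dens_add_smul (posSemidef_transpose_eq hA)] at h1
      nlinarith
  rw [discrim] at h
  linarith

theorem densPolar_comm {A : Matrix ι ι ℝ} (hA : Aᵀ = A) (v w : ι → ℝ) (X Y : Matrix ι ι ℝ) :
    densPolar A v X w Y = densPolar A w Y v X := by
  rw [densPolar, densPolar, dotProduct_mulVec_comm hA, trace_form_comm]

theorem densPolar_self (A : Matrix ι ι ℝ) (v : ι → ℝ) (X : Matrix ι ι ℝ) :
    densPolar A v X v X = 2 * dens A v X := by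
  rw [densPolar, dens]; ring

theorem dens_congr (A : Matrix ι ι ℝ) (V : Matrix ι κ ℝ) (w : κ → ℝ) (Y : Matrix κ κ ℝ) :
    dens A (V *ᵥ w) (V * Y * Vᵀ) = dens (Vᵀ * A * V) w Y := by
  unfold dens
  rw [dotProduct_congr]
  congr 2
  rw [trace_mul_comm]
  calc (A * (V * Y * Vᵀ * A * (V * Y * Vᵀ))).trace
      = ((A * V) * (Y * (Vᵀ * A * V) * Y * Vᵀ)).trace := by simp only [Matrix.mul_assoc]
    _ = ((Y * (Vᵀ * A * V) * Y * Vᵀ) * (A * V)).trace := trace_mul_comm _ _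
    _ = _ := by simp only [Matrix.mul_assoc]

/-- The duality `(u · v)² ≤ ⟨u, K u⟩ ⟨v, K⁻¹ v⟩`. -/
theorem dotProduct_sq_le [DecidableEq ι] {K : Matrix ι ι ℝ} (hK : K.PosDef) (u v : ι → ℝ) :
    (u ⬝ᵥ v) ^ 2 ≤ (u ⬝ᵥ (K *ᵥ u)) * (v ⬝ᵥ (K⁻¹ *ᵥ v)) := by
  have hdet := (isUnit_iff_isUnit_det K).1 hK.isUnit
  have h := densPolar_sq_le hK.inv.posSemidef v (K *ᵥ u) (X := 0) (Y := 0) (by simp) (by simp)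
  simp only [densPolar, dens, mulVec_mulVec, nonsing_inv_mul K hdet, one_mulVec, Matrix.zero_mul,
    trace_zero, mul_zero, add_zero] at h
  rw [dotProduct_comm (K *ᵥ u) u, dotProduct_comm v u] at h
  linarith

/-- Symmetric matrices `X` with range in that of `K` satisfy
`⟨u, X w⟩² ≤ tr (X A X A) ⟨u, K u⟩ ⟨w, K w⟩`, where `A` is a generalized inverse of `K`. -/
theorem dotProduct_mulVec_sq_le [DecidableEq ι] {K A X : Matrix ι ι ℝ} (hK : K.PosSemidef)
    (hA : A.PosSemidef) (hX : Xᵀ = X) (hKAK : K * A * K = K) (hKAX : K * A * X = X)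
    (u w : ι → ℝ) :
    (u ⬝ᵥ (X *ᵥ w)) ^ 2 ≤ (X * A * X * A).trace * ((u ⬝ᵥ (K *ᵥ u)) * (w ⬝ᵥ (K *ᵥ w))) := by
  have hKt := posSemidef_transpose_eq hK
  have hAt := posSemidef_transpose_eq hA
  have hXAK : X * A * K = X := by
    have := congrArg transpose hKAX
    simpa [transpose_mul, hKt, hAt, hX, Matrix.mul_assoc] using this
  set S : Matrix ι ι ℝ := vecMulVec u w + vecMulVec w u with hS
  have hSt : Sᵀ = S := by simp [hS, transpose_vecMulVec, add_comm]
  set Y := K * S * K with hY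
  have hYt : Yᵀ = Y := by simp [hY, transpose_mul, hKt, hSt, Matrix.mul_assoc]
  have h := densPolar_sq_le hA 0 0 hX hYt
  have tr1 : ∀ M : Matrix ι ι ℝ, Mᵀ = M → (M * S).trace = 2 * (u ⬝ᵥ (M *ᵥ w)) := by
    intro M hM
    rw [hS, Matrix.mul_add, mul_vecMulVec, mul_vecMulVec, trace_add, trace_vecMulVec,
      trace_vecMulVec, dotProduct_comm (M *ᵥ u), dotProduct_comm (M *ᵥ w),
      dotProduct_mulVec_comm hM w u]
    ring
  have e1 : (X * A * Y * A).trace = 2 * (u ⬝ᵥ (X *ᵥ w)) := by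
    calc (X * A * Y * A).trace = ((X * A * K) * S * (K * A)).trace := by
          simp only [hY, Matrix.mul_assoc]
      _ = ((K * A) * (X * S)).trace := by rw [hXAK, trace_mul_comm]
      _ = (X * S).trace := by rw [← Matrix.mul_assoc, hKAX]
      _ = _ := tr1 X hX
  have e2 : (Y * A * Y * A).trace
      = 2 * ((u ⬝ᵥ (K *ᵥ u)) * (w ⬝ᵥ (K *ᵥ w)) + (u ⬝ᵥ (K *ᵥ w)) ^ 2) := by
    calc (Y * A * Y * A).trace = (K * S * (K * A * K) * S * (K * A)).trace := by
          simp only [hY, Matrix.mul_assoc]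
      _ = ((K * A * K) * S * K * S).trace := by
          rw [trace_mul_comm, hKAK]; simp only [← Matrix.mul_assoc]; rw [hKAK]
      _ = ((K * S * K) * S).trace := by rw [hKAK]
      _ = 2 * (u ⬝ᵥ (Y *ᵥ w)) := by rw [← hY, tr1 Y hYt]
      _ = _ := by
          rw [hY, hS]
          simp only [Matrix.mul_add, Matrix.add_mul, mul_vecMulVec, vecMulVec_mul, add_mulVec,
            vecMulVec_mulVec, dotProduct_add, ← mulVec_transpose, hKt]
          simp only [op_smul_eq_smul, dotProduct_smul, smul_eq_mul, dotProduct_comm (K *ᵥ w) w,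
            dotProduct_comm (K *ᵥ u) w, dotProduct_mulVec_comm hKt w u]
          ring
  simp only [densPolar, dens, e1, e2, zero_dotProduct, mul_zero, zero_add] at h
  set T := (X * A * X * A).trace
  -- The second summand of `e2` is at most the first one.
  have hT : 0 ≤ T := by
    have := dens_nonneg hA 0 hX
    simp only [dens, zero_dotProduct, mul_zero, zero_add] at this
    linarith
  have hc : (u ⬝ᵥ (K *ᵥ w)) ^ 2 ≤ (u ⬝ᵥ (K *ᵥ u)) * (w ⬝ᵥ (K *ᵥ w)) := by
    have h3 := densPolar_sq_le hK u w (X := 0) (Y := 0) (by simp) (by simp)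
    simp only [densPolar, dens, Matrix.zero_mul, trace_zero, mul_zero, add_zero] at h3
    linarith
  nlinarith [mul_le_mul_of_nonneg_left hc hT]

theorem dotProduct_mulVec_sq_le_of_posDef [DecidableEq ι] {K X : Matrix ι ι ℝ} (hK : K.PosDef)
    (hX : Xᵀ = X) (u w : ι → ℝ) :
    (u ⬝ᵥ (X *ᵥ w)) ^ 2 ≤
      (X * K⁻¹ * X * K⁻¹).trace * ((u ⬝ᵥ (K *ᵥ u)) * (w ⬝ᵥ (K *ᵥ w))) := by
  have hdet := (isUnit_iff_isUnit_det K).1 hK.isUnit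
  exact dotProduct_mulVec_sq_le hK.posSemidef hK.inv.posSemidef hX
    (by rw [mul_nonsing_inv K hdet, Matrix.one_mul])
    (by rw [mul_nonsing_inv K hdet, Matrix.one_mul]) u w

/-- The density is antitone in the covariance for the Loewner order. -/
theorem dens_inv_le [DecidableEq ι] {K L : Matrix ι ι ℝ} (hK : K.PosDef) (hL : L.PosDef) {c : ℝ}
    (hc : 1 ≤ c) (h : ∀ u : ι → ℝ, u ⬝ᵥ (K *ᵥ u) ≤ c * (u ⬝ᵥ (L *ᵥ u))) (v : ι → ℝ)
    {X : Matrix ι ι ℝ} (hX : Xᵀ = X) : dens L⁻¹ v X ≤ c ^ 2 * dens K⁻¹ v X := by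
  have hdet := (isUnit_iff_isUnit_det L).1 hL.isUnit
  have hc0 : 0 ≤ c := by linarith
  have hAp := hK.inv.posSemidef
  have hBp := hL.inv.posSemidef
  have key : ∀ v : ι → ℝ, v ⬝ᵥ (L⁻¹ *ᵥ v) ≤ c * (v ⬝ᵥ (K⁻¹ *ᵥ v)) := by
    intro v
    set u := L⁻¹ *ᵥ v with hu
    have h1 := dotProduct_sq_le hK u v
    have h2 := h u
    have h3 : L *ᵥ u = v := by rw [hu, mulVec_mulVec, mul_nonsing_inv L hdet, one_mulVec]
    rw [h3] at h2
    rw [dotProduct_comm v u]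
    have h4 : 0 ≤ u ⬝ᵥ v := by
      rw [dotProduct_comm]; exact posSemidef_nonneg hBp v
    have h5 := posSemidef_nonneg hAp v
    rcases h4.eq_or_lt with h4 | h4
    · rw [← h4]; exact mul_nonneg hc0 h5
    · have h6 : (u ⬝ᵥ v) * (u ⬝ᵥ v) ≤ (u ⬝ᵥ v) * (c * (v ⬝ᵥ (K⁻¹ *ᵥ v))) := by
        calc (u ⬝ᵥ v) * (u ⬝ᵥ v) = (u ⬝ᵥ v) ^ 2 := by ring
          _ ≤ _ := h1
          _ ≤ (c * (u ⬝ᵥ v)) * (v ⬝ᵥ (K⁻¹ *ᵥ v)) := mul_le_mul_of_nonneg_right h2 h5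
          _ = _ := by ring
      exact le_of_mul_le_mul_left h6 h4
  set A := K⁻¹
  set B := L⁻¹
  have hD : (c • A - B).PosSemidef := by
    refine posSemidef_of_nonneg ?_ fun v => ?_
    · rw [transpose_sub, transpose_smul, posSemidef_transpose_eq hAp,
        posSemidef_transpose_eq hBp]
    · rw [sub_mulVec, smul_mulVec, dotProduct_sub, dotProduct_smul, smul_eq_mul]
      linarith [key v]
  have tr : ∀ {M : Matrix ι ι ℝ}, M.PosSemidef → (X * M * X * B).trace ≤
      c * (X * M * X * A).trace := by
    intro M hM
    have h1 := posSemidef_congr_mul hM X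
    rw [hX] at h1
    have h2 := trace_mul_nonneg h1 hD
    rw [Matrix.mul_sub, trace_sub, Matrix.mul_smul, trace_smul, smul_eq_mul] at h2
    linarith
  have t1 := tr hBp
  have t2 := tr hAp
  have t3 := mul_le_mul_of_nonneg_left t2 hc0
  rw [trace_form_comm' X A B] at t3
  have h0 := posSemidef_nonneg hAp v
  have h1 := key v
  have h2 : c * (v ⬝ᵥ (A *ᵥ v)) ≤ c ^ 2 * (v ⬝ᵥ (A *ᵥ v)) :=
    mul_le_mul_of_nonneg_right (by nlinarith) h0
  unfold dens
  nlinarith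
where
  trace_form_comm' (X A B : Matrix ι ι ℝ) : (X * A * X * B).trace = (X * B * X * A).trace := by
    rw [Matrix.mul_assoc (X * A), trace_mul_comm, ← Matrix.mul_assoc]

end Density

/-! ### Curves of positive definite matrices -/

section MatrixDerivative

variable {ι κ ν : Type*} [Fintype κ]

/-- Entrywise differentiability of a matrix-valued function within a set. -/
def HasMatDeriv (K : ℝ → Matrix ι κ ℝ) (X : Matrix ι κ ℝ) (s : Set ℝ) (t : ℝ) : Prop :=
  ∀ i j, HasDerivWithinAt (fun r => K r i j) (X i j) s t

variable {s : Set ℝ} {t : ℝ}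

theorem hasMatDeriv_const (A : Matrix ι κ ℝ) : HasMatDeriv (fun _ => A) 0 s t :=
  fun _ _ => hasDerivWithinAt_const _ _ _

theorem HasMatDeriv.transpose {K : ℝ → Matrix ι κ ℝ} {X : Matrix ι κ ℝ}
    (h : HasMatDeriv K X s t) : HasMatDeriv (fun r => (K r)ᵀ) Xᵀ s t :=
  fun i j => h j i

theorem HasMatDeriv.mul {K : ℝ → Matrix ι κ ℝ} {L : ℝ → Matrix κ ν ℝ} {X : Matrix ι κ ℝ}
    {Y : Matrix κ ν ℝ} (hK : HasMatDeriv K X s t) (hL : HasMatDeriv L Y s t) :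
    HasMatDeriv (fun r => K r * L r) (X * L t + K t * Y) s t := by
  intro i j
  simp only [Matrix.add_apply, Matrix.mul_apply, ← Finset.sum_add_distrib]
  exact HasDerivWithinAt.fun_sum fun k _ => (hK i k).mul (hL k j)

theorem HasMatDeriv.mulVec {K : ℝ → Matrix ι κ ℝ} {n : ℝ → κ → ℝ} {X : Matrix ι κ ℝ}
    {v : κ → ℝ} (hK : HasMatDeriv K X s t) (hn : ∀ i, HasDerivWithinAt (fun r => n r i) (v i) s t)
    (i : ι) :
    HasDerivWithinAt (fun r => (K r *ᵥ n r) i) ((X *ᵥ n t + K t *ᵥ v) i) s t := by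
  simp only [Pi.add_apply, Matrix.mulVec, dotProduct, ← Finset.sum_add_distrib]
  exact HasDerivWithinAt.fun_sum fun k _ => (hK i k).mul (hn k)

theorem hasDerivWithinAt_dotProduct {v w : ℝ → κ → ℝ} {v' w' : κ → ℝ}
    (hv : ∀ i, HasDerivWithinAt (fun r => v r i) (v' i) s t)
    (hw : ∀ i, HasDerivWithinAt (fun r => w r i) (w' i) s t) :
    HasDerivWithinAt (fun r => v r ⬝ᵥ w r) (v' ⬝ᵥ w t + v t ⬝ᵥ w') s t := by
  simp only [dotProduct, ← Finset.sum_add_distrib]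
  exact HasDerivWithinAt.fun_sum fun k _ => (hv k).mul (hw k)

theorem hasDerivWithinAt_quad [Fintype ι] {K : ℝ → Matrix ι κ ℝ} {X : Matrix ι κ ℝ}
    (hK : HasMatDeriv K X s t) (u : ι → ℝ) (w : κ → ℝ) :
    HasDerivWithinAt (fun r => u ⬝ᵥ (K r *ᵥ w)) (u ⬝ᵥ (X *ᵥ w)) s t := by
  have := hasDerivWithinAt_dotProduct (v := fun _ => u) (w := fun r => K r *ᵥ w)
    (fun i => hasDerivWithinAt_const t s (u i))
    (hK.mulVec (n := fun _ => w) (v := 0) fun i => hasDerivWithinAt_const t s (w i))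
  simp only [mulVec_zero, add_zero] at this
  convert this using 1
  simp [dotProduct]

end MatrixDerivative

section Curves

variable {ι : Type*} [Fintype ι] [DecidableEq ι]

/-- The velocity of a curve of vectors, entry by entry. -/
noncomputable def vel (n : ℝ → ι → ℝ) (t : ℝ) : ι → ℝ := fun i => deriv (fun s => n s i) t

/-- The velocity of a curve of matrices, entry by entry. -/
noncomputable def velMat (K : ℝ → Matrix ι ι ℝ) (t : ℝ) : Matrix ι ι ℝ :=
  Matrix.of fun i j => deriv (fun s => K s i j) t

/-- An absolutely continuous curve of vectors and positive definite matrices on `[0,1]`. -/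
structure PosCurve (n : ℝ → ι → ℝ) (K : ℝ → Matrix ι ι ℝ) : Prop where
  ac_mean : ∀ i, AbsolutelyContinuousOnInterval (fun t => n t i) 0 1
  ac_cov : ∀ i j, AbsolutelyContinuousOnInterval (fun t => K t i j) 0 1
  posDef : ∀ t ∈ Icc (0 : ℝ) 1, (K t).PosDef

/-- The density of the action along a curve of vectors and positive definite matrices. -/
noncomputable def curveDens (n : ℝ → ι → ℝ) (K : ℝ → Matrix ι ι ℝ) (t : ℝ) : ℝ :=
  dens (K t)⁻¹ (vel n t) (velMat K t)

/-- The action of a curve of vectors and positive definite matrices. -/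
noncomputable def energy (n : ℝ → ι → ℝ) (K : ℝ → Matrix ι ι ℝ) : ℝ≥0∞ :=
  ∫⁻ t in Ioo (0 : ℝ) 1, ENNReal.ofReal (curveDens n K t)

variable {n : ℝ → ι → ℝ} {K : ℝ → Matrix ι ι ℝ}

theorem velMat_eq {X : Matrix ι ι ℝ} {t : ℝ} (h : HasMatDeriv K X univ t) : velMat K t = X := by
  ext i j
  exact (hasDerivWithinAt_univ.1 (h i j)).deriv

theorem vel_eq {v : ι → ℝ} {t : ℝ} (h : ∀ i, HasDerivWithinAt (fun r => n r i) (v i) univ t) :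
    vel n t = v := by
  ext i
  exact (hasDerivWithinAt_univ.1 (h i)).deriv

theorem ae_hasMatDeriv (h : ∀ i j, AbsolutelyContinuousOnInterval (fun t => K t i j) 0 1) :
    ∀ᵐ t ∂volume.restrict (Ioo (0 : ℝ) 1), HasMatDeriv K (velMat K t) univ t := by
  have : ∀ᵐ t ∂volume.restrict (Ioo (0 : ℝ) 1), ∀ i j,
      HasDerivAt (fun s => K s i j) (deriv (fun s => K s i j) t) t :=
    ae_all_iff.2 fun i => ae_all_iff.2 fun j => ac_hasDerivAt (h i j)
  filter_upwards [this] with t ht i j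
  exact (ht i j).hasDerivWithinAt

theorem ae_hasVecDeriv (h : ∀ i, AbsolutelyContinuousOnInterval (fun t => n t i) 0 1) :
    ∀ᵐ t ∂volume.restrict (Ioo (0 : ℝ) 1),
      ∀ i, HasDerivWithinAt (fun r => n r i) (vel n t i) univ t := by
  have : ∀ᵐ t ∂volume.restrict (Ioo (0 : ℝ) 1), ∀ i,
      HasDerivAt (fun s => n s i) (deriv (fun s => n s i) t) t :=
    ae_all_iff.2 fun i => ac_hasDerivAt (h i)
  filter_upwards [this] with t ht i
  exact (ht i).hasDerivWithinAt

theorem ae_Ioo_mem : ∀ᵐ t ∂volume.restrict (Ioo (0 : ℝ) 1), t ∈ Ioo (0 : ℝ) 1 :=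
  ae_restrict_mem measurableSet_Ioo

theorem ac_continuousOn {f : ℝ → ℝ} (hf : AbsolutelyContinuousOnInterval f 0 1) :
    ContinuousOn f (Icc 0 1) := by
  have := hf.continuousOn
  rwa [uIcc_of_le zero_le_one] at this

theorem velMat_transpose [Finite ι] {t : ℝ} (hK : ∀ᶠ s in 𝓝 t, (K s)ᵀ = K s) :
    (velMat K t)ᵀ = velMat K t := by
  ext i j
  simp only [Matrix.transpose_apply, velMat, Matrix.of_apply]
  refine EventuallyEq.deriv_eq ?_
  filter_upwards [hK] with s hs
  conv_lhs => rw [← hs]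
  rfl

namespace PosCurve

theorem symm (h : PosCurve n K) {t : ℝ} (ht : t ∈ Icc (0 : ℝ) 1) : (K t)ᵀ = K t :=
  posSemidef_transpose_eq (h.posDef t ht).posSemidef

theorem velMat_symm (h : PosCurve n K) {t : ℝ} (ht : t ∈ Ioo (0 : ℝ) 1) :
    (velMat K t)ᵀ = velMat K t :=
  velMat_transpose (by
    filter_upwards [Icc_mem_nhds ht.1 ht.2] with s hs
    exact h.symm hs)

theorem curveDens_nonneg (h : PosCurve n K) {t : ℝ} (ht : t ∈ Ioo (0 : ℝ) 1) :
    0 ≤ curveDens n K t :=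
  dens_nonneg (h.posDef t (Ioo_subset_Icc_self ht)).inv.posSemidef _ (h.velMat_symm ht)

theorem continuousOn_cov (h : PosCurve n K) : ContinuousOn K (Icc 0 1) :=
  continuousOn_pi.2 fun i => continuousOn_pi.2 fun j => ac_continuousOn (h.ac_cov i j)

theorem isUnit_det (h : PosCurve n K) {t : ℝ} (ht : t ∈ Icc (0 : ℝ) 1) : IsUnit (K t).det :=
  (isUnit_iff_isUnit_det _).1 (h.posDef t ht).isUnit

theorem continuousOn_inv (h : PosCurve n K) : ContinuousOn (fun t => (K t)⁻¹) (Icc 0 1) := by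
  have hc := h.continuousOn_cov
  have hdet : ContinuousOn (fun t => (K t).det) (Icc 0 1) :=
    (continuous_id.matrix_det).comp_continuousOn hc
  have hadj : ContinuousOn (fun t => (K t).adjugate) (Icc 0 1) :=
    (continuous_id.matrix_adjugate).comp_continuousOn hc
  refine ((hdet.inv₀ fun t ht => (h.isUnit_det ht).ne_zero).smul hadj).congr fun t _ => ?_
  rw [Matrix.inv_def, Ring.inverse_eq_inv']
  rfl

theorem continuousOn_inv_apply (h : PosCurve n K) (i j : ι) :
    ContinuousOn (fun t => (K t)⁻¹ i j) (Icc 0 1) :=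
  continuousOn_pi.1 (continuousOn_pi.1 h.continuousOn_inv i) j

end PosCurve

/-- Entrywise measurability on `(0,1)` of a matrix-valued function. -/
def AEMeasMat {κ : Type*} (A : ℝ → Matrix ι κ ℝ) : Prop :=
  ∀ i j, AEMeasurable (fun t => A t i j) (volume.restrict (Ioo (0 : ℝ) 1))

theorem AEMeasMat.mul {κ ν : Type*} {A : ℝ → Matrix κ ι ℝ} {B : ℝ → Matrix ι ν ℝ}
    (hA : AEMeasMat A) (hB : AEMeasMat B) : AEMeasMat fun t => A t * B t := by
  intro i j
  simp only [Matrix.mul_apply]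
  exact Finset.aemeasurable_fun_sum _ fun k _ => (hA i k).mul (hB k j)

theorem aemeasurable_dot {v w : ℝ → ι → ℝ}
    (hv : ∀ i, AEMeasurable (fun t => v t i) (volume.restrict (Ioo (0 : ℝ) 1)))
    (hw : ∀ i, AEMeasurable (fun t => w t i) (volume.restrict (Ioo (0 : ℝ) 1))) :
    AEMeasurable (fun t => v t ⬝ᵥ w t) (volume.restrict (Ioo (0 : ℝ) 1)) := by
  simp only [dotProduct]
  exact Finset.aemeasurable_fun_sum _ fun k _ => (hv k).mul (hw k)

theorem AEMeasMat.mulVec {κ : Type*} {A : ℝ → Matrix κ ι ℝ} {v : ℝ → ι → ℝ} (hA : AEMeasMat A)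
    (hv : ∀ i, AEMeasurable (fun t => v t i) (volume.restrict (Ioo (0 : ℝ) 1))) (i : κ) :
    AEMeasurable (fun t => (A t *ᵥ v t) i) (volume.restrict (Ioo (0 : ℝ) 1)) :=
  aemeasurable_dot (hA i) hv

theorem AEMeasMat.trace {A : ℝ → Matrix ι ι ℝ} (hA : AEMeasMat A) :
    AEMeasurable (fun t => (A t).trace) (volume.restrict (Ioo (0 : ℝ) 1)) := by
  simp only [Matrix.trace, Matrix.diag]
  exact Finset.aemeasurable_fun_sum _ fun k _ => hA k k

theorem aemeasurable_densPolar {A X Y : ℝ → Matrix ι ι ℝ} {v w : ℝ → ι → ℝ} (hA : AEMeasMat A)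
    (hX : AEMeasMat X) (hY : AEMeasMat Y)
    (hv : ∀ i, AEMeasurable (fun t => v t i) (volume.restrict (Ioo (0 : ℝ) 1)))
    (hw : ∀ i, AEMeasurable (fun t => w t i) (volume.restrict (Ioo (0 : ℝ) 1))) :
    AEMeasurable (fun t => densPolar (A t) (v t) (X t) (w t) (Y t))
      (volume.restrict (Ioo (0 : ℝ) 1)) := by
  unfold densPolar
  exact (aemeasurable_dot hv (hA.mulVec hw)).add
    ((((hX.mul hA).mul hY).mul hA).trace.const_mul _)

theorem aemeasurable_dens {A X : ℝ → Matrix ι ι ℝ} {v : ℝ → ι → ℝ} (hA : AEMeasMat A)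
    (hX : AEMeasMat X)
    (hv : ∀ i, AEMeasurable (fun t => v t i) (volume.restrict (Ioo (0 : ℝ) 1))) :
    AEMeasurable (fun t => dens (A t) (v t) (X t)) (volume.restrict (Ioo (0 : ℝ) 1)) := by
  have := (aemeasurable_densPolar hA hX hX hv hv).const_mul (1 / 2)
  refine this.congr (Eventually.of_forall fun t => ?_)
  simp only [densPolar_self]; ring

theorem aemeasurable_of_continuousOn {f : ℝ → ℝ} (hf : ContinuousOn f (Icc 0 1)) :
    AEMeasurable f (volume.restrict (Ioo (0 : ℝ) 1)) :=
  (hf.mono Ioo_subset_Icc_self).aemeasurable measurableSet_Ioo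

namespace PosCurve

theorem aeMeasMat_inv (h : PosCurve n K) : AEMeasMat fun t => (K t)⁻¹ := fun i j =>
  aemeasurable_of_continuousOn (h.continuousOn_inv_apply i j)

theorem aeMeasMat_cov (h : PosCurve n K) : AEMeasMat K := fun i j =>
  aemeasurable_of_continuousOn (ac_continuousOn (h.ac_cov i j))

end PosCurve

theorem aeMeasMat_velMat (K : ℝ → Matrix ι ι ℝ) : AEMeasMat (velMat K) := fun _ _ =>
  (measurable_deriv _).aemeasurable

theorem aemeasurable_vel (n : ℝ → ι → ℝ) (i : ι) :
    AEMeasurable (fun t => vel n t i) (volume.restrict (Ioo (0 : ℝ) 1)) :=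
  (measurable_deriv _).aemeasurable

namespace PosCurve

theorem aestronglyMeasurable_curveDens (h : PosCurve n K) :
    AEStronglyMeasurable (curveDens n K) (volume.restrict (Ioo (0 : ℝ) 1)) :=
  (aemeasurable_dens h.aeMeasMat_inv (aeMeasMat_velMat K) (aemeasurable_vel n)).aestronglyMeasurable

theorem ae_curveDens_nonneg (h : PosCurve n K) :
    ∀ᵐ t ∂volume.restrict (Ioo (0 : ℝ) 1), 0 ≤ curveDens n K t := by
  filter_upwards [ae_Ioo_mem] with t ht
  exact h.curveDens_nonneg ht

theorem integrableOn_curveDens (h : PosCurve n K) (hE : energy n K ≠ ⊤) :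
    IntegrableOn (curveDens n K) (Ioo 0 1) :=
  integrableOn_of_lintegral_le h.aestronglyMeasurable_curveDens h.ae_curveDens_nonneg le_rfl hE

theorem ac_quad (h : PosCurve n K) (u w : ι → ℝ) :
    AbsolutelyContinuousOnInterval (fun t => u ⬝ᵥ (K t *ᵥ w)) 0 1 := by
  simp only [dotProduct, Matrix.mulVec]
  exact ac_sum _ fun i _ => (ac_sum _ fun j _ => by
    simpa [mul_comm] using (h.ac_cov i j).const_mul (w j)).const_mul (u i)

/-- Along a curve of finite action, covariances at different times are comparable. -/
theorem quad_le (h : PosCurve n K) {R : ℝ} (hR0 : 0 ≤ R) (hR : energy n K ≤ ENNReal.ofReal R)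
    (u : ι → ℝ) {s t : ℝ} (hs : s ∈ Icc (0 : ℝ) 1) (ht : t ∈ Icc (0 : ℝ) 1) :
    u ⬝ᵥ (K t *ᵥ u) ≤ Real.exp √(8 * R * |t - s|) * (u ⬝ᵥ (K s *ᵥ u)) := by
  refine le_exp_mul_of_logDeriv_sq_le (f := fun t => u ⬝ᵥ (K t *ᵥ u))
    (F := fun t => ENNReal.ofReal (curveDens n K t)) (h.ac_quad u u)
    (fun r hr => posSemidef_nonneg (h.posDef r hr).posSemidef u) ?_ hR0 hR hs ht
  filter_upwards [ae_hasMatDeriv h.ac_cov, ae_Ioo_mem] with r hr hr1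
  have hr2 := Ioo_subset_Icc_self hr1
  have hd := (hasDerivWithinAt_univ.1 (hasDerivWithinAt_quad hr u u)).deriv
  rw [hd, ← ENNReal.ofReal_mul (by norm_num)]
  refine ENNReal.ofReal_le_ofReal ?_
  have hP := h.posDef r hr2
  have h1 := dotProduct_mulVec_sq_le_of_posDef hP (h.velMat_symm hr1) u u
  have h2 := trace_le_dens hP.inv.posSemidef (vel n r) (velMat K r)
  have h3 := h.curveDens_nonneg hr1
  have h4 := posSemidef_nonneg hP.posSemidef u
  rcases h4.eq_or_lt with h4 | h4
  · rw [← h4]; simp; exact h3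
  · rw [div_pow, div_le_iff₀ (by positivity)]
    refine h1.trans ?_
    rw [← pow_two]
    exact mul_le_mul_of_nonneg_right h2 (by positivity)

end PosCurve

/-- The action may be computed with any velocities that are derivatives almost everywhere. -/
theorem energy_eq {v : ℝ → ι → ℝ} {X : ℝ → Matrix ι ι ℝ}
    (h : ∀ᵐ t ∂volume.restrict (Ioo (0 : ℝ) 1),
      (∀ i, HasDerivWithinAt (fun r => n r i) (v t i) univ t) ∧ HasMatDeriv K (X t) univ t) :
    energy n K = ∫⁻ t in Ioo (0 : ℝ) 1, ENNReal.ofReal (dens (K t)⁻¹ (v t) (X t)) := by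
  refine lintegral_congr_ae ?_
  filter_upwards [h] with t ht
  rw [curveDens, vel_eq ht.1, velMat_eq ht.2]

end Curves

/-! ### Existence of minimizers -/

section Existence

variable {ι : Type*} [Fintype ι] [DecidableEq ι]

theorem dens_zero (A : Matrix ι ι ℝ) : dens A 0 0 = 0 := by simp [dens]

theorem single_dotProduct_mulVec_single (A : Matrix ι ι ℝ) (i j : ι) :
    (Pi.single i 1 : ι → ℝ) ⬝ᵥ (A *ᵥ Pi.single j 1) = A i j := by
  simp

theorem posSemidef_cauchy {K : Matrix ι ι ℝ} (hK : K.PosSemidef) (u w : ι → ℝ) :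
    (u ⬝ᵥ (K *ᵥ w)) ^ 2 ≤ (u ⬝ᵥ (K *ᵥ u)) * (w ⬝ᵥ (K *ᵥ w)) := by
  have h3 := densPolar_sq_le hK u w (X := 0) (Y := 0) (by simp) (by simp)
  simp only [densPolar, dens, Matrix.zero_mul, trace_zero, mul_zero, add_zero] at h3
  linarith

theorem sq_apply_le_of_posDef {K : Matrix ι ι ℝ} (hK : K.PosDef) (v : ι → ℝ) {X : Matrix ι ι ℝ}
    (hX : Xᵀ = X) (i : ι) : v i ^ 2 ≤ K i i * (2 * dens K⁻¹ v X) := by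
  have h := dotProduct_sq_le hK (Pi.single i 1) v
  rw [single_dotProduct_mulVec_single, single_dotProduct, one_mul] at h
  refine h.trans (mul_le_mul_of_nonneg_left ?_ hK.posSemidef.diag_nonneg)
  have h2 := dens_nonneg hK.inv.posSemidef 0 hX
  simp only [dens, zero_dotProduct, mul_zero, zero_add] at h2
  unfold dens; linarith

theorem sq_entry_le_of_posDef {K : Matrix ι ι ℝ} (hK : K.PosDef) (v : ι → ℝ) {X : Matrix ι ι ℝ}
    (hX : Xᵀ = X) (i j : ι) : X i j ^ 2 ≤ K i i * K j j * (8 * dens K⁻¹ v X) := by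
  have h := dotProduct_mulVec_sq_le_of_posDef hK hX (Pi.single i 1) (Pi.single j 1)
  simp only [single_dotProduct_mulVec_single] at h
  rw [mul_comm] at h
  exact h.trans (mul_le_mul_of_nonneg_left (trace_le_dens hK.inv.posSemidef v X)
    (mul_nonneg hK.posSemidef.diag_nonneg hK.posSemidef.diag_nonneg))

variable {n : ℝ → ι → ℝ} {K : ℝ → Matrix ι ι ℝ}

theorem densPolar_eq_sum (A : Matrix ι ι ℝ) (v w : ι → ℝ) (X Y : Matrix ι ι ℝ) :
    densPolar A v X w Y =
      ∑ i, v i * (A *ᵥ w) i + ∑ i, ∑ j, X i j * ((1 / 4) * (A * Y * A) j i) := by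
  rw [densPolar, Matrix.mul_assoc X, Matrix.mul_assoc X]
  have h : ∀ M : Matrix ι ι ℝ, (X * M).trace = ∑ i, ∑ j, X i j * M j i := fun M => by
    simp only [Matrix.trace, Matrix.diag, Matrix.mul_apply]
  rw [h, Finset.mul_sum]
  congr 1
  refine Finset.sum_congr rfl fun i _ => ?_
  rw [Finset.mul_sum]
  exact Finset.sum_congr rfl fun j _ => by ring

theorem hasDerivWithinAt_densPolar {v : ι → ℝ} {X : Matrix ι ι ℝ} {s : Set ℝ} {t : ℝ}
    (hn : ∀ i, HasDerivWithinAt (fun r => n r i) (v i) s t) (hK : HasMatDeriv K X s t)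
    (A : Matrix ι ι ℝ) (w : ι → ℝ) (Y : Matrix ι ι ℝ) :
    HasDerivWithinAt (fun r => densPolar A (n r) (K r) w Y) (densPolar A v X w Y) s t := by
  simp only [densPolar_eq_sum]
  exact (HasDerivWithinAt.fun_sum fun i _ => (hn i).mul_const _).add
    (HasDerivWithinAt.fun_sum fun i _ => HasDerivWithinAt.fun_sum fun j _ => (hK i j).mul_const _)

theorem PosCurve.ac_densPolar (h : PosCurve n K) (A : Matrix ι ι ℝ) (w : ι → ℝ)
    (Y : Matrix ι ι ℝ) :
    AbsolutelyContinuousOnInterval (fun r => densPolar A (n r) (K r) w Y) 0 1 := by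
  simp only [densPolar_eq_sum]
  refine (ac_sum _ fun i _ => ?_).fun_add (ac_sum _ fun i _ => ac_sum _ fun j _ => ?_)
  · simpa only [mul_comm] using (h.ac_mean i).const_mul ((A *ᵥ w) i)
  · simpa only [mul_comm] using (h.ac_cov i j).const_mul ((1 / 4) * (A * Y * A) j i)

theorem densPolar_sub (A : Matrix ι ι ℝ) (v v' w : ι → ℝ) (X X' Y : Matrix ι ι ℝ) :
    densPolar A (v - v') (X - X') w Y = densPolar A v X w Y - densPolar A v' X' w Y := by
  simp only [densPolar, sub_dotProduct, Matrix.sub_mul, trace_sub]; ring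

/-- The increments of a curve, measured by the quadratic form at the initial time, are controlled
by the action. This is Jensen's inequality, together with the comparability of the forms. -/
theorem PosCurve.dens_sub_le (h : PosCurve n K) {R : ℝ} (hR0 : 0 ≤ R)
    (hR : energy n K ≤ ENNReal.ofReal R) {s t : ℝ} (hs : s ∈ Icc (0 : ℝ) 1)
    (ht : t ∈ Icc (0 : ℝ) 1) (hst : s ≤ t) :
    dens (K s)⁻¹ (n t - n s) (K t - K s) ≤
      (t - s) * (Real.exp √(8 * R * (t - s)) ^ 2 * ∫ x in s..t, curveDens n K x) := by
  rcases hst.eq_or_lt with rfl | hlt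
  · simp [dens_zero]
  set κ := Real.exp √(8 * R * (t - s)) with hκ
  have hκ1 : 1 ≤ κ := Real.one_le_exp (Real.sqrt_nonneg _)
  set A := (K s)⁻¹ with hA
  have hAp : A.PosSemidef := (h.posDef s hs).inv.posSemidef
  set w := n t - n s with hw
  set Y := K t - K s with hY
  have hYt : Yᵀ = Y := by rw [hY, transpose_sub, h.symm ht, h.symm hs]
  set q := dens A w Y with hq
  set T := t - s with hT
  have hTpos : 0 < T := sub_pos.2 hlt
  have hint : IntervalIntegrable (curveDens n K) volume s t :=
    intervalIntegrable_of_Ioo (h.integrableOn_curveDens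
      (ne_top_of_le_ne_top ENNReal.ofReal_ne_top hR)) hs ht
  have hac := h.ac_densPolar A w Y
  have hftc := (ac_mono hac hs ht).integral_deriv_eq_sub
  rw [← densPolar_sub, densPolar_self, ← hq] at hftc
  have hle : ∫ x in s..t, deriv (fun r => densPolar A (n r) (K r) w Y) x ≤
      ∫ x in s..t, (T * κ ^ 2 * curveDens n K x + q / T) := by
    refine intervalIntegral.integral_mono_ae_restrict hst (ac_mono hac hs ht).intervalIntegrable_deriv
      ((hint.const_mul _).add (by simp)) ?_
    have hae : ∀ᵐ x ∂volume.restrict (Ioo (0 : ℝ) 1), x ∈ Ioo (0 : ℝ) 1 ∧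
        deriv (fun r => densPolar A (n r) (K r) w Y) x
          = densPolar A (vel n x) (velMat K x) w Y := by
      filter_upwards [ae_hasMatDeriv h.ac_cov, ae_hasVecDeriv h.ac_mean, ae_Ioo_mem]
        with x h1 h2 h3
      exact ⟨h3, (hasDerivWithinAt_univ.1 (hasDerivWithinAt_densPolar h2 h1 A w Y)).deriv⟩
    have hae' := ae_uIoc_of_ae_Ioo hae hs ht
    rw [uIoc_of_le hst] at hae'
    rw [← restrict_Ioc_eq_restrict_Icc]
    refine (ae_restrict_iff' measurableSet_Ioc).2 ?_
    filter_upwards [hae'] with x hx hxs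
    obtain ⟨hx1, hx2⟩ := hx hxs
    rw [hx2]
    have hx3 := Ioo_subset_Icc_self hx1
    set v := vel n x
    set X := velMat K x
    have hXt : Xᵀ = X := h.velMat_symm hx1
    -- Comparison of the quadratic forms at the times `x` and `s`.
    have h1 : dens A v X ≤ κ ^ 2 * curveDens n K x := by
      refine dens_inv_le (h.posDef x hx3) (h.posDef s hs) hκ1 (fun u => ?_) v hXt
      refine (h.quad_le hR0 hR u hs hx3).trans ?_
      refine mul_le_mul_of_nonneg_right (Real.exp_le_exp.2 (Real.sqrt_le_sqrt ?_))
        (posSemidef_nonneg (h.posDef s hs).posSemidef u)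
      refine mul_le_mul_of_nonneg_left ?_ (by positivity)
      rw [abs_of_nonneg (by linarith [hxs.1])]
      linarith [hxs.2]
    have h2 := dens_nonneg hAp (w + (-T) • v) (X := Y + (-T) • X) (by simp [hXt, hYt])
    rw [dens_add_smul (posSemidef_transpose_eq hAp),
      densPolar_comm (posSemidef_transpose_eq hAp)] at h2
    have h3 : densPolar A v X w Y ≤ T * dens A v X + q / T := by
      rw [← mul_le_mul_iff_right₀ hTpos, mul_add, mul_div_cancel₀ _ hTpos.ne']
      nlinarith
    have h4 := mul_le_mul_of_nonneg_left h1 hTpos.le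
    show _ ≤ T * κ ^ 2 * curveDens n K x + q / T
    linarith
  rw [hftc, intervalIntegral.integral_add (hint.const_mul _) (by simp),
    intervalIntegral.integral_const_mul, intervalIntegral.integral_const, smul_eq_mul, ← hT,
    mul_div_cancel₀ _ hTpos.ne'] at hle
  linarith

theorem exists_tendsto_ultrafilter {𝒰 : Ultrafilter ℕ} {f : ℕ → ℝ} {M : ℝ}
    (hf : ∀ j, |f j| ≤ M) : ∃ x, Tendsto f 𝒰 (𝓝 x) := by
  obtain ⟨x, -, hx⟩ := (isCompact_Icc (a := -M) (b := M)).ultrafilter_le_nhds (𝒰.map f)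
    (by
      rw [le_principal_iff]
      exact Filter.mem_map.2 (Filter.univ_mem' fun j => abs_le.1 (hf j)))
  exact ⟨x, hx⟩

theorem tendsto_dens {β : Type*} {l : Filter β} {A X : β → Matrix ι ι ℝ} {v : β → ι → ℝ}
    {B Y : Matrix ι ι ℝ} {w : ι → ℝ} (hA : Tendsto A l (𝓝 B)) (hv : Tendsto v l (𝓝 w))
    (hX : Tendsto X l (𝓝 Y)) :
    Tendsto (fun j => dens (A j) (v j) (X j)) l (𝓝 (dens B w Y)) := by
  have mul : ∀ {M N : β → Matrix ι ι ℝ} {M' N' : Matrix ι ι ℝ}, Tendsto M l (𝓝 M') →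
      Tendsto N l (𝓝 N') → Tendsto (fun j => M j * N j) l (𝓝 (M' * N')) := by
    intro M N M' N' hM hN
    refine tendsto_pi_nhds.2 fun i => tendsto_pi_nhds.2 fun k => ?_
    simp only [Matrix.mul_apply]
    exact tendsto_finsetSum _ fun a _ => (tendsto_pi_nhds.1 (tendsto_pi_nhds.1 hM i) a).mul
      (tendsto_pi_nhds.1 (tendsto_pi_nhds.1 hN a) k)
  have h1 : Tendsto (fun j => (X j * A j * X j * A j).trace) l (𝓝 (Y * B * Y * B).trace) := by
    have h := mul (mul (mul hX hA) hX) hA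
    simp only [Matrix.trace, Matrix.diag]
    exact tendsto_finsetSum _ fun i _ => tendsto_pi_nhds.1 (tendsto_pi_nhds.1 h i) i
  have h2 : Tendsto (fun j => v j ⬝ᵥ (A j *ᵥ v j)) l (𝓝 (w ⬝ᵥ (B *ᵥ w))) := by
    simp only [dotProduct, Matrix.mulVec]
    exact tendsto_finsetSum _ fun i _ => (tendsto_pi_nhds.1 hv i).mul
      (tendsto_finsetSum _ fun k _ => (tendsto_pi_nhds.1 (tendsto_pi_nhds.1 hA i) k).mul
        (tendsto_pi_nhds.1 hv k))
  unfold dens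
  exact (h2.const_mul _).add (h1.const_mul _)

theorem tendsto_matrix_inv {β : Type*} {l : Filter β} {A : β → Matrix ι ι ℝ} {B : Matrix ι ι ℝ}
    (h : Tendsto A l (𝓝 B)) (hB : IsUnit B.det) : Tendsto (fun j => (A j)⁻¹) l (𝓝 B⁻¹) := by
  have h1 : Tendsto (fun j => (A j).det) l (𝓝 B.det) :=
    (continuous_id.matrix_det.tendsto B).comp h
  have h2 : Tendsto (fun j => (A j).adjugate) l (𝓝 B.adjugate) :=
    (continuous_id.matrix_adjugate.tendsto B).comp h
  simp only [Matrix.inv_def, Ring.inverse_eq_inv']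
  exact (h1.inv₀ hB.ne_zero).smul h2

/-- Lower semicontinuity in differential form: if the increments of a curve are controlled by those
of a monotone function `Φ`, as in `PosCurve.dens_sub_le`, the action is at most the total increment
of `Φ`. -/
theorem PosCurve.energy_le_of_monotone (h : PosCurve n K) {Φ : ℝ → ℝ} {c : ℝ}
    (hΦ : MonotoneOn Φ (Icc 0 1))
    (hd : ∀ s ∈ Icc (0 : ℝ) 1, ∀ t ∈ Icc (0 : ℝ) 1, s ≤ t →
      dens (K s)⁻¹ (n t - n s) (K t - K s) ≤
        (t - s) * (Real.exp √(c * (t - s)) ^ 2 * (Φ t - Φ s))) :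
    energy n K ≤ ENNReal.ofReal (Φ 1 - Φ 0) := by
  have hΦ' : MonotoneOn Φ (uIcc 0 1) := by rwa [uIcc_of_le zero_le_one]
  have hi := hΦ'.intervalIntegrable_deriv
  rw [intervalIntegrable_iff_integrableOn_Ioo_of_le zero_le_one] at hi
  have hdiff : ∀ᵐ s ∂volume.restrict (Ioo (0 : ℝ) 1), HasDerivAt Φ (deriv Φ s) s := by
    rw [ae_restrict_iff' measurableSet_Ioo]
    filter_upwards [hΦ.ae_differentiableWithinAt_of_mem] with s hs hs1
    exact ((hs (Ioo_subset_Icc_self hs1)).differentiableAt (Icc_mem_nhds hs1.1 hs1.2)).hasDerivAt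
  have key : ∀ᵐ s ∂volume.restrict (Ioo (0 : ℝ) 1), curveDens n K s ≤ deriv Φ s := by
    filter_upwards [hdiff, ae_hasMatDeriv h.ac_cov, ae_hasVecDeriv h.ac_mean, ae_Ioo_mem]
      with s h1 h2 h3 h4
    have hsl : 𝓝[>] s ≤ 𝓝[≠] s := nhdsWithin_mono _ fun x hx => ne_of_gt hx
    have t1 : Tendsto (fun t => (t - s)⁻¹ • (n t - n s)) (𝓝[>] s) (𝓝 (vel n s)) :=
      tendsto_pi_nhds.2 fun i =>
        ((hasDerivWithinAt_univ.1 (h3 i)).tendsto_slope).mono_left hsl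
    have t2 : Tendsto (fun t => (t - s)⁻¹ • (K t - K s)) (𝓝[>] s) (𝓝 (velMat K s)) :=
      tendsto_pi_nhds.2 fun i => tendsto_pi_nhds.2 fun j =>
        ((hasDerivWithinAt_univ.1 (h2 i j)).tendsto_slope).mono_left hsl
    have t3 : Tendsto (fun t => dens (K s)⁻¹ ((t - s)⁻¹ • (n t - n s)) ((t - s)⁻¹ • (K t - K s)))
        (𝓝[>] s) (𝓝 (curveDens n K s)) :=
      tendsto_dens tendsto_const_nhds t1 t2
    have t4 : Tendsto (fun t => Real.exp √(c * (t - s)) ^ 2 * slope Φ s t) (𝓝[>] s)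
        (𝓝 (deriv Φ s)) := by
      have h5 : Tendsto (fun t => Real.exp √(c * (t - s)) ^ 2) (𝓝[>] s) (𝓝 1) := by
        have : Continuous fun t => Real.exp √(c * (t - s)) ^ 2 := by fun_prop
        have := this.tendsto s
        simp only [sub_self, mul_zero, Real.sqrt_zero, Real.exp_zero, one_pow] at this
        exact this.mono_left nhdsWithin_le_nhds
      simpa using h5.mul (h1.tendsto_slope.mono_left hsl)
    refine le_of_tendsto_of_tendsto t3 t4 ?_
    filter_upwards [Ioo_mem_nhdsGT h4.2] with t ht
    have hts : 0 < t - s := sub_pos.2 ht.1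
    have h6 := hd s (Ioo_subset_Icc_self h4) t ⟨h4.1.le.trans ht.1.le, ht.2.le⟩ ht.1.le
    rw [dens_smul, slope_def_field]
    calc (t - s)⁻¹ ^ 2 * dens (K s)⁻¹ (n t - n s) (K t - K s)
        ≤ (t - s)⁻¹ ^ 2 * ((t - s) * (Real.exp √(c * (t - s)) ^ 2 * (Φ t - Φ s))) :=
          mul_le_mul_of_nonneg_left h6 (by positivity)
      _ = _ := by field_simp
  have h0 : ∀ᵐ s ∂volume.restrict (Ioo (0 : ℝ) 1), 0 ≤ deriv Φ s := by
    filter_upwards [key, h.ae_curveDens_nonneg] with s h1 h2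
    exact h2.trans h1
  calc energy n K ≤ ∫⁻ s in Ioo (0 : ℝ) 1, ENNReal.ofReal (deriv Φ s) := by
        refine lintegral_mono_ae ?_
        filter_upwards [key] with s hs
        exact ENNReal.ofReal_le_ofReal hs
    _ = ENNReal.ofReal (∫ s in Ioo (0 : ℝ) 1, deriv Φ s) :=
        (ofReal_integral_eq_lintegral_ofReal hi h0).symm
    _ ≤ ENNReal.ofReal (Φ 1 - Φ 0) := by
        refine ENNReal.ofReal_le_ofReal ?_
        have := hΦ'.intervalIntegral_deriv_mem_uIcc
        have h01 : 0 ≤ Φ 1 - Φ 0 :=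
          sub_nonneg.2 (hΦ ⟨le_rfl, zero_le_one⟩ ⟨zero_le_one, le_rfl⟩ zero_le_one)
        rw [uIcc_of_le h01] at this
        rw [integral_Ioo_eq]; exact this.2

/-- A curve of least action among the curves with the same end points. -/
structure IsMinimal (n : ℝ → ι → ℝ) (K : ℝ → Matrix ι ι ℝ) : Prop where
  curve : PosCurve n K
  ne_top : energy n K ≠ ⊤
  le : ∀ n' K', PosCurve n' K' → n' 0 = n 0 → n' 1 = n 1 → K' 0 = K 0 → K' 1 = K 1 →
    energy n K ≤ energy n' K'

/-- Existence of curves of least action, by the direct method. The limit of a minimizing sequence is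
taken pointwise along an ultrafilter, together with the limit `Φ` of the accumulated actions. -/
theorem exists_isMinimal (h : PosCurve n K) (hE : energy n K ≠ ⊤) :
    ∃ n' K', IsMinimal n' K' ∧ n' 0 = n 0 ∧ n' 1 = n 1 ∧ K' 0 = K 0 ∧ K' 1 = K 1 := by
  have h00 : (0 : ℝ) ∈ Icc (0 : ℝ) 1 := ⟨le_rfl, zero_le_one⟩
  have h01 : (1 : ℝ) ∈ Icc (0 : ℝ) 1 := ⟨zero_le_one, le_rfl⟩
  set S : Set ℝ≥0∞ := {E | ∃ n' K', PosCurve n' K' ∧ n' 0 = n 0 ∧ n' 1 = n 1 ∧ K' 0 = K 0 ∧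
    K' 1 = K 1 ∧ energy n' K' = E} with hS
  have hSne : S.Nonempty := ⟨_, n, K, h, rfl, rfl, rfl, rfl, rfl⟩
  set D := sInf S with hD
  have hDtop : D < ⊤ := (sInf_le (show energy n K ∈ S from ⟨n, K, h, rfl, rfl, rfl, rfl, rfl⟩)).trans_lt hE.lt_top
  obtain ⟨u, -, hu, huS⟩ := exists_seq_tendsto_sInf hSne (OrderBot.bddBelow S)
  set R : ℝ := D.toReal + 1 with hRdef
  have hR0 : 0 ≤ R := by positivity
  have hDR : D < ENNReal.ofReal R := by
    rw [ENNReal.lt_ofReal_iff_toReal_lt hDtop.ne]; linarith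
  obtain ⟨N, hN⟩ := eventually_atTop.1 (hu.eventually (gt_mem_nhds hDR))
  choose n' K' hc hn0 hn1 hK0 hK1 hen using fun j => huS (N + j)
  have hen' : ∀ j, energy (n' j) (K' j) ≤ ENNReal.ofReal R := fun j =>
    (hen j).trans_le (hN _ (Nat.le_add_right N j)).le
  set 𝒰 : Ultrafilter ℕ := hyperfilter ℕ with h𝒰
  set κ := Real.exp √(8 * R) with hκ
  have hκ0 : 0 < κ := Real.exp_pos _
  have hκle : ∀ s ∈ Icc (0 : ℝ) 1, ∀ t ∈ Icc (0 : ℝ) 1, Real.exp √(8 * R * |t - s|) ≤ κ := by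
    intro s hs t ht
    refine Real.exp_le_exp.2 (Real.sqrt_le_sqrt ?_)
    have : |t - s| ≤ 1 := abs_le.2 ⟨by linarith [hs.2, ht.1], by linarith [hs.1, ht.2]⟩
    nlinarith
  have hq : ∀ j (v : ι → ℝ), ∀ s ∈ Icc (0 : ℝ) 1, ∀ t ∈ Icc (0 : ℝ) 1,
      v ⬝ᵥ (K' j t *ᵥ v) ≤ κ * (v ⬝ᵥ (K' j s *ᵥ v)) := fun j v s hs t ht =>
    ((hc j).quad_le hR0 (hen' j) v hs ht).trans (mul_le_mul_of_nonneg_right (hκle s hs t ht)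
      (posSemidef_nonneg ((hc j).posDef s hs).posSemidef v))
  -- The accumulated action.
  set Φ' : ℕ → ℝ → ℝ := fun j t => ∫ x in (0 : ℝ)..t, curveDens (n' j) (K' j) x with hΦ'
  have hint : ∀ j, IntegrableOn (curveDens (n' j) (K' j)) (Ioo 0 1) := fun j =>
    (hc j).integrableOn_curveDens (ne_top_of_le_ne_top ENNReal.ofReal_ne_top (hen' j))
  have hΦsub : ∀ j, ∀ s ∈ Icc (0 : ℝ) 1, ∀ t ∈ Icc (0 : ℝ) 1,
      Φ' j t - Φ' j s = ∫ x in s..t, curveDens (n' j) (K' j) x := fun j s hs t ht =>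
    intervalIntegral.integral_interval_sub_left (intervalIntegrable_of_Ioo (hint j) h00 ht)
      (intervalIntegrable_of_Ioo (hint j) h00 hs)
  have hΦmono : ∀ j, MonotoneOn (Φ' j) (Icc 0 1) := by
    intro j s hs t ht hst
    rw [← sub_nonneg, hΦsub j s hs t ht, intervalIntegral.integral_of_le hst]
    refine integral_nonneg_of_ae ?_
    have := ae_uIoc_of_ae_Ioo (hc j).ae_curveDens_nonneg hs ht
    rw [uIoc_of_le hst] at this
    exact (ae_restrict_iff' measurableSet_Ioc).2 this
  have hΦ1 : ∀ j, ENNReal.ofReal (Φ' j 1) = energy (n' j) (K' j) := by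
    intro j
    rw [hΦ', energy, ← ofReal_integral_eq_lintegral_ofReal (hint j) (hc j).ae_curveDens_nonneg,
      integral_Ioo_eq]
  have hΦ0 : ∀ j, Φ' j 0 = 0 := fun j => by simp [hΦ']
  have hΦR : ∀ j, ∀ t ∈ Icc (0 : ℝ) 1, 0 ≤ Φ' j t ∧ Φ' j t ≤ R := by
    intro j t ht
    refine ⟨?_, ?_⟩
    · have := hΦmono j h00 ht ht.1
      rwa [hΦ0] at this
    · refine (hΦmono j ht h01 ht.2).trans ?_
      have := hen' j
      rwa [← hΦ1, ENNReal.ofReal_le_ofReal_iff hR0] at this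
  -- Uniform bounds.
  have hKb : ∀ t ∈ Icc (0 : ℝ) 1, ∀ j i k, |K' j t i k| ≤ κ * √(K 0 i i * K 0 k k) := by
    intro t ht j i k
    have hdiag : ∀ i, K' j t i i ≤ κ * K 0 i i := fun i => by
      have := hq j (Pi.single i 1) 0 h00 t ht
      simpa only [single_dotProduct_mulVec_single, hK0 j] using this
    have hnn : ∀ i, 0 ≤ K' j t i i := fun i => ((hc j).posDef t ht).posSemidef.diag_nonneg
    have h1 := posSemidef_cauchy ((hc j).posDef t ht).posSemidef (Pi.single i 1) (Pi.single k 1)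
    simp only [single_dotProduct_mulVec_single] at h1
    rw [← Real.sqrt_sq hκ0.le, ← Real.sqrt_mul (sq_nonneg _), ← Real.sqrt_sq_eq_abs]
    refine Real.sqrt_le_sqrt (h1.trans ?_)
    have := mul_le_mul (hdiag i) (hdiag k) (hnn k) ((hnn i).trans (hdiag i))
    calc _ ≤ _ := this
      _ = _ := by ring
  have hnb : ∀ t ∈ Icc (0 : ℝ) 1, ∀ j i,
      |n' j t i| ≤ √(K 0 i i * (2 * (κ ^ 2 * R))) + |n 0 i| := by
    intro t ht j i
    have h1 := (hc j).dens_sub_le hR0 (hen' j) h00 ht ht.1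
    rw [← hΦsub j 0 h00 t ht, hΦ0, sub_zero, sub_zero] at h1
    have hexp : Real.exp √(8 * R * t) ≤ κ := by
      have := hκle 0 h00 t ht
      rwa [sub_zero, abs_of_nonneg ht.1] at this
    have h2 : dens (K' j 0)⁻¹ (n' j t - n' j 0) (K' j t - K' j 0) ≤ κ ^ 2 * R := by
      refine h1.trans ?_
      have h3 : Real.exp √(8 * R * t) ^ 2 * Φ' j t ≤ κ ^ 2 * R :=
        mul_le_mul (pow_le_pow_left₀ (Real.exp_pos _).le hexp 2) (hΦR j t ht).2
          (hΦR j t ht).1 (by positivity)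
      have h4 : 0 ≤ Real.exp √(8 * R * t) ^ 2 * Φ' j t :=
        mul_nonneg (by positivity) (hΦR j t ht).1
      nlinarith [ht.1, ht.2]
    have h3 := sq_apply_le_of_posDef ((hc j).posDef 0 h00) (n' j t - n' j 0)
      (X := K' j t - K' j 0) (by rw [transpose_sub, (hc j).symm ht, (hc j).symm h00]) i
    rw [hK0 j] at h2 h3
    have h5 : |n' j t i - n 0 i| ≤ √(K 0 i i * (2 * (κ ^ 2 * R))) := by
      rw [← Real.sqrt_sq_eq_abs]
      refine Real.sqrt_le_sqrt ?_
      rw [Pi.sub_apply, hn0 j] at h3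
      refine h3.trans (mul_le_mul_of_nonneg_left ?_ (h.posDef 0 h00).posSemidef.diag_nonneg)
      rw [hn0 j] at h2
      linarith
    have := abs_add_le (n' j t i - n 0 i) (n 0 i)
    rw [sub_add_cancel] at this
    linarith
  -- Pointwise limits.
  have exN : ∀ t, ∃ x : ι → ℝ, t ∈ Icc (0 : ℝ) 1 →
      ∀ i, Tendsto (fun j => n' j t i) 𝒰 (𝓝 (x i)) := by
    intro t
    by_cases ht : t ∈ Icc (0 : ℝ) 1
    · choose x hx using fun i => exists_tendsto_ultrafilter (𝒰 := 𝒰) (fun j => hnb t ht j i)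
      exact ⟨x, fun _ => hx⟩
    · exact ⟨0, fun h => absurd h ht⟩
  have exK : ∀ t, ∃ X : Matrix ι ι ℝ, t ∈ Icc (0 : ℝ) 1 →
      ∀ i k, Tendsto (fun j => K' j t i k) 𝒰 (𝓝 (X i k)) := by
    intro t
    by_cases ht : t ∈ Icc (0 : ℝ) 1
    · choose x hx using fun i k => exists_tendsto_ultrafilter (𝒰 := 𝒰) (fun j => hKb t ht j i k)
      exact ⟨x, fun _ => hx⟩
    · exact ⟨0, fun h => absurd h ht⟩
  have exΦ : ∀ t, ∃ x : ℝ, t ∈ Icc (0 : ℝ) 1 → Tendsto (fun j => Φ' j t) 𝒰 (𝓝 x) := by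
    intro t
    by_cases ht : t ∈ Icc (0 : ℝ) 1
    · obtain ⟨x, hx⟩ := exists_tendsto_ultrafilter (𝒰 := 𝒰) (M := R)
        (fun j => abs_le.2 ⟨by linarith [(hΦR j t ht).1], (hΦR j t ht).2⟩)
      exact ⟨x, fun _ => hx⟩
    · exact ⟨0, fun h => absurd h ht⟩
  choose m hm using exN
  choose C hC using exK
  choose Φ hΦ using exΦ
  have hmv : ∀ t ∈ Icc (0 : ℝ) 1, Tendsto (fun j => n' j t) 𝒰 (𝓝 (m t)) := fun t ht =>
    tendsto_pi_nhds.2 (hm t ht)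
  have hCv : ∀ t ∈ Icc (0 : ℝ) 1, Tendsto (fun j => K' j t) 𝒰 (𝓝 (C t)) := fun t ht =>
    tendsto_pi_nhds.2 fun i => tendsto_pi_nhds.2 (hC t ht i)
  have hquad : ∀ (v : ι → ℝ), ∀ t ∈ Icc (0 : ℝ) 1,
      Tendsto (fun j => v ⬝ᵥ (K' j t *ᵥ v)) 𝒰 (𝓝 (v ⬝ᵥ (C t *ᵥ v))) := by
    intro v t ht
    have : Continuous fun A : Matrix ι ι ℝ => v ⬝ᵥ (A *ᵥ v) :=
      continuous_const.dotProduct (continuous_id.matrix_mulVec continuous_const)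
    exact (this.tendsto _).comp (hCv t ht)
  have hm0 : m 0 = n 0 := tendsto_nhds_unique (hmv 0 h00) (by simp [hn0])
  have hm1 : m 1 = n 1 := tendsto_nhds_unique (hmv 1 h01) (by simp [hn1])
  have hC0 : C 0 = K 0 := tendsto_nhds_unique (hCv 0 h00) (by simp [hK0])
  have hC1 : C 1 = K 1 := tendsto_nhds_unique (hCv 1 h01) (by simp [hK1])
  have hCle : ∀ (v : ι → ℝ), ∀ t ∈ Icc (0 : ℝ) 1,
      v ⬝ᵥ (C t *ᵥ v) ≤ κ * (v ⬝ᵥ (K 0 *ᵥ v)) ∧ v ⬝ᵥ (K 0 *ᵥ v) ≤ κ * (v ⬝ᵥ (C t *ᵥ v)) := by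
    intro v t ht
    constructor
    · refine le_of_tendsto (hquad v t ht) (Eventually.of_forall fun j => ?_)
      have := hq j v 0 h00 t ht
      rwa [hK0] at this
    · refine ge_of_tendsto ((hquad v t ht).const_mul κ) (Eventually.of_forall fun j => ?_)
      have := hq j v t ht 0 h00
      rwa [hK0] at this
  have hCsymm : ∀ t ∈ Icc (0 : ℝ) 1, (C t)ᵀ = C t := by
    intro t ht
    ext i k
    refine tendsto_nhds_unique (hC t ht k i) ((hC t ht i k).congr fun j => ?_)
    conv_lhs => rw [← (hc j).symm ht]
    rfl
  have hCpos : ∀ t ∈ Icc (0 : ℝ) 1, (C t).PosDef := by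
    intro t ht
    refine posDef_of_pos (hCsymm t ht) fun v hv => ?_
    have h1 := posDef_pos (h.posDef 0 h00) hv
    have h2 := (hCle v t ht).2
    exact pos_of_mul_pos_right (h1.trans_le h2) hκ0.le
  have hΦlim : MonotoneOn Φ (Icc 0 1) := fun s hs t ht hst =>
    le_of_tendsto_of_tendsto' (hΦ s hs) (hΦ t ht) fun j => hΦmono j hs ht hst
  have hdens : ∀ s ∈ Icc (0 : ℝ) 1, ∀ t ∈ Icc (0 : ℝ) 1, s ≤ t →
      dens (C s)⁻¹ (m t - m s) (C t - C s) ≤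
        (t - s) * (Real.exp √(8 * R * (t - s)) ^ 2 * (Φ t - Φ s)) := by
    intro s hs t ht hst
    have hdet : IsUnit (C s).det := (isUnit_iff_isUnit_det _).1 (hCpos s hs).isUnit
    have l1 : Tendsto (fun j => dens (K' j s)⁻¹ (n' j t - n' j s) (K' j t - K' j s)) 𝒰
        (𝓝 (dens (C s)⁻¹ (m t - m s) (C t - C s))) :=
      tendsto_dens (tendsto_matrix_inv (hCv s hs) hdet) ((hmv t ht).sub (hmv s hs))
        ((hCv t ht).sub (hCv s hs))
    refine le_of_tendsto_of_tendsto' l1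
      ((((hΦ t ht).sub (hΦ s hs)).const_mul _).const_mul _) fun j => ?_
    rw [hΦsub j s hs t ht]
    exact (hc j).dens_sub_le hR0 (hen' j) hs ht hst
  -- The limit curve is absolutely continuous.
  have hdens' : ∀ s ∈ Icc (0 : ℝ) 1, ∀ t ∈ Icc (0 : ℝ) 1, s ≤ t →
      dens (C s)⁻¹ (m t - m s) (C t - C s) ≤ κ ^ 2 * ((t - s) * (Φ t - Φ s)) := by
    intro s hs t ht hst
    refine (hdens s hs t ht hst).trans ?_
    have h1 := hκle s hs t ht
    rw [abs_of_nonneg (sub_nonneg.2 hst)] at h1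
    have h2 : 0 ≤ (t - s) * (Φ t - Φ s) :=
      mul_nonneg (sub_nonneg.2 hst) (sub_nonneg.2 (hΦlim hs ht hst))
    have h3 := mul_le_mul_of_nonneg_right (pow_le_pow_left₀ (Real.exp_pos _).le h1 2) h2
    linarith
  have hCdiag : ∀ s ∈ Icc (0 : ℝ) 1, ∀ i, C s i i ≤ κ * K 0 i i := fun s hs i => by
    simpa only [single_dotProduct_mulVec_single] using (hCle (Pi.single i 1) s hs).1
  have hCnn : ∀ s ∈ Icc (0 : ℝ) 1, ∀ i, 0 ≤ C s i i := fun s hs i =>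
    (hCpos s hs).posSemidef.diag_nonneg
  have hsym : ∀ s ∈ Icc (0 : ℝ) 1, ∀ t ∈ Icc (0 : ℝ) 1, (C t - C s)ᵀ = C t - C s :=
    fun s hs t ht => by rw [transpose_sub, hCsymm t ht, hCsymm s hs]
  have hK00 : ∀ i, 0 ≤ K 0 i i := fun i => (h.posDef 0 h00).posSemidef.diag_nonneg
  have hpc : PosCurve m C := by
    refine ⟨fun i => ?_, fun i k => ?_, hCpos⟩
    · refine ac_of_sq_le_monotone (c := κ * K 0 i i * (2 * κ ^ 2))
        (mul_nonneg (mul_nonneg hκ0.le (hK00 i)) (by positivity)) hΦlim fun s hs t ht hst => ?_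
      have h1 := sq_apply_le_of_posDef (hCpos s hs) (m t - m s) (hsym s hs t ht) i
      have h2 := hdens' s hs t ht hst
      have h3 := dens_nonneg (hCpos s hs).inv.posSemidef (m t - m s) (hsym s hs t ht)
      calc (m t i - m s i) ^ 2 ≤ _ := h1
        _ ≤ (κ * K 0 i i) * (2 * (κ ^ 2 * ((t - s) * (Φ t - Φ s)))) :=
          mul_le_mul (hCdiag s hs i) (by linarith) (by linarith)
            (mul_nonneg hκ0.le (hK00 i))
        _ = _ := by ring
    · refine ac_of_sq_le_monotone (c := (κ * K 0 i i) * (κ * K 0 k k) * (8 * κ ^ 2))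
        (mul_nonneg (mul_nonneg (mul_nonneg hκ0.le (hK00 i)) (mul_nonneg hκ0.le (hK00 k)))
          (by positivity)) hΦlim fun s hs t ht hst => ?_
      have h1 := sq_entry_le_of_posDef (hCpos s hs) (m t - m s) (hsym s hs t ht) i k
      have h2 := hdens' s hs t ht hst
      have h3 := dens_nonneg (hCpos s hs).inv.posSemidef (m t - m s) (hsym s hs t ht)
      calc (C t i k - C s i k) ^ 2 ≤ _ := h1
        _ ≤ ((κ * K 0 i i) * (κ * K 0 k k)) * (8 * (κ ^ 2 * ((t - s) * (Φ t - Φ s)))) :=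
          mul_le_mul (mul_le_mul (hCdiag s hs i) (hCdiag s hs k) (hCnn s hs k)
            (mul_nonneg hκ0.le (hK00 i))) (by linarith) (by linarith)
            (mul_nonneg (mul_nonneg hκ0.le (hK00 i)) (mul_nonneg hκ0.le (hK00 k)))
        _ = _ := by ring
  have hle : energy m C ≤ D := by
    refine (hpc.energy_le_of_monotone hΦlim hdens).trans_eq ?_
    have hΦ00 : Φ 0 = 0 := tendsto_nhds_unique (hΦ 0 h00) (by simp [hΦ0])
    rw [hΦ00, sub_zero]
    have l1 : Tendsto (fun j => ENNReal.ofReal (Φ' j 1)) 𝒰 (𝓝 (ENNReal.ofReal (Φ 1))) :=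
      ENNReal.tendsto_ofReal (hΦ 1 h01)
    have l2 : Tendsto (fun j => ENNReal.ofReal (Φ' j 1)) 𝒰 (𝓝 D) := by
      have : (fun j => ENNReal.ofReal (Φ' j 1)) = fun j => u (N + j) := by
        funext j; rw [hΦ1, hen]
      rw [this]
      have h1 : Tendsto (fun j => u (N + j)) atTop (𝓝 D) :=
        hu.comp (tendsto_atTop_mono (fun j => Nat.le_add_left j N) tendsto_id)
      exact h1.mono_left Nat.hyperfilter_le_atTop
    exact tendsto_nhds_unique l1 l2
  refine ⟨m, C, ⟨hpc, (hle.trans_lt hDtop).ne, ?_⟩, hm0, hm1, hC0, hC1⟩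
  intro n'' K'' h'' e1 e2 e3 e4
  exact hle.trans (sInf_le (show energy n'' K'' ∈ S from ⟨n'', K'', h'', e1.trans hm0,
    e2.trans hm1, e3.trans hC0, e4.trans hC1, rfl⟩))

end Existence

/-! ### Conservation laws of minimizers -/

section Noether

variable {ι : Type*} [Fintype ι] [DecidableEq ι]

section Exp

attribute [local instance] Matrix.linftyOpNormedRing Matrix.linftyOpNormedAlgebra
  Matrix.linftyOpNormedAddCommGroup Matrix.linftyOpNormedSpace

theorem hasMatDeriv_exp_smul (G : Matrix ι ι ℝ) (s : Set ℝ) (t : ℝ) :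
    HasMatDeriv (fun r => NormedSpace.exp (r • G)) (NormedSpace.exp (t • G) * G) s t := by
  intro i j
  have h := hasDerivAt_exp_smul_const (𝕂 := ℝ) G t
  let L : Matrix ι ι ℝ →ₗ[ℝ] ℝ := Matrix.entryLinearMap ℝ ℝ i j
  exact ((LinearMap.toContinuousLinearMap L).hasFDerivAt.comp_hasDerivAt t h).hasDerivWithinAt

end Exp

theorem exp_neg_smul_mul (G : Matrix ι ι ℝ) (s : ℝ) :
    NormedSpace.exp (s • -G) * NormedSpace.exp (s • G) = 1 := by
  have hc : Commute (s • -G) (s • G) :=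
    (((Commute.refl G).neg_left).smul_left _).smul_right _
  rw [← Matrix.exp_add_of_commute _ _ hc, ← smul_add, neg_add_cancel, smul_zero,
    NormedSpace.exp_zero]

/-- The one-parameter group `s ↦ exp (s G)` of matrices. -/
theorem exists_oneParameter (G : Matrix ι ι ℝ) :
    ∃ γ : ℝ → Matrix ι ι ℝ, γ 0 = 1 ∧ (∀ s, γ (-s) * γ s = 1) ∧
      ∀ s i j, HasDerivAt (fun r => γ r i j) ((γ s * G) i j) s := by
  refine ⟨fun s => NormedSpace.exp (s • G), by simp, fun s => ?_, fun s i j =>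
    hasDerivWithinAt_univ.1 (hasMatDeriv_exp_smul G univ s i j)⟩
  show NormedSpace.exp ((-s) • G) * NormedSpace.exp (s • G) = 1
  rw [neg_smul, ← smul_neg]
  exact exp_neg_smul_mul G s

variable {n : ℝ → ι → ℝ} {K : ℝ → Matrix ι ι ℝ}

/-- Translating the mean by `φ w` keeps the curve in the class of admissible curves. -/
theorem PosCurve.translate (h : PosCurve n K) {φ : ℝ → ℝ}
    (hφ : AbsolutelyContinuousOnInterval φ 0 1) (w : ι → ℝ) :
    PosCurve (fun t => n t + φ t • w) K ∧ energy (fun t => n t + φ t • w) K =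
      ∫⁻ t in Ioo (0 : ℝ) 1, ENNReal.ofReal (curveDens n K t
        + deriv φ t * densPolar (K t)⁻¹ (vel n t) (velMat K t) w 0
        + deriv φ t ^ 2 * dens (K t)⁻¹ w 0) := by
  refine ⟨⟨fun i => ?_, h.ac_cov, h.posDef⟩, ?_⟩
  · have := (h.ac_mean i).fun_add (hφ.const_mul (w i))
    simpa [mul_comm] using this
  · rw [energy_eq (v := fun t => vel n t + deriv φ t • w) (X := fun t => velMat K t)]
    · refine lintegral_congr_ae ?_
      filter_upwards [ae_Ioo_mem] with t ht
      have hA := posSemidef_transpose_eq (h.posDef t (Ioo_subset_Icc_self ht)).inv.posSemidef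
      have := dens_add_smul hA (vel n t) w (velMat K t) 0 (deriv φ t)
      rw [smul_zero, add_zero] at this
      rw [this]; rfl
    · filter_upwards [ae_hasMatDeriv h.ac_cov, ae_hasVecDeriv h.ac_mean, ac_hasDerivAt hφ]
        with t h1 h2 h3
      refine ⟨fun i => ?_, h1⟩
      exact (h2 i).add (h3.hasDerivWithinAt.mul_const (w i))

section Action

variable {φ : ℝ → ℝ} {G : Matrix ι ι ℝ} {γ : ℝ → Matrix ι ι ℝ}

theorem isUnit_det_oneParameter (hγ1 : ∀ s, γ (-s) * γ s = 1) (s : ℝ) : IsUnit (γ s).det := by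
  have := congrArg det (hγ1 s)
  rw [det_mul, det_one] at this
  exact IsUnit.of_mul_eq_one_right _ this

theorem contDiff_oneParameter (hγd : ∀ s i j, HasDerivAt (fun r => γ r i j) ((γ s * G) i j) s)
    (i j : ι) : ContDiff ℝ 1 fun r => γ r i j := by
  have hc : ∀ i j, Continuous fun r => γ r i j := fun i j =>
    continuous_iff_continuousAt.2 fun s => (hγd s i j).continuousAt
  rw [contDiff_one_iff_deriv]
  refine ⟨fun s => (hγd s i j).differentiableAt, ?_⟩
  have : deriv (fun r => γ r i j) = fun s => (γ s * G) i j := funext fun s => (hγd s i j).deriv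
  rw [this]
  simp only [Matrix.mul_apply]
  exact continuous_finsetSum _ fun k _ => (hc i k).mul continuous_const

/-- Letting a one-parameter group act at a time-dependent parameter keeps the curve in the class of
admissible curves. -/
theorem PosCurve.act (h : PosCurve n K) (hφ : AbsolutelyContinuousOnInterval φ 0 1)
    (hγ1 : ∀ s, γ (-s) * γ s = 1)
    (hγd : ∀ s i j, HasDerivAt (fun r => γ r i j) ((γ s * G) i j) s) :
    PosCurve (fun t => γ (φ t) *ᵥ n t) (fun t => γ (φ t) * K t * (γ (φ t))ᵀ) := by
  have hac : ∀ i j, AbsolutelyContinuousOnInterval (fun t => γ (φ t) i j) 0 1 := fun i j =>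
    ac_comp_contDiff (φ := fun r => γ r i j) hφ (contDiff_oneParameter hγd i j)
  refine ⟨fun i => ?_, fun i j => ?_, fun t ht => ?_⟩
  · simp only [Matrix.mulVec, dotProduct]
    exact ac_sum _ fun j _ => (hac i j).fun_mul (h.ac_mean j)
  · simp only [Matrix.mul_apply, Matrix.transpose_apply]
    exact ac_sum _ fun k _ => (ac_sum _ fun l _ => (hac i l).fun_mul (h.ac_cov l k)).fun_mul
      (hac j k)
  · have hinj : Function.Injective (γ (φ t)).vecMul :=
      Matrix.vecMul_injective_iff_isUnit.2
        ((isUnit_iff_isUnit_det _).2 (isUnit_det_oneParameter hγ1 _))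
    have := (h.posDef t ht).mul_mul_conjTranspose_same hinj
    rwa [conjTranspose_eq_transpose_of_trivial] at this

/-- The density is invariant under the action of invertible matrices. -/
theorem dens_act {g L : Matrix ι ι ℝ} (hg : IsUnit g.det) (v : ι → ℝ) (X : Matrix ι ι ℝ) :
    dens (g * L * gᵀ)⁻¹ (g *ᵥ v) (g * X * gᵀ) = dens L⁻¹ v X := by
  have hgt : IsUnit gᵀ.det := by rwa [det_transpose]
  have hinv : gᵀ * (g * L * gᵀ)⁻¹ * g = L⁻¹ := by
    rw [Matrix.mul_inv_rev, Matrix.mul_inv_rev, ← Matrix.mul_assoc, mul_nonsing_inv _ hgt,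
      Matrix.one_mul, Matrix.mul_assoc, nonsing_inv_mul _ hg, Matrix.mul_one]
  rw [dens_congr, hinv]

theorem PosCurve.energy_act (h : PosCurve n K) (hφ : AbsolutelyContinuousOnInterval φ 0 1)
    (hγ1 : ∀ s, γ (-s) * γ s = 1)
    (hγd : ∀ s i j, HasDerivAt (fun r => γ r i j) ((γ s * G) i j) s) :
    energy (fun t => γ (φ t) *ᵥ n t) (fun t => γ (φ t) * K t * (γ (φ t))ᵀ) =
      ∫⁻ t in Ioo (0 : ℝ) 1, ENNReal.ofReal (curveDens n K t
        + deriv φ t * densPolar (K t)⁻¹ (vel n t) (velMat K t) (G *ᵥ n t) (G * K t + K t * Gᵀ)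
        + deriv φ t ^ 2 * dens (K t)⁻¹ (G *ᵥ n t) (G * K t + K t * Gᵀ)) := by
  rw [energy_eq (v := fun t => γ (φ t) *ᵥ (vel n t + deriv φ t • (G *ᵥ n t)))
    (X := fun t => γ (φ t) * (velMat K t + deriv φ t • (G * K t + K t * Gᵀ)) * (γ (φ t))ᵀ)]
  · refine lintegral_congr_ae ?_
    filter_upwards [ae_Ioo_mem] with t ht
    have hA := posSemidef_transpose_eq (h.posDef t (Ioo_subset_Icc_self ht)).inv.posSemidef
    rw [dens_act (isUnit_det_oneParameter hγ1 _), dens_add_smul hA, curveDens]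
  · filter_upwards [ae_hasMatDeriv h.ac_cov, ae_hasVecDeriv h.ac_mean, ac_hasDerivAt hφ]
      with t h1 h2 h3
    have hg : HasMatDeriv (fun r => γ (φ r)) (deriv φ t • (γ (φ t) * G)) univ t := by
      intro i j
      have h4 : HasDerivAt (fun r => γ (φ r) i j) ((γ (φ t) * G) i j * deriv φ t) t :=
        HasDerivAt.comp t (hγd (φ t) i j) h3
      rw [mul_comm] at h4
      exact h4.hasDerivWithinAt
    constructor
    · intro i
      have h4 := hg.mulVec h2 i
      have e : (deriv φ t • (γ (φ t) * G)) *ᵥ n t + γ (φ t) *ᵥ vel n t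
          = γ (φ t) *ᵥ (vel n t + deriv φ t • (G *ᵥ n t)) := by
        rw [mulVec_add, mulVec_smul, smul_mulVec, mulVec_mulVec, add_comm]
      rw [e] at h4
      exact h4
    · have h4 := (hg.mul h1).mul hg.transpose
      have e : (deriv φ t • (γ (φ t) * G) * K t + γ (φ t) * velMat K t) * (γ (φ t))ᵀ
          + γ (φ t) * K t * (deriv φ t • (γ (φ t) * G))ᵀ
          = γ (φ t) * (velMat K t + deriv φ t • (G * K t + K t * Gᵀ)) * (γ (φ t))ᵀ := by
        simp only [Matrix.mul_add, Matrix.add_mul, Matrix.mul_smul, Matrix.smul_mul,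
          transpose_smul, transpose_mul, Matrix.mul_assoc, smul_add]
        abel
      rw [e] at h4
      exact h4

end Action

theorem trace_mul_single (M : Matrix ι ι ℝ) (a b : ι) :
    (M * Matrix.single a b 1).trace = M b a := by
  simp [Matrix.trace_mul_single]

theorem densPolar_act {A L X : Matrix ι ι ℝ} (hA : Aᵀ = A) (hX : Xᵀ = X) (hAL : A * L = 1)
    (v m : ι → ℝ) (a b : ι) :
    densPolar A v X (Matrix.single a b 1 *ᵥ m)
        (Matrix.single a b 1 * L + L * (Matrix.single a b 1)ᵀ) =
      (vecMulVec m (A *ᵥ v) + (1 / 2 : ℝ) • (X * A)) b a := by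
  have hLA : L * A = 1 := mul_eq_one_comm.1 hAL
  set G : Matrix ι ι ℝ := Matrix.single a b 1 with hG
  have h1 : (X * A * (G * L + L * Gᵀ) * A).trace = 2 * (X * A) b a := by
    have e1 : X * A * (G * L + L * Gᵀ) * A = X * A * G * (L * A) + X * (A * L) * (Gᵀ * A) := by
      simp only [Matrix.mul_add, Matrix.add_mul, Matrix.mul_assoc]
    have e2 : (X * (Gᵀ * A)).trace = (X * A * G).trace := by
      rw [← trace_transpose]
      simp only [transpose_mul, transpose_transpose, hX, hA]
      rw [trace_mul_comm, Matrix.mul_assoc]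
    rw [e1, hLA, hAL, Matrix.mul_one, Matrix.mul_one, trace_add, e2, hG, trace_mul_single]
    ring
  have h2 : v ⬝ᵥ (A *ᵥ (G *ᵥ m)) = m b * (A *ᵥ v) a := by
    rw [dotProduct_mulVec_comm hA, hG]
    rw [single_mulVec]
    simp [Function.update_apply, dotProduct]
  rw [densPolar, h1, h2]
  simp only [Matrix.add_apply, vecMulVec_apply, Matrix.smul_apply, smul_eq_mul]
  ring

theorem continuousOn_dens {A X : ℝ → Matrix ι ι ℝ} {v : ℝ → ι → ℝ} {s : Set ℝ}
    (hA : ContinuousOn A s) (hv : ContinuousOn v s) (hX : ContinuousOn X s) :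
    ContinuousOn (fun t => dens (A t) (v t) (X t)) s := fun t ht =>
  tendsto_dens (hA t ht) (hv t ht) (hX t ht)

theorem PosCurve.continuousOn_mean (h : PosCurve n K) : ContinuousOn n (Icc 0 1) :=
  continuousOn_pi.2 fun i => ac_continuousOn (h.ac_mean i)

/-- Noether's theorem in its weak form: if the curve may be moved in the direction
`(w, Y)` with arbitrary speed `φ'`, the corresponding momentum is constant. -/
theorem IsMinimal.momentum_const (h : IsMinimal n K) {w : ℝ → ι → ℝ} {Y : ℝ → Matrix ι ι ℝ}
    (hw : ContinuousOn w (Icc 0 1)) (hY : ContinuousOn Y (Icc 0 1))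
    (hYt : ∀ t ∈ Icc (0 : ℝ) 1, (Y t)ᵀ = Y t)
    (hvar : ∀ φ : ℝ → ℝ, AbsolutelyContinuousOnInterval φ 0 1 → φ 0 = 0 → φ 1 = 0 →
      energy n K ≤ ∫⁻ t in Ioo (0 : ℝ) 1, ENNReal.ofReal (curveDens n K t
        + deriv φ t * densPolar (K t)⁻¹ (vel n t) (velMat K t) (w t) (Y t)
        + deriv φ t ^ 2 * dens (K t)⁻¹ (w t) (Y t))) :
    ∃ c, ∀ᵐ t ∂volume.restrict (Ioo (0 : ℝ) 1),
      densPolar (K t)⁻¹ (vel n t) (velMat K t) (w t) (Y t) = c := by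
  have hc := h.curve
  have hQ := continuousOn_dens hc.continuousOn_inv hw hY
  obtain ⟨M, hM⟩ := isCompact_Icc.exists_bound_of_continuousOn hQ
  have hwm : ∀ i, AEMeasurable (fun t => w t i) (volume.restrict (Ioo (0 : ℝ) 1)) := fun i =>
    aemeasurable_of_continuousOn (continuousOn_pi.1 hw i)
  have hYm : AEMeasMat Y := fun i j =>
    aemeasurable_of_continuousOn (continuousOn_pi.1 (continuousOn_pi.1 hY i) j)
  refine ae_const_of_variation (Q := fun t => dens (K t)⁻¹ (w t) (Y t)) (M := M)
    (hc.integrableOn_curveDens h.ne_top) hc.ae_curveDens_nonneg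
    (aemeasurable_densPolar hc.aeMeasMat_inv (aeMeasMat_velMat K) hYm (aemeasurable_vel n)
      hwm).aestronglyMeasurable
    (aemeasurable_of_continuousOn hQ).aestronglyMeasurable ?_ ?_ hvar
  · filter_upwards [ae_Ioo_mem] with t ht
    have ht' := Ioo_subset_Icc_self ht
    exact ⟨dens_nonneg (hc.posDef t ht').inv.posSemidef _ (hYt t ht'),
      (le_abs_self _).trans (hM t ht')⟩
  · filter_upwards [ae_Ioo_mem] with t ht
    have ht' := Ioo_subset_Icc_self ht
    exact densPolar_sq_le (hc.posDef t ht').inv.posSemidef _ _ (hc.velMat_symm ht) (hYt t ht')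

/-- The conserved momenta of the affine group: `K⁻¹ ṅ` for translations, and
`n ⊗ K⁻¹ ṅ + ½ K̇ K⁻¹` for linear maps. -/
theorem IsMinimal.exists_momenta (h : IsMinimal n K) :
    ∃ (α : ι → ℝ) (B : Matrix ι ι ℝ), ∀ᵐ t ∂volume.restrict (Ioo (0 : ℝ) 1),
      (K t)⁻¹ *ᵥ vel n t = α ∧
      vecMulVec (n t) α + (1 / 2 : ℝ) • (velMat K t * (K t)⁻¹) = B := by
  have hc := h.curve
  have hA : ∀ t ∈ Icc (0 : ℝ) 1, ((K t)⁻¹)ᵀ = (K t)⁻¹ := fun t ht =>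
    posSemidef_transpose_eq (hc.posDef t ht).inv.posSemidef
  have h1 : ∀ i, ∃ c, ∀ᵐ t ∂volume.restrict (Ioo (0 : ℝ) 1), ((K t)⁻¹ *ᵥ vel n t) i = c := by
    intro i
    obtain ⟨c, hc'⟩ := h.momentum_const (w := fun _ => Pi.single i 1) (Y := fun _ => 0)
      continuousOn_const continuousOn_const (fun _ _ => by simp) (fun φ hφ h0 h1 => by
        obtain ⟨hp, he⟩ := hc.translate hφ (Pi.single i 1)
        rw [← he]
        exact h.le _ _ hp (by simp [h0]) (by simp [h1]) rfl rfl)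
    refine ⟨c, ?_⟩
    filter_upwards [hc', ae_Ioo_mem] with t ht ht1
    rw [← ht, densPolar, dotProduct_mulVec_comm (hA t (Ioo_subset_Icc_self ht1))]
    simp
  have h2 : ∀ a b, ∃ c, ∀ᵐ t ∂volume.restrict (Ioo (0 : ℝ) 1),
      (vecMulVec (n t) ((K t)⁻¹ *ᵥ vel n t) + (1 / 2 : ℝ) • (velMat K t * (K t)⁻¹)) b a = c := by
    intro a b
    obtain ⟨γ, hγ0, hγ1, hγd⟩ := exists_oneParameter (Matrix.single a b (1 : ℝ))
    have hKc := hc.continuousOn_cov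
    obtain ⟨c, hc'⟩ := h.momentum_const (w := fun t => Matrix.single a b (1 : ℝ) *ᵥ n t)
      (Y := fun t => Matrix.single a b (1 : ℝ) * K t + K t * (Matrix.single a b (1 : ℝ))ᵀ)
      ((continuous_const.matrix_mulVec continuous_id).comp_continuousOn hc.continuousOn_mean)
      (((continuous_const.matrix_mul continuous_id).add
        (continuous_id.matrix_mul continuous_const)).comp_continuousOn hKc)
      (fun t ht => by
        rw [transpose_add, transpose_mul, transpose_mul, transpose_transpose, hc.symm ht, add_comm])
      (fun φ hφ h0 h1 => by
        rw [← hc.energy_act hφ hγ1 hγd]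
        exact h.le _ _ (hc.act hφ hγ1 hγd) (by simp [h0, hγ0]) (by simp [h1, hγ0]) (by simp [h0, hγ0])
          (by simp [h1, hγ0]))
    refine ⟨c, ?_⟩
    filter_upwards [hc', ae_Ioo_mem] with t ht ht1
    have ht2 := Ioo_subset_Icc_self ht1
    rw [← ht, densPolar_act (hA t ht2) (hc.velMat_symm ht1) (nonsing_inv_mul _ (hc.isUnit_det ht2))]
  choose α hα using h1
  choose B hB using h2
  refine ⟨α, fun b a => B a b, ?_⟩
  filter_upwards [ae_all_iff.2 hα, ae_all_iff.2 fun a => ae_all_iff.2 (hB a)] with t h1 h2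
  have h3 : (K t)⁻¹ *ᵥ vel n t = α := funext h1
  refine ⟨h3, ?_⟩
  rw [← h3]
  ext b a
  exact h2 a b

/-- Minimizers are smooth: the conservation of the momenta is a system of first order equations. -/
theorem IsMinimal.hasDeriv (h : IsMinimal n K) :
    ∃ (α : ι → ℝ) (B : Matrix ι ι ℝ), ∀ t ∈ Icc (0 : ℝ) 1,
      (∀ i, HasDerivWithinAt (fun r => n r i) ((K t *ᵥ α) i) (Icc 0 1) t) ∧
      HasMatDeriv K ((2 : ℝ) • (B - vecMulVec (n t) α) * K t) (Icc 0 1) t := by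
  have hc := h.curve
  obtain ⟨α, B, hαB⟩ := h.exists_momenta
  set P : ℝ → Matrix ι ι ℝ := fun t => (2 : ℝ) • (B - vecMulVec (n t) α) with hP
  have hKc := hc.continuousOn_cov
  have hnc := hc.continuousOn_mean
  have hode : ∀ᵐ t ∂volume.restrict (Ioo (0 : ℝ) 1),
      vel n t = K t *ᵥ α ∧ velMat K t = P t * K t := by
    filter_upwards [hαB, ae_Ioo_mem] with t ht ht1
    have hdet := hc.isUnit_det (Ioo_subset_Icc_self ht1)
    constructor
    · rw [← ht.1, mulVec_mulVec, mul_nonsing_inv _ hdet, one_mulVec]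
    · have : velMat K t * (K t)⁻¹ = P t := by
        rw [hP, ← ht.2]
        simp only [add_sub_cancel_left]
        rw [smul_smul]; norm_num
      rw [← this, Matrix.mul_assoc, nonsing_inv_mul _ hdet, Matrix.mul_one]
  have hn'c : ∀ i, ContinuousOn (fun t => (K t *ᵥ α) i) (Icc 0 1) := fun i =>
    (continuous_apply i).comp_continuousOn
      ((continuous_id.matrix_mulVec continuous_const).comp_continuousOn hKc)
  have hPc : ContinuousOn P (Icc 0 1) := by
    refine continuousOn_pi.2 fun i => continuousOn_pi.2 fun j => ?_
    exact (continuousOn_const (c := B i j)).sub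
      ((continuousOn_pi.1 hnc i).mul (continuousOn_const (c := α j))) |>.const_smul (2 : ℝ)
  have hK'c : ∀ i j, ContinuousOn (fun t => (P t * K t) i j) (Icc 0 1) := fun i j =>
    continuousOn_pi.1 (continuousOn_pi.1 ((continuous_fst.matrix_mul
      continuous_snd).comp_continuousOn (hPc.prodMk hKc)) i) j
  refine ⟨α, B, fun t ht => ⟨fun i => ac_hasDerivWithinAt (hc.ac_mean i) (hn'c i) ?_ ht,
    fun i j => ac_hasDerivWithinAt (hc.ac_cov i j) (hK'c i j) ?_ ht⟩⟩
  · filter_upwards [hode] with s hs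
    exact congrFun hs.1 i
  · filter_upwards [hode] with s hs
    exact congrFun (congrFun hs.2 i) j

/-- Minimizers solve the Euler–Lagrange equations. -/
theorem IsMinimal.eulerLagrange (h : IsMinimal n K) :
    ∃ (α : ι → ℝ) (n' : ℝ → ι → ℝ) (K' : ℝ → Matrix ι ι ℝ), ∀ t ∈ Icc (0 : ℝ) 1,
      (∀ i, HasDerivWithinAt (fun r => n r i) (n' t i) (Icc 0 1) t) ∧
      HasMatDeriv K (K' t) (Icc 0 1) t ∧ (K t)⁻¹ *ᵥ n' t = α ∧
      HasMatDeriv K' (K' t * (K t)⁻¹ * K' t - (2 : ℝ) • (K t * vecMulVec α α * K t))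
        (Icc 0 1) t := by
  have hc := h.curve
  obtain ⟨α, B, hαB⟩ := h.hasDeriv
  set P : ℝ → Matrix ι ι ℝ := fun t => (2 : ℝ) • (B - vecMulVec (n t) α) with hP
  refine ⟨α, fun t => K t *ᵥ α, fun t => P t * K t,
    fun t ht => ⟨(hαB t ht).1, (hαB t ht).2, ?_, ?_⟩⟩
  · rw [mulVec_mulVec, nonsing_inv_mul _ (hc.isUnit_det ht), one_mulVec]
  · have hPd : HasMatDeriv P ((-2 : ℝ) • vecMulVec (K t *ᵥ α) α) (Icc 0 1) t := by
      intro i j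
      have := ((hasDerivWithinAt_const t (Icc (0 : ℝ) 1) (B i j)).sub
        (((hαB t ht).1 i).mul_const (α j))).const_mul 2
      refine this.congr_deriv ?_
      simp only [Matrix.smul_apply, vecMulVec_apply, smul_eq_mul]
      ring
    have := hPd.mul (hαB t ht).2
    convert this using 1
    have e1 : P t * K t * (K t)⁻¹ = P t := by
      rw [Matrix.mul_assoc, mul_nonsing_inv _ (hc.isUnit_det ht), Matrix.mul_one]
    have e2 : vecMulVec (K t *ᵥ α) α = K t * vecMulVec α α := (mul_vecMulVec _ _ _).symm
    rw [e1, e2, neg_smul, Matrix.neg_mul, Matrix.smul_mul (2 : ℝ) (K t * vecMulVec α α),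
      sub_eq_add_neg, add_comm]

end Noether

/-! ### Minimizers with a constant mean -/

section Commuting

variable {ι : Type*} [Fintype ι] [DecidableEq ι]

theorem eq_of_hasDerivWithinAt_zero {f : ℝ → ℝ}
    (h : ∀ t ∈ Icc (0 : ℝ) 1, HasDerivWithinAt f 0 (Icc 0 1) t) {t : ℝ} (ht : t ∈ Icc (0 : ℝ) 1) :
    f t = f 0 :=
  constant_of_derivWithin_zero (fun s hs => (h s hs).differentiableWithinAt)
    (fun s hs => (h s (Ico_subset_Icc_self hs)).derivWithin
      (uniqueDiffOn_Icc zero_lt_one s (Ico_subset_Icc_self hs))) t ht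

section ExpInjective

open scoped Matrix.Norms.L2Operator

theorem exp_injective_of_transpose_eq {A B : Matrix ι ι ℝ} (hA : Aᵀ = A) (hB : Bᵀ = B)
    (h : NormedSpace.exp A = NormedSpace.exp B) : A = B := by
  have hA' : IsSelfAdjoint A := by rwa [isSelfAdjoint_iff, star_eq_conjTranspose,
    conjTranspose_eq_transpose_of_trivial]
  have hB' : IsSelfAdjoint B := by rwa [isSelfAdjoint_iff, star_eq_conjTranspose,
    conjTranspose_eq_transpose_of_trivial]
  rw [← CFC.log_exp A hA', ← CFC.log_exp B hB', h]

end ExpInjective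

/-- The solution of `K' = G K`, `K(0) = 1` is the exponential. -/
theorem eq_exp_of_hasMatDeriv {K : ℝ → Matrix ι ι ℝ} {G : Matrix ι ι ℝ}
    (h : ∀ t ∈ Icc (0 : ℝ) 1, HasMatDeriv K (G * K t) (Icc 0 1) t) (h0 : K 0 = 1) {t : ℝ}
    (ht : t ∈ Icc (0 : ℝ) 1) : K t = NormedSpace.exp (t • G) := by
  have hd : ∀ s ∈ Icc (0 : ℝ) 1,
      HasMatDeriv (fun r => NormedSpace.exp (r • -G) * K r) 0 (Icc 0 1) s := by
    intro s hs
    have := (hasMatDeriv_exp_smul (-G) (Icc 0 1) s).mul (h s hs)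
    rwa [Matrix.mul_assoc, Matrix.neg_mul, ← Matrix.mul_add, neg_add_cancel,
      Matrix.mul_zero] at this
  have h1 : NormedSpace.exp (t • -G) * K t = 1 := by
    ext i j
    refine (eq_of_hasDerivWithinAt_zero (fun s hs => hd s hs i j) ht).trans ?_
    simp [h0]
  have h2 := mul_eq_one_comm.1 (exp_neg_smul_mul G t)
  rw [← Matrix.one_mul (K t), ← h2, Matrix.mul_assoc, h1, Matrix.mul_one]

theorem exp_diagonal_smul (t : ℝ) (g : ι → ℝ) :
    NormedSpace.exp (t • Matrix.diagonal g) = Matrix.diagonal fun i => Real.exp (t * g i) := by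
  rw [← Matrix.diagonal_smul, Matrix.exp_diagonal]
  congr 1
  ext i
  rw [Pi.coe_exp, Real.exp_eq_exp_ℝ]
  rfl

variable {n : ℝ → ι → ℝ} {K : ℝ → Matrix ι ι ℝ}

/-- A minimizer whose mean returns to its initial value has a constant mean: the momentum `α` is
constant and `⟨α, ṅ⟩ = ⟨α, K α⟩ ≥ 0`. -/
theorem IsMinimal.linear_of_mean_eq (h : IsMinimal n K) (hn : n 0 = n 1) :
    (∀ t ∈ Icc (0 : ℝ) 1, n t = n 0) ∧
      ∃ G : Matrix ι ι ℝ, ∀ t ∈ Icc (0 : ℝ) 1, HasMatDeriv K (G * K t) (Icc 0 1) t := by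
  obtain ⟨α, B, hαB⟩ := h.hasDeriv
  have hα : α = 0 := by
    by_contra hα
    have hd : ∀ t ∈ Icc (0 : ℝ) 1,
        HasDerivWithinAt (fun r => α ⬝ᵥ n r) (α ⬝ᵥ (K t *ᵥ α)) (Icc 0 1) t := by
      intro t ht
      have := hasDerivWithinAt_dotProduct (v := fun _ => α) (v' := 0)
        (fun i => hasDerivWithinAt_const t (Icc (0 : ℝ) 1) (α i)) (hαB t ht).1
      simpa using this
    have hmono : StrictMonoOn (fun r => α ⬝ᵥ n r) (Icc 0 1) := by
      refine strictMonoOn_of_deriv_pos (convex_Icc 0 1)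
        (fun t ht => (hd t ht).continuousWithinAt) fun t ht => ?_
      rw [interior_Icc] at ht
      have ht' := Ioo_subset_Icc_self ht
      rw [((hd t ht').hasDerivAt (Icc_mem_nhds ht.1 ht.2)).deriv]
      exact posDef_pos (h.curve.posDef t ht') hα
    have := hmono ⟨le_rfl, zero_le_one⟩ ⟨zero_le_one, le_rfl⟩ zero_lt_one
    simp [hn] at this
  subst hα
  refine ⟨fun t ht => funext fun i => eq_of_hasDerivWithinAt_zero (f := fun r => n r i)
    (fun s hs => by simpa using (hαB s hs).1 i) ht, (2 : ℝ) • B, fun t ht => ?_⟩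
  simpa using (hαB t ht).2

/-- A minimizer from `(n₀, 1)` to `(n₀, diag μ)` is `(n₀, diag μᵗ)`. -/
theorem IsMinimal.eq_diagonal_rpow (h : IsMinimal n K) (hn : n 0 = n 1) (h0 : K 0 = 1)
    {μ : ι → ℝ} (hμ : ∀ i, 0 < μ i) (h1 : K 1 = Matrix.diagonal μ) :
    (∀ t ∈ Icc (0 : ℝ) 1, n t = n 0 ∧ K t = Matrix.diagonal fun i => μ i ^ t) ∧
      energy n K = ENNReal.ofReal ((1 / 8) * ∑ i, Real.log (μ i) ^ 2) := by
  obtain ⟨hnc, G, hG⟩ := h.linear_of_mean_eq hn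
  have h00 : (0 : ℝ) ∈ Icc (0 : ℝ) 1 := ⟨le_rfl, zero_le_one⟩
  have h11 : (1 : ℝ) ∈ Icc (0 : ℝ) 1 := ⟨zero_le_one, le_rfl⟩
  have hGs : Gᵀ = G := by
    ext i j
    have hd1 := hG 0 h00 j i
    have hd2 := hG 0 h00 i j
    rw [h0, Matrix.mul_one] at hd1 hd2
    have hd3 : HasDerivWithinAt (fun r => K r j i) (G i j) (Icc 0 1) 0 :=
      hd2.congr (fun s hs => congrFun (congrFun (h.curve.symm hs) i) j)
        (congrFun (congrFun (h.curve.symm h00) i) j)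
    exact (uniqueDiffOn_Icc zero_lt_one 0 h00).eq_deriv _ hd1 hd3
  have hGl : G = Matrix.diagonal fun i => Real.log (μ i) := by
    refine exp_injective_of_transpose_eq hGs (diagonal_transpose _) ?_
    have e1 := eq_exp_of_hasMatDeriv hG h0 h11
    rw [one_smul, h1] at e1
    have e2 := exp_diagonal_smul 1 fun i => Real.log (μ i)
    rw [one_smul] at e2
    rw [← e1, e2]
    congr 1
    ext i
    rw [one_mul, Real.exp_log (hμ i)]
  refine ⟨fun t ht => ⟨hnc t ht, ?_⟩, ?_⟩
  · rw [eq_exp_of_hasMatDeriv hG h0 ht, hGl, exp_diagonal_smul]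
    congr 1
    ext i
    rw [Real.rpow_def_of_pos (hμ i), mul_comm]
  · rw [energy_eq (v := fun _ => 0) (X := fun t => G * K t)]
    · have : ∀ t ∈ Ioo (0 : ℝ) 1, ENNReal.ofReal (dens (K t)⁻¹ 0 (G * K t)) =
          ENNReal.ofReal ((1 / 8) * ∑ i, Real.log (μ i) ^ 2) := by
        intro t ht
        have hdet := h.curve.isUnit_det (Ioo_subset_Icc_self ht)
        have e : G * K t * (K t)⁻¹ = G := by
          rw [Matrix.mul_assoc, mul_nonsing_inv _ hdet, Matrix.mul_one]
        rw [dens, e, Matrix.mul_assoc G, e, hGl, diagonal_mul_diagonal, trace_diagonal]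
        simp [pow_two]
      rw [setLIntegral_congr_fun measurableSet_Ioo this]
      simp
    · filter_upwards [ae_Ioo_mem] with t ht
      have ht' := Ioo_subset_Icc_self ht
      refine ⟨fun i => ?_, fun i j => ?_⟩
      · refine HasDerivAt.hasDerivWithinAt ?_
        refine (hasDerivAt_const t (n 0 i)).congr_of_eventuallyEq ?_
        filter_upwards [Icc_mem_nhds ht.1 ht.2] with s hs
        rw [hnc s hs]
      · exact ((hG t ht' i j).hasDerivAt (Icc_mem_nhds ht.1 ht.2)).hasDerivWithinAt

/-- Linear changes of coordinates preserve the action. -/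
theorem PosCurve.congr (h : PosCurve n K) {g : Matrix ι ι ℝ} (hg : IsUnit g.det) :
    PosCurve (fun t => g *ᵥ n t) (fun t => g * K t * gᵀ) ∧
      energy (fun t => g *ᵥ n t) (fun t => g * K t * gᵀ) = energy n K := by
  refine ⟨⟨fun i => ?_, fun i j => ?_, fun t ht => ?_⟩, ?_⟩
  · simp only [Matrix.mulVec, dotProduct]
    exact ac_sum _ fun j _ => (h.ac_mean j).const_mul _
  · simp only [Matrix.mul_apply, Matrix.transpose_apply]
    refine ac_sum _ fun k _ => ?_
    have := (ac_sum Finset.univ fun l _ => (h.ac_cov l k).const_mul (g i l)).const_mul (g j k)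
    simpa [mul_comm] using this
  · have hinj : Function.Injective g.vecMul :=
      Matrix.vecMul_injective_iff_isUnit.2 ((isUnit_iff_isUnit_det _).2 hg)
    have := (h.posDef t ht).mul_mul_conjTranspose_same hinj
    rwa [conjTranspose_eq_transpose_of_trivial] at this
  · rw [energy_eq (v := fun t => g *ᵥ vel n t) (X := fun t => g * velMat K t * gᵀ)]
    · simp only [dens_act hg]
      rfl
    · filter_upwards [ae_hasMatDeriv h.ac_cov, ae_hasVecDeriv h.ac_mean] with t h1 h2
      constructor
      · intro i
        have := (hasMatDeriv_const g (s := univ) (t := t)).mulVec h2 i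
        simpa using this
      · have := ((hasMatDeriv_const g (s := univ) (t := t)).mul h1).mul (hasMatDeriv_const gᵀ)
        simpa using this

/-- The lower bound for curves between diagonal covariances with the same mean. -/
theorem PosCurve.le_energy_of_mean_eq (h : PosCurve n K) (hn : n 0 = n 1) {a b : ι → ℝ}
    (ha : ∀ i, 0 < a i) (hb : ∀ i, 0 < b i) (h0 : K 0 = Matrix.diagonal a)
    (h1 : K 1 = Matrix.diagonal b) :
    ENNReal.ofReal ((1 / 8) * ∑ i, Real.log (b i / a i) ^ 2) ≤ energy n K := by
  by_cases hE : energy n K = ⊤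
  · rw [hE]; exact le_top
  set g : Matrix ι ι ℝ := Matrix.diagonal fun i => (√(a i))⁻¹ with hgd
  have hs : ∀ i, 0 < √(a i) := fun i => Real.sqrt_pos.2 (ha i)
  have hg : IsUnit g.det := by
    rw [hgd, det_diagonal, isUnit_iff_ne_zero]
    exact Finset.prod_ne_zero_iff.2 fun i _ => (inv_pos.2 (hs i)).ne'
  obtain ⟨hc, he⟩ := h.congr hg
  obtain ⟨n', K', hmin, e1, e2, e3, e4⟩ := exists_isMinimal hc (by rwa [he])
  have hd : ∀ c : ι → ℝ, g * Matrix.diagonal c * gᵀ = Matrix.diagonal fun i => c i / a i := by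
    intro c
    rw [hgd, diagonal_transpose, diagonal_mul_diagonal, diagonal_mul_diagonal]
    congr 1
    ext i
    have h1 := Real.sq_sqrt (ha i).le
    have h2 := hs i
    rw [eq_div_iff (ha i).ne', ← h1]
    field_simp
    rw [Real.sqrt_sq (hs i).le]
  have e5 := (hmin.eq_diagonal_rpow (by rw [e1, e2, hn])
    (by rw [e3, h0, hd, ← diagonal_one]; congr 1; ext i; exact div_self (ha i).ne')
    (fun i => div_pos (hb i) (ha i)) (by rw [e4, h1, hd])).2
  rw [← e5, ← he]
  exact hmin.le _ _ hc e1.symm e2.symm e3.symm e4.symm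

end Commuting

/-! ### The explicit one-dimensional curves -/

section Scalar

variable {δ a b : ℝ}

/-- The root `√((δ² + a + b)² - 4 a b)` in the formula for the phase. -/
noncomputable def disc (δ a b : ℝ) : ℝ := √((δ ^ 2 + a + b) ^ 2 - 4 * a * b)

theorem disc_sq (ha : 0 < a) (hb : 0 < b) :
    disc δ a b ^ 2 = (δ ^ 2 + a + b) ^ 2 - 4 * a * b :=
  Real.sq_sqrt (by
    nlinarith [sq_nonneg δ, sq_nonneg (a - b), mul_nonneg (sq_nonneg δ) ha.le,
      mul_nonneg (sq_nonneg δ) hb.le, sq_nonneg (δ ^ 2)])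

theorem disc_pos (hδ : δ ≠ 0) (ha : 0 < a) (hb : 0 < b) : 0 < disc δ a b :=
  Real.sqrt_pos.2 (by
    have := pow_pos (abs_pos.2 hδ) 2
    rw [sq_abs] at this
    nlinarith [sq_nonneg (a - b), mul_pos this ha, mul_pos this hb, sq_nonneg (δ ^ 2)])

theorem one_le_cosh_rate (δ : ℝ) (ha : 0 < a) (hb : 0 < b) :
    1 ≤ (δ ^ 2 + a + b) / (2 * √(a * b)) := by
  have h : 0 < √(a * b) := Real.sqrt_pos.2 (mul_pos ha hb)
  rw [le_div_iff₀ (by positivity), Real.sqrt_mul ha.le]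
  nlinarith [sq_nonneg (√a - √b), Real.sq_sqrt ha.le, Real.sq_sqrt hb.le, sq_nonneg δ]

theorem cosh_rate (δ : ℝ) (ha : 0 < a) (hb : 0 < b) :
    Real.cosh (rate δ a b) = (δ ^ 2 + a + b) / (2 * (√a * √b)) := by
  rw [rate, Real.cosh_arcosh (one_le_cosh_rate δ ha hb), Real.sqrt_mul ha.le]

theorem rate_nonneg (δ : ℝ) (ha : 0 < a) (hb : 0 < b) : 0 ≤ rate δ a b :=
  Real.arcosh_nonneg (one_le_cosh_rate δ ha hb)

theorem sinh_rate (δ : ℝ) (ha : 0 < a) (hb : 0 < b) :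
    Real.sinh (rate δ a b) = disc δ a b / (2 * (√a * √b)) := by
  have h1 : 0 ≤ Real.sinh (rate δ a b) := Real.sinh_nonneg_iff.2 (rate_nonneg δ ha hb)
  have h2 : 0 ≤ disc δ a b / (2 * (√a * √b)) := div_nonneg (Real.sqrt_nonneg _) (by positivity)
  have ha' := Real.sqrt_pos.2 ha
  have hb' := Real.sqrt_pos.2 hb
  rw [← sq_eq_sq₀ h1 h2, div_pow, disc_sq ha hb, Real.sinh_sq, cosh_rate δ ha hb]
  have e1 := Real.sq_sqrt ha.le
  have e2 := Real.sq_sqrt hb.le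
  have e3 : (2 * (√a * √b)) ^ 2 = 4 * a * b := by
    rw [mul_pow, mul_pow, e1, e2]; ring
  rw [div_pow, e3]
  field_simp

theorem exp_phase (hδ : δ ≠ 0) (ha : 0 < a) (hb : 0 < b) :
    Real.exp (phase δ a b) = (a - b - δ ^ 2 + disc δ a b) / (2 * |δ| * √a) := by
  have hδ' := abs_pos.2 hδ
  have ha' := Real.sqrt_pos.2 ha
  rw [phase, Real.exp_log]; · rfl
  refine div_pos ?_ (by positivity)
  have h1 := disc_sq (δ := δ) ha hb
  have h2 := disc_pos hδ ha hb
  have h3 : 0 < δ ^ 2 * a := by positivity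
  by_contra h4
  have h5 : a - b - δ ^ 2 + disc δ a b ≤ 0 := not_lt.1 h4
  nlinarith

theorem exp_neg_phase (hδ : δ ≠ 0) (ha : 0 < a) (hb : 0 < b) :
    Real.exp (-phase δ a b) = (disc δ a b - (a - b - δ ^ 2)) / (2 * |δ| * √a) := by
  have h := exp_phase hδ ha hb
  have hδ' := abs_pos.2 hδ
  have ha' := Real.sqrt_pos.2 ha
  have h1 := disc_sq (δ := δ) ha hb
  have h2 := Real.exp_pos (phase δ a b)
  rw [Real.exp_neg, inv_eq_iff_eq_inv, h, inv_div, div_eq_div_iff (by positivity)]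
  · have e1 := Real.sq_sqrt ha.le
    have e2 := sq_abs δ
    have : (2 * |δ| * √a) * (2 * |δ| * √a) = 4 * δ ^ 2 * a := by
      calc _ = 4 * |δ| ^ 2 * (√a) ^ 2 := by ring
        _ = _ := by rw [e1, e2]
    rw [this]
    linear_combination h1
  · intro h3
    have h4 : 0 < δ ^ 2 * a := by positivity
    nlinarith

theorem cosh_phase (hδ : δ ≠ 0) (ha : 0 < a) (hb : 0 < b) :
    Real.cosh (phase δ a b) = disc δ a b / (2 * |δ| * √a) := by
  rw [Real.cosh_eq, exp_phase hδ ha hb, exp_neg_phase hδ ha hb]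
  ring

theorem sinh_phase (hδ : δ ≠ 0) (ha : 0 < a) (hb : 0 < b) :
    Real.sinh (phase δ a b) = (a - b - δ ^ 2) / (2 * |δ| * √a) := by
  rw [Real.sinh_eq, exp_phase hδ ha hb, exp_neg_phase hδ ha hb]
  ring

theorem cosh_rate_add_phase (hδ : δ ≠ 0) (ha : 0 < a) (hb : 0 < b) :
    Real.cosh (rate δ a b + phase δ a b) = disc δ a b / (2 * |δ| * √b) := by
  have hδ' := abs_pos.2 hδ
  have ha' := Real.sqrt_pos.2 ha
  have hb' := Real.sqrt_pos.2 hb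
  have e1 := Real.sq_sqrt ha.le
  rw [Real.cosh_add, cosh_rate δ ha hb, sinh_rate δ ha hb, cosh_phase hδ ha hb,
    sinh_phase hδ ha hb]
  field_simp
  rw [e1]
  ring

theorem sinh_rate_add_phase (hδ : δ ≠ 0) (ha : 0 < a) (hb : 0 < b) :
    Real.sinh (rate δ a b + phase δ a b) = (δ ^ 2 + a - b) / (2 * |δ| * √b) := by
  have hδ' := abs_pos.2 hδ
  have ha' := Real.sqrt_pos.2 ha
  have hb' := Real.sqrt_pos.2 hb
  have e1 := Real.sq_sqrt ha.le
  have h1 := disc_sq (δ := δ) ha hb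
  rw [Real.sinh_add, cosh_rate δ ha hb, sinh_rate δ ha hb, cosh_phase hδ ha hb,
    sinh_phase hδ ha hb]
  field_simp
  rw [e1, h1]
  ring

theorem tanh_phase (hδ : δ ≠ 0) (ha : 0 < a) (hb : 0 < b) :
    Real.tanh (phase δ a b) = (a - b - δ ^ 2) / disc δ a b := by
  have := disc_pos hδ ha hb
  have hδ' := abs_pos.2 hδ
  have ha' := Real.sqrt_pos.2 ha
  rw [Real.tanh_eq_sinh_div_cosh, sinh_phase hδ ha hb, cosh_phase hδ ha hb]
  field_simp

theorem tanh_rate_add_phase (hδ : δ ≠ 0) (ha : 0 < a) (hb : 0 < b) :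
    Real.tanh (rate δ a b + phase δ a b) = (δ ^ 2 + a - b) / disc δ a b := by
  have := disc_pos hδ ha hb
  have hδ' := abs_pos.2 hδ
  have hb' := Real.sqrt_pos.2 hb
  rw [Real.tanh_eq_sinh_div_cosh, sinh_rate_add_phase hδ ha hb, cosh_rate_add_phase hδ ha hb]
  field_simp

theorem amplitude_eq (hδ : δ ≠ 0) (ha : 0 < a) (hb : 0 < b) :
    amplitude δ a b = disc δ a b / (2 * δ) := by
  have := disc_pos hδ ha hb
  rw [amplitude, tanh_rate_add_phase hδ ha hb, tanh_phase hδ ha hb, ← sub_div]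
  have : δ ^ 2 + a - b - (a - b - δ ^ 2) = 2 * δ ^ 2 := by ring
  rw [this]
  field_simp

theorem shift_zero (δ a b : ℝ) : shift δ a b 0 = 0 := by simp [shift]

theorem shift_of_eq_zero (a b t : ℝ) : shift 0 a b t = 0 := by simp [shift, amplitude]

theorem shift_one (ha : 0 < a) (hb : 0 < b) : shift δ a b 1 = δ := by
  rcases eq_or_ne δ 0 with rfl | hδ
  · exact shift_of_eq_zero a b 1
  have := disc_pos hδ ha hb
  rw [shift, mul_one, amplitude]
  refine div_mul_cancel₀ _ ?_
  rw [tanh_rate_add_phase hδ ha hb, tanh_phase hδ ha hb, ← sub_div]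
  have : δ ^ 2 + a - b - (a - b - δ ^ 2) = 2 * δ ^ 2 := by ring
  rw [this]
  positivity

theorem variance_zero (ha : 0 < a) (hb : 0 < b) : variance δ a b 0 = a := by
  rcases eq_or_ne δ 0 with rfl | hδ
  · simp [variance]
  have h1 := disc_pos hδ ha hb
  have ha' := Real.sqrt_pos.2 ha
  have hδ' := abs_pos.2 hδ
  rw [variance, if_neg hδ, mul_zero, zero_add, amplitude_eq hδ ha hb, cosh_phase hδ ha hb, div_pow,
    div_pow, div_pow, mul_pow, mul_pow, mul_pow, sq_abs, Real.sq_sqrt ha.le]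
  field_simp

theorem variance_one (ha : 0 < a) (hb : 0 < b) : variance δ a b 1 = b := by
  rcases eq_or_ne δ 0 with rfl | hδ
  · simp [variance]
  have h1 := disc_pos hδ ha hb
  have hb' := Real.sqrt_pos.2 hb
  have hδ' := abs_pos.2 hδ
  rw [variance, if_neg hδ, mul_one, amplitude_eq hδ ha hb, cosh_rate_add_phase hδ ha hb, div_pow,
    div_pow, div_pow, mul_pow, mul_pow, mul_pow, sq_abs, Real.sq_sqrt hb.le]
  field_simp

theorem amplitude_ne_zero (hδ : δ ≠ 0) (ha : 0 < a) (hb : 0 < b) : amplitude δ a b ≠ 0 := by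
  have := disc_pos hδ ha hb
  rw [amplitude_eq hδ ha hb]
  positivity

theorem variance_pos (ha : 0 < a) (hb : 0 < b) (t : ℝ) : 0 < variance δ a b t := by
  rw [variance]
  split_ifs with hδ
  · positivity
  · have := amplitude_ne_zero hδ ha hb
    have := Real.cosh_pos (rate δ a b * t + phase δ a b)
    positivity

theorem variance_zero_zero (t : ℝ) : variance 0 0 0 t = 0 := by
  rw [variance, if_pos rfl]
  rcases eq_or_ne t 0 with rfl | ht
  · simp
  · simp [Real.zero_rpow ht]

theorem rate_of_eq_zero (ha : 0 < a) (hb : 0 < b) : rate 0 a b ^ 2 = (Real.log (b / a) / 2) ^ 2 := by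
  have h1 : Real.cosh (rate 0 a b) = Real.cosh (Real.log (b / a) / 2) := by
    rw [cosh_rate 0 ha hb, Real.cosh_eq]
    have e : Real.exp (Real.log (b / a) / 2) = √b / √a := by
      rw [← Real.sqrt_div hb.le, Real.sqrt_eq_rpow, Real.rpow_def_of_pos (div_pos hb ha)]
      congr 1; ring
    rw [Real.exp_neg, e, inv_div]
    have ha' := Real.sqrt_pos.2 ha
    have hb' := Real.sqrt_pos.2 hb
    field_simp
    rw [Real.sq_sqrt ha.le, Real.sq_sqrt hb.le]
    ring
  have h2 : |rate 0 a b| = |Real.log (b / a) / 2| :=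
    le_antisymm (Real.cosh_le_cosh.1 h1.le) (Real.cosh_le_cosh.1 h1.ge)
  rw [← sq_abs, h2, sq_abs]

/-- The logarithmic derivative of the explicit variance. -/
noncomputable def logRate (δ a b t : ℝ) : ℝ :=
  if δ = 0 then Real.log (b / a) else -2 * rate δ a b * Real.tanh (rate δ a b * t + phase δ a b)

/-- The velocity of the explicit mean. -/
noncomputable def shiftRate (δ a b t : ℝ) : ℝ :=
  amplitude δ a b * (rate δ a b / Real.cosh (rate δ a b * t + phase δ a b) ^ 2)

theorem hasDerivAt_tanh (x : ℝ) : HasDerivAt Real.tanh (1 / Real.cosh x ^ 2) x := by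
  have h := (Real.hasDerivAt_sinh x).div (Real.hasDerivAt_cosh x) (Real.cosh_pos x).ne'
  have e : (Real.sinh / Real.cosh) = Real.tanh := funext fun y => (Real.tanh_eq_sinh_div_cosh y).symm
  rw [e] at h
  refine h.congr_deriv ?_
  rw [← Real.cosh_sq_sub_sinh_sq x]
  ring

theorem hasDerivAt_shift (δ a b t : ℝ) :
    HasDerivAt (shift δ a b) (shiftRate δ a b t) t := by
  have h1 : HasDerivAt (fun t => rate δ a b * t + phase δ a b) (rate δ a b) t := by
    simpa using ((hasDerivAt_id t).const_mul (rate δ a b)).add_const (phase δ a b)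
  have := (((hasDerivAt_tanh _).comp t h1).sub_const (Real.tanh (phase δ a b))).const_mul
    (amplitude δ a b)
  refine this.congr_deriv ?_
  rw [shiftRate]; ring

theorem hasDerivAt_variance (ha : 0 < a) (hb : 0 < b) (t : ℝ) :
    HasDerivAt (variance δ a b) (logRate δ a b t * variance δ a b t) t := by
  rcases eq_or_ne δ 0 with rfl | hδ
  · have e : variance 0 a b = fun t => Real.exp (Real.log a + t * Real.log (b / a)) := by
      funext s
      rw [variance, if_pos rfl, Real.rpow_def_of_pos ha, Real.rpow_def_of_pos hb, ← Real.exp_add,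
        Real.log_div hb.ne' ha.ne']
      congr 1; ring
    rw [e, logRate, if_pos rfl]
    have h1 : HasDerivAt (fun t => Real.log a + t * Real.log (b / a)) (Real.log (b / a)) t := by
      simpa using ((hasDerivAt_id t).mul_const (Real.log (b / a))).const_add (Real.log a)
    exact h1.exp.congr_deriv (mul_comm _ _)
  · have e : variance δ a b =
        fun t => (amplitude δ a b / Real.cosh (rate δ a b * t + phase δ a b)) ^ 2 := by
      funext s; rw [variance, if_neg hδ]
    rw [e, logRate, if_neg hδ]
    have h1 : HasDerivAt (fun t => rate δ a b * t + phase δ a b) (rate δ a b) t := by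
      simpa using ((hasDerivAt_id t).const_mul (rate δ a b)).add_const (phase δ a b)
    have hc := Real.cosh_pos (rate δ a b * t + phase δ a b)
    have := ((hasDerivAt_const t (amplitude δ a b)).div h1.cosh hc.ne').pow 2
    refine this.congr_deriv ?_
    rw [Real.tanh_eq_sinh_div_cosh]
    simp only [Pi.div_apply]
    generalize rate δ a b * t + phase δ a b = x at hc ⊢
    norm_num
    field_simp

/-- The explicit curve has constant density `½ β²`. -/
theorem explicit_density (ha : 0 < a) (hb : 0 < b) (t : ℝ) :
    (1 / 2) * (shiftRate δ a b t ^ 2 / variance δ a b t) + (1 / 8) * logRate δ a b t ^ 2 =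
      (1 / 2) * rate δ a b ^ 2 := by
  rcases eq_or_ne δ 0 with rfl | hδ
  · rw [rate_of_eq_zero ha hb, logRate, if_pos rfl]
    simp [shiftRate, amplitude]
    ring
  · have hr := amplitude_ne_zero hδ ha hb
    have hc := Real.cosh_pos (rate δ a b * t + phase δ a b)
    rw [shiftRate, logRate, if_neg hδ, variance, if_neg hδ, Real.tanh_eq_sinh_div_cosh]
    have h := Real.cosh_sq (rate δ a b * t + phase δ a b)
    field_simp
    rw [h]
    ring

end Scalar

/-! ### Lower bounds by conditioning on one coordinate -/

section Schur

variable {ι : Type*} [Fintype ι] [DecidableEq ι]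

theorem dens_add_le {A B : Matrix ι ι ℝ} (hA : A.PosSemidef) (hB : B.PosSemidef) (v : ι → ℝ)
    {X : Matrix ι ι ℝ} (hX : Xᵀ = X) : dens A v X + dens B v X ≤ dens (A + B) v X := by
  have h1 : 0 ≤ (X * A * X * B).trace := by
    have := posSemidef_congr_mul hA X
    rw [hX] at this
    exact trace_mul_nonneg this hB
  have h2 : (X * B * X * A).trace = (X * A * X * B).trace := by
    rw [Matrix.mul_assoc (X * B), trace_mul_comm, ← Matrix.mul_assoc]
  simp only [dens, add_mulVec, dotProduct_add, Matrix.mul_add, Matrix.add_mul, trace_add]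
  linarith

/-- The linear map that conditions on the coordinate `l`: the column with index `j` is
`eʲ - (K j l / K l l) eˡ`, which is orthogonal to `eˡ` for the bilinear form `K`. -/
noncomputable def schurMap (K : Matrix ι ι ℝ) (l : ι) : Matrix ι {i // i ≠ l} ℝ :=
  Matrix.of fun i j => (if i = j then 1 else 0) - (if i = l then K j l / K l l else 0)

variable {K X : Matrix ι ι ℝ} {l : ι}

theorem transpose_schurMap_mulVec (v : ι → ℝ) (j : {i // i ≠ l}) :
    ((schurMap K l)ᵀ *ᵥ v) j = v j - K j l / K l l * v l := by
  simp [Matrix.mulVec, dotProduct, schurMap, sub_mul, Finset.sum_sub_distrib, ite_mul]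

theorem schurMap_mulVec (w : {i // i ≠ l} → ℝ) (i : {i // i ≠ l}) :
    (schurMap K l *ᵥ w) i = w i := by
  have h : ∀ j : {i // i ≠ l}, ((i : ι) = j) = (i = j) := fun j => by rw [Subtype.ext_iff]
  simp [Matrix.mulVec, dotProduct, schurMap, i.2, h]

theorem schurMap_congr_apply (K X : Matrix ι ι ℝ) (i j : {i // i ≠ l}) :
    ((schurMap K l)ᵀ * X * schurMap K l) i j =
      X i j - K i l / K l l * X l j - (X i l - K i l / K l l * X l l) * (K j l / K l l) := by
  have h1 : ∀ k, ((schurMap K l)ᵀ * X) i k = X i k - K i l / K l l * X l k := fun k =>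
    transpose_schurMap_mulVec (fun r => X r k) i
  have h2 := transpose_schurMap_mulVec (K := K) (((schurMap K l)ᵀ * X) i) j
  rw [Matrix.mul_apply']
  rw [Matrix.mulVec, dotProduct_comm] at h2
  refine h2.trans ?_
  rw [h1, h1]
  ring

/-- The Schur complement of the diagonal entry with index `l`. -/
noncomputable def schurCompl (K : Matrix ι ι ℝ) (l : ι) : Matrix {i // i ≠ l} {i // i ≠ l} ℝ :=
  (schurMap K l)ᵀ * K * schurMap K l

theorem schurCompl_apply (hd : K l l ≠ 0) (i j : {i // i ≠ l}) :
    schurCompl K l i j = K i j - K i l * K l j / K l l := by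
  rw [schurCompl, schurMap_congr_apply]
  field_simp
  ring

theorem posDef_diag_pos (hK : K.PosDef) (l : ι) : 0 < K l l := by
  have h : (Pi.single l 1 : ι → ℝ) ≠ 0 := by simp
  simpa [single_dotProduct_mulVec_single] using posDef_pos hK h

theorem schurCompl_posDef (hK : K.PosDef) (l : ι) : (schurCompl K l).PosDef := by
  have hs := posSemidef_transpose_eq hK.posSemidef
  refine posDef_of_pos ?_ fun w hw => ?_
  · simp only [schurCompl, transpose_mul, transpose_transpose, hs, Matrix.mul_assoc]
  · rw [schurCompl, ← dotProduct_congr]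
    refine posDef_pos hK fun h => hw ?_
    ext i
    rw [← schurMap_mulVec (K := K) w i, h]
    rfl

/-- The inverse of a positive definite matrix in terms of a Schur complement. -/
theorem inv_eq_schur (hK : K.PosDef) (l : ι) :
    K⁻¹ = Matrix.single l l (K l l)⁻¹ + schurMap K l * (schurCompl K l)⁻¹ * (schurMap K l)ᵀ := by
  have hs := posSemidef_transpose_eq hK.posSemidef
  have hd := (posDef_diag_pos hK l).ne'
  set F := schurMap K l with hF
  set S := schurCompl K l with hS
  have hSu : IsUnit S.det := (isUnit_iff_isUnit_det _).1 (schurCompl_posDef hK l).isUnit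
  refine Matrix.inv_eq_left_inv ?_
  -- both sides are compared on `eˡ` and on the columns of `F`, which form a basis
  set A := Matrix.single l l (K l l)⁻¹ + F * S⁻¹ * Fᵀ with hA
  have hbasis : (1 : Matrix ι ι ℝ) = vecMulVec (Pi.single l 1) (fun j => K j l / K l l)
      + F * (Matrix.of fun (i : {i // i ≠ l}) (j : ι) => if (i : ι) = j then (1 : ℝ) else 0) := by
    ext i j
    rw [Matrix.add_apply, vecMulVec_apply, Matrix.mul_apply]
    by_cases hj : j = l
    · have : ∀ x : {i // i ≠ l}, (if (x : ι) = l then (1 : ℝ) else 0) = 0 := fun x =>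
        if_neg x.2
      simp only [Matrix.of_apply, this, mul_zero, Finset.sum_const_zero, add_zero, hj, div_self hd,
        mul_one]
      simp [Matrix.one_apply, Pi.single_apply, hj]
    · rw [Finset.sum_eq_single (⟨j, hj⟩ : {i // i ≠ l})]
      · simp only [Matrix.of_apply, if_true, mul_one, hF, schurMap, Matrix.one_apply,
          Pi.single_apply]
        split_ifs <;> simp
      · intro x _ hx
        rw [Matrix.of_apply, if_neg (fun h => hx (Subtype.ext h)), mul_zero]
      · simp
  have h1 : Fᵀ *ᵥ (K *ᵥ Pi.single l 1) = 0 := by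
    ext j
    rw [transpose_schurMap_mulVec]
    simp [hd]
  have h2 : (A * K) *ᵥ Pi.single l 1 = Pi.single l 1 := by
    rw [← mulVec_mulVec, hA, add_mulVec, ← mulVec_mulVec, ← mulVec_mulVec, h1]
    simp only [mulVec_zero, add_zero]
    ext i
    rw [single_mulVec]
    by_cases hi : i = l
    · subst hi; simp [hd]
    · simp [hi]
  have h3 : Matrix.single l l (K l l)⁻¹ * K * F = 0 := by
    rw [← transpose_inj, transpose_mul, transpose_mul, hs, transpose_zero]
    ext j i
    rw [transpose_single]
    have h4 : (K * Matrix.single l l (K l l)⁻¹) = vecMulVec (K *ᵥ Pi.single l 1)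
        (Pi.single l (K l l)⁻¹) := by
      rw [← mul_vecMulVec]
      congr 1
      ext r s
      rw [vecMulVec_apply, Matrix.single_apply, Pi.single_apply, Pi.single_apply]
      by_cases hr : l = r <;> by_cases hs : l = s <;>
        simp [hr, hs, eq_comm]
    rw [h4, mul_vecMulVec, h1]
    simp [vecMulVec_apply]
  have h5 : A * K * F = F := by
    rw [hA, Matrix.add_mul, Matrix.add_mul, h3, zero_add]
    have : F * S⁻¹ * Fᵀ * K * F = F * S⁻¹ * S := by
      rw [hS, schurCompl, ← hF]; simp only [Matrix.mul_assoc]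
    rw [this, Matrix.mul_assoc, nonsing_inv_mul _ hSu, Matrix.mul_one]
  calc A * K = A * K * 1 := (Matrix.mul_one _).symm
    _ = 1 := by
      conv_lhs => rw [hbasis]
      rw [Matrix.mul_add, mul_vecMulVec, h2, ← Matrix.mul_assoc, h5, ← hbasis]

/-- The action density dominates the sum of the density of one coordinate and the density of the
conditional covariance of the others. -/
theorem schur_dens_le (hK : K.PosDef) (l : ι) (v : ι → ℝ) (hX : Xᵀ = X) :
    (1 / 2) * (v l ^ 2 / K l l) + (1 / 8) * (X l l / K l l) ^ 2
      + dens (schurCompl K l)⁻¹ 0 ((schurMap K l)ᵀ * X * schurMap K l) ≤ dens K⁻¹ v X := by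
  have hd := posDef_diag_pos hK l
  have hS := (schurCompl_posDef hK l).inv.posSemidef
  have hP1 : (Matrix.single l l (K l l)⁻¹).PosSemidef := by
    refine posSemidef_of_nonneg (transpose_single _ _ _) fun w => ?_
    have : w ⬝ᵥ (Matrix.single l l (K l l)⁻¹ *ᵥ w) = (K l l)⁻¹ * (w l * w l) := by
      rw [single_mulVec]
      simp [Function.update_apply, dotProduct]
      ring
    rw [this]
    exact mul_nonneg (inv_nonneg.2 hd.le) (mul_self_nonneg _)
  have hP2 : (schurMap K l * (schurCompl K l)⁻¹ * (schurMap K l)ᵀ).PosSemidef := by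
    simpa using posSemidef_congr_mul hS (schurMap K l)ᵀ
  have h1 : dens (Matrix.single l l (K l l)⁻¹) v X =
      (1 / 2) * (v l ^ 2 / K l l) + (1 / 8) * (X l l / K l l) ^ 2 := by
    have e1 : v ⬝ᵥ (Matrix.single l l (K l l)⁻¹ *ᵥ v) = v l ^ 2 / K l l := by
      rw [single_mulVec]
      simp [Function.update_apply, dotProduct]
      ring
    have e2 : (X * Matrix.single l l (K l l)⁻¹ * X * Matrix.single l l (K l l)⁻¹).trace
        = (X l l / K l l) ^ 2 := by
      rw [Matrix.trace_mul_single]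
      have : (X * Matrix.single l l (K l l)⁻¹ * X) l l = X l l * (K l l)⁻¹ * X l l := by
        rw [Matrix.mul_apply, Finset.sum_eq_single l]
        · simp
        · intro b _ hb
          rw [Matrix.mul_single_apply_of_ne _ _ _ _ _ hb, zero_mul]
        · simp
      simp [this]
      ring
    rw [dens, e1, e2]
  have h2 : dens (schurMap K l * (schurCompl K l)⁻¹ * (schurMap K l)ᵀ) v X =
      dens (schurCompl K l)⁻¹ ((schurMap K l)ᵀ *ᵥ v) ((schurMap K l)ᵀ * X * schurMap K l) := by
    have := dens_congr (schurCompl K l)⁻¹ (schurMap K l)ᵀ v X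
    rw [transpose_transpose] at this
    exact this.symm
  have h3 := dens_add_le hP1 hP2 v hX
  rw [← inv_eq_schur hK, h1, h2] at h3
  refine le_trans ?_ h3
  have h4 := posSemidef_nonneg hS ((schurMap K l)ᵀ *ᵥ v)
  simp only [dens, zero_dotProduct]
  linarith

end Schur

section LowerBound

/-- In the hyperbolic half plane with coordinates `p` and `√D` the Busemann function of the end
point `ξ` is `1`-Lipschitz. -/
theorem busemann_sq_le {q D p' D' : ℝ} (hD : 0 < D) :
    (D' / (2 * D) - (2 * q * p' + D') / (q ^ 2 + D)) ^ 2 ≤ p' ^ 2 / D + (D' / (2 * D)) ^ 2 := by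
  have hN : 0 < q ^ 2 + D := by positivity
  have e : p' ^ 2 / D + (D' / (2 * D)) ^ 2
      - (D' / (2 * D) - (2 * q * p' + D') / (q ^ 2 + D)) ^ 2 =
      (p' * (q ^ 2 - D) + q * D') ^ 2 / (D * (q ^ 2 + D) ^ 2) := by
    field_simp
    ring
  have : 0 ≤ (p' * (q ^ 2 - D) + q * D') ^ 2 / (D * (q ^ 2 + D) ^ 2) := by positivity
  linarith

/-- The logarithms of the horocycle functions at the end points of the explicit geodesic differ by
the rate. -/
theorem busemann_sub {δ a b : ℝ} (hδ : δ ≠ 0) (ha : 0 < a) (hb : 0 < b) :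
    ∃ q : ℝ, (Real.log b / 2 - Real.log ((q + δ) ^ 2 + b)) -
      (Real.log a / 2 - Real.log (q ^ 2 + a)) = rate δ a b := by
  have key : ∀ x r : ℝ, r ≠ 0 → Real.log ((r / Real.cosh x) ^ 2) / 2 -
      Real.log ((r * (Real.tanh x - 1)) ^ 2 + (r / Real.cosh x) ^ 2) = x - Real.log (2 * |r|) := by
    intro x r hr
    have hc := Real.cosh_pos x
    have hr' := abs_pos.2 hr
    have e1 : (r * (Real.tanh x - 1)) ^ 2 + (r / Real.cosh x) ^ 2 =
        2 * |r| * Real.exp (-x) * (|r| / Real.cosh x) := by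
      rw [Real.tanh_eq_sinh_div_cosh, ← Real.cosh_sub_sinh]
      have h1 := Real.cosh_sq x
      have h2 := sq_abs r
      field_simp
      rw [h2]
      linear_combination (-r ^ 2) * h1
    have e2 : (r / Real.cosh x) ^ 2 = (|r| / Real.cosh x) ^ 2 := by rw [div_pow, div_pow, sq_abs]
    rw [e1, e2, Real.log_pow, Real.log_mul (by positivity) (by positivity),
      Real.log_mul (by positivity) (by positivity), Real.log_exp]
    push_cast
    ring
  have hr := amplitude_ne_zero hδ ha hb
  have h0 := variance_zero (δ := δ) ha hb
  have h1 := variance_one (δ := δ) ha hb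
  have h2 := shift_one (δ := δ) ha hb
  rw [variance, if_neg hδ, mul_zero, zero_add] at h0
  rw [variance, if_neg hδ, mul_one] at h1
  rw [shift, mul_one] at h2
  have k0 := key (phase δ a b) _ hr
  have k1 := key (rate δ a b + phase δ a b) _ hr
  rw [h0] at k0
  rw [h1] at k1
  refine ⟨amplitude δ a b * (Real.tanh (phase δ a b) - 1), ?_⟩
  have e : amplitude δ a b * (Real.tanh (phase δ a b) - 1) + δ =
      amplitude δ a b * (Real.tanh (rate δ a b + phase δ a b) - 1) := by
    linear_combination -h2
  rw [e, k0, k1]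
  ring

/-- The lower bound for one coordinate: half the square of the hyperbolic distance. -/
theorem rate_le_lintegral {p D : ℝ → ℝ} (hp : AbsolutelyContinuousOnInterval p 0 1)
    (hD : AbsolutelyContinuousOnInterval D 0 1) (hpos : ∀ t ∈ Icc (0 : ℝ) 1, 0 < D t)
    (hδ : p 1 - p 0 ≠ 0) :
    ENNReal.ofReal ((1 / 2) * rate (p 1 - p 0) (D 0) (D 1) ^ 2) ≤
      ∫⁻ t in Ioo (0 : ℝ) 1, ENNReal.ofReal
        ((1 / 2) * (deriv p t ^ 2 / D t) + (1 / 8) * (deriv D t / D t) ^ 2) := by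
  obtain ⟨q, hq⟩ := busemann_sub hδ (hpos 0 ⟨le_rfl, zero_le_one⟩) (hpos 1 ⟨zero_le_one, le_rfl⟩)
  set β := rate (p 1 - p 0) (D 0) (D 1) with hβ
  have hu : uIcc (0 : ℝ) 1 = Icc 0 1 := uIcc_of_le zero_le_one
  have hQ : AbsolutelyContinuousOnInterval (fun t => p t + (q - p 0)) 0 1 :=
    hp.fun_add (ac_const _)
  have hN : AbsolutelyContinuousOnInterval
      (fun t => (p t + (q - p 0)) * (p t + (q - p 0)) + D t) 0 1 := (hQ.fun_mul hQ).fun_add hD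
  have hNpos : ∀ t ∈ Icc (0 : ℝ) 1, 0 < (p t + (q - p 0)) * (p t + (q - p 0)) + D t :=
    fun t ht => add_pos_of_nonneg_of_pos (mul_self_nonneg _) (hpos t ht)
  have hl1 := ac_log hD (by rwa [hu])
  have hl2 := ac_log hN (by rwa [hu])
  set Ψ : ℝ → ℝ := fun t => (β / 2) * Real.log (D t)
    + ((-β) * Real.log ((p t + (q - p 0)) * (p t + (q - p 0)) + D t) + (-(β ^ 2 / 2)) * t) with hΨ
  have hac : AbsolutelyContinuousOnInterval Ψ 0 1 :=
    (hl1.const_mul _).fun_add ((hl2.const_mul _).fun_add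
      ((ac_of_contDiff contDiff_id).const_mul _))
  have hdiff : Ψ 1 - Ψ 0 = (1 / 2) * β ^ 2 := by
    have e1 : p 1 + (q - p 0) = q + (p 1 - p 0) := by ring
    have e2 : p 0 + (q - p 0) = q := by ring
    simp only [hΨ, e1, e2, ← pow_two]
    linear_combination β * hq
  rw [← hdiff]
  refine ofReal_sub_le_lintegral hac ?_
  filter_upwards [ac_hasDerivAt hp, ac_hasDerivAt hD, ae_Ioo_mem] with t h1 h2 ht
  have ht' := Ioo_subset_Icc_self ht
  have h3 := h1.add_const (q - p 0)
  have h4 := (((h2.log (hpos t ht').ne').const_mul (β / 2)).add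
    (((((h3.mul h3).add h2).log (hNpos t ht').ne').const_mul (-β)).add
      ((hasDerivAt_id t).const_mul (-(β ^ 2 / 2))))).deriv
  have h5 : deriv Ψ t = _ := h4
  rw [h5]
  simp only [Pi.add_apply, Pi.mul_apply]
  have hDt := hpos t ht'
  have hb := busemann_sq_le (q := p t + (q - p 0)) (p' := deriv p t) (D' := deriv D t) hDt
  generalize p t + (q - p 0) = Q at hb ⊢
  set y := deriv D t / (2 * D t) - (2 * Q * deriv p t + deriv D t) / (Q ^ 2 + D t) with hy
  have e3 : β / 2 * (deriv D t / D t) + (-β * ((deriv p t * Q + Q * deriv p t + deriv D t) /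
      (Q * Q + D t)) + -(β ^ 2 / 2) * 1) = β * y - β ^ 2 / 2 := by
    have e4 : Q * Q + D t = Q ^ 2 + D t := by ring
    have e5 : deriv p t * Q + Q * deriv p t = 2 * Q * deriv p t := by ring
    rw [e4, e5, hy]
    have : deriv D t / (2 * D t) = (deriv D t / D t) / 2 := by rw [mul_comm, div_div]
    rw [this]
    ring
  have e6 : (deriv D t / (2 * D t)) ^ 2 = (1 / 4) * (deriv D t / D t) ^ 2 := by
    rw [div_pow, div_pow, mul_pow]; ring
  rw [e6] at hb
  rw [e3]
  nlinarith [sq_nonneg (β - y)]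

variable {ι : Type*} [Fintype ι] [DecidableEq ι] {n : ℝ → ι → ℝ} {K : ℝ → Matrix ι ι ℝ}

theorem ac_inv {f : ℝ → ℝ} (hf : AbsolutelyContinuousOnInterval f 0 1)
    (h0 : ∀ t ∈ Icc (0 : ℝ) 1, 0 < f t) : AbsolutelyContinuousOnInterval (fun t => (f t)⁻¹) 0 1 := by
  have hu : uIcc (0 : ℝ) 1 = Icc 0 1 := uIcc_of_le zero_le_one
  have h1 := ac_comp_contDiff (φ := fun x => Real.exp (-x)) (ac_log hf (by rwa [hu]))
    (Real.contDiff_exp.comp contDiff_neg)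
  refine ac_congr h1 fun t ht => ?_
  rw [hu] at ht
  rw [Real.exp_neg, Real.exp_log (h0 t ht)]

/-- The curve of Schur complements. -/
theorem PosCurve.schur (h : PosCurve n K) (l : ι) :
    PosCurve (fun _ => (0 : {i // i ≠ l} → ℝ)) (fun t => schurCompl (K t) l) ∧
      energy (fun _ => (0 : {i // i ≠ l} → ℝ)) (fun t => schurCompl (K t) l) =
        ∫⁻ t in Ioo (0 : ℝ) 1, ENNReal.ofReal (dens (schurCompl (K t) l)⁻¹ 0
          ((schurMap (K t) l)ᵀ * velMat K t * schurMap (K t) l)) := by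
  have hpos : ∀ t ∈ Icc (0 : ℝ) 1, 0 < K t l l := fun t ht => posDef_diag_pos (h.posDef t ht) l
  refine ⟨⟨fun i => ac_const _, fun i j => ?_, fun t ht => schurCompl_posDef (h.posDef t ht) l⟩, ?_⟩
  · refine ac_congr ((h.ac_cov i j).fun_add ((((h.ac_cov i l).fun_mul (h.ac_cov l j)).fun_mul
      (ac_inv (h.ac_cov l l) hpos)).const_mul (-1))) fun t ht => ?_
    rw [uIcc_of_le zero_le_one] at ht
    rw [schurCompl_apply (hpos t ht).ne']
    ring
  · refine energy_eq ?_
    filter_upwards [ae_hasMatDeriv h.ac_cov, ae_Ioo_mem] with t ht ht1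
    refine ⟨fun i => hasDerivWithinAt_const _ _ _, fun i j => ?_⟩
    have hp := hpos t (Ioo_subset_Icc_self ht1)
    have h1 := fun a b => hasDerivWithinAt_univ.1 (ht a b)
    have h2 := (h1 i j).sub (((h1 i l).mul (h1 l j)).div (h1 l l) hp.ne')
    refine HasDerivAt.hasDerivWithinAt ?_
    have hsym : K t l j = K t j l :=
      congrFun (congrFun (h.symm (Ioo_subset_Icc_self ht1)) j) l
    refine (h2.congr_of_eventuallyEq ?_).congr_deriv ?_
    · filter_upwards [Icc_mem_nhds ht1.1 ht1.2] with s hs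
      exact schurCompl_apply (hpos s hs).ne' i j
    · rw [schurMap_congr_apply]
      simp only [Pi.mul_apply]
      rw [hsym]
      field_simp
      ring

/-- The lower bound for curves between diagonal covariances whose means differ in one coordinate. -/
theorem PosCurve.le_energy_of_single (h : PosCurve n K) (l : ι) (hn : n 1 l - n 0 l ≠ 0)
    {a b : ι → ℝ} (ha : ∀ i, 0 < a i) (hb : ∀ i, 0 < b i) (h0 : K 0 = Matrix.diagonal a)
    (h1 : K 1 = Matrix.diagonal b) :
    ENNReal.ofReal ((1 / 2) * (rate (n 1 l - n 0 l) (a l) (b l) ^ 2 +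
      ∑ i with i ≠ l, rate 0 (a i) (b i) ^ 2)) ≤ energy n K := by
  have hpos : ∀ t ∈ Icc (0 : ℝ) 1, 0 < K t l l := fun t ht => posDef_diag_pos (h.posDef t ht) l
  obtain ⟨hc, he⟩ := h.schur l
  have hS : ∀ c : ι → ℝ, (∀ i, 0 < c i) →
      schurCompl (Matrix.diagonal c) l = Matrix.diagonal fun i : {i // i ≠ l} => c i := by
    intro c hcp
    ext i j
    rw [schurCompl_apply (by simpa using (hcp l).ne')]
    rw [Matrix.diagonal_apply_ne _ i.2, zero_mul, zero_div, sub_zero, Matrix.diagonal_apply,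
      Matrix.diagonal_apply]
    simp [Subtype.ext_iff]
  have hl1 := rate_le_lintegral (h.ac_mean l) (h.ac_cov l l) hpos hn
  have hl2 := hc.le_energy_of_mean_eq rfl (fun i => ha i) (fun i => hb i)
    (by rw [h0, hS a ha]) (by rw [h1, hS b hb])
  rw [h0, h1, Matrix.diagonal_apply_eq, Matrix.diagonal_apply_eq] at hl1
  have hsum : (1 / 2) * ∑ i with i ≠ l, rate 0 (a i) (b i) ^ 2 =
      (1 / 8) * ∑ i : {i // i ≠ l}, Real.log (b i / a i) ^ 2 := by
    rw [Finset.sum_subtype (p := fun i => i ≠ l) _ (by simp), Finset.mul_sum, Finset.mul_sum]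
    refine Finset.sum_congr rfl fun i _ => ?_
    rw [rate_of_eq_zero (ha i) (hb i)]
    ring
  rw [mul_add, hsum, ENNReal.ofReal_add (by positivity) (by positivity)]
  refine (add_le_add hl1 (hl2.trans he.le)).trans ?_
  rw [← lintegral_add_left']
  · refine lintegral_mono_ae ?_
    filter_upwards [ae_Ioo_mem] with t ht
    have ht' := Ioo_subset_Icc_self ht
    have h3 := schur_dens_le (h.posDef t ht') l (vel n t) (h.velMat_symm ht)
    have h4 := hpos t ht'
    rw [← ENNReal.ofReal_add]
    · exact ENNReal.ofReal_le_ofReal h3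
    · positivity
    · refine dens_nonneg (schurCompl_posDef (h.posDef t ht') l).inv.posSemidef _ ?_
      simp only [transpose_mul, transpose_transpose, h.velMat_symm ht, Matrix.mul_assoc]
  · have hm1 : AEMeasurable (deriv fun t => n t l) (volume.restrict (Ioo (0 : ℝ) 1)) :=
      (measurable_deriv _).aemeasurable
    have hm2 : AEMeasurable (deriv fun t => K t l l) (volume.restrict (Ioo (0 : ℝ) 1)) :=
      (measurable_deriv _).aemeasurable
    have hm3 := h.aeMeasMat_cov l l
    exact ((((hm1.pow_const 2).div hm3).const_mul _).add
      (((hm2.div hm3).pow_const 2).const_mul _)).ennreal_ofReal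

end LowerBound

/-! ### The explicit curve between diagonal covariances -/

section Diagonal

variable {ι : Type*} [Fintype ι] [DecidableEq ι] {δ a b : ι → ℝ}

theorem ac_of_hasDerivAt {f f' : ℝ → ℝ} (h : ∀ t, HasDerivAt f (f' t) t) (hc : Continuous f') :
    AbsolutelyContinuousOnInterval f 0 1 := by
  refine ac_of_contDiff (contDiff_one_iff_deriv.2 ⟨fun t => (h t).differentiableAt, ?_⟩)
  rwa [funext fun t => (h t).deriv]

theorem continuous_tanh : Continuous Real.tanh :=
  continuous_iff_continuousAt.2 fun x => (hasDerivAt_tanh x).continuousAt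

theorem ac_shift (δ a b : ℝ) : AbsolutelyContinuousOnInterval (shift δ a b) 0 1 := by
  refine ac_of_hasDerivAt (hasDerivAt_shift δ a b) ?_
  unfold shiftRate
  have : Continuous fun t : ℝ => Real.cosh (rate δ a b * t + phase δ a b) := by fun_prop
  exact continuous_const.mul (continuous_const.div (this.pow 2)
    fun t => (pow_pos (Real.cosh_pos _) 2).ne')

theorem ac_variance {δ a b : ℝ} (ha : 0 < a) (hb : 0 < b) :
    AbsolutelyContinuousOnInterval (variance δ a b) 0 1 := by
  refine ac_of_hasDerivAt (hasDerivAt_variance ha hb) (Continuous.mul ?_ ?_)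
  · unfold logRate
    split_ifs
    · exact continuous_const
    · exact continuous_const.mul (continuous_tanh.comp (by fun_prop))
  · exact continuous_iff_continuousAt.2 fun t => (hasDerivAt_variance ha hb t).continuousAt

/-- The explicit mean in coordinates. -/
noncomputable def diagMean (δ a b : ι → ℝ) (t : ℝ) : ι → ℝ := fun i => shift (δ i) (a i) (b i) t

/-- The explicit covariance in coordinates. -/
noncomputable def diagCov (δ a b : ι → ℝ) (t : ℝ) : Matrix ι ι ℝ :=
  Matrix.diagonal fun i => variance (δ i) (a i) (b i) t

theorem diagMean_zero (δ a b : ι → ℝ) : diagMean δ a b 0 = 0 := funext fun _ => shift_zero _ _ _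

theorem diagMean_one (ha : ∀ i, 0 < a i) (hb : ∀ i, 0 < b i) : diagMean δ a b 1 = δ :=
  funext fun i => shift_one (ha i) (hb i)

theorem diagCov_zero (ha : ∀ i, 0 < a i) (hb : ∀ i, 0 < b i) :
    diagCov δ a b 0 = Matrix.diagonal a :=
  congrArg _ (funext fun i => variance_zero (ha i) (hb i))

theorem diagCov_one (ha : ∀ i, 0 < a i) (hb : ∀ i, 0 < b i) :
    diagCov δ a b 1 = Matrix.diagonal b :=
  congrArg _ (funext fun i => variance_one (ha i) (hb i))

theorem posCurve_diag (ha : ∀ i, 0 < a i) (hb : ∀ i, 0 < b i) :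
    PosCurve (diagMean δ a b) (diagCov δ a b) := by
  refine ⟨fun i => ac_shift _ _ _, fun i j => ?_, fun t _ =>
    PosDef.diagonal fun i => variance_pos (ha i) (hb i) t⟩
  rcases eq_or_ne i j with rfl | hij
  · simpa [diagCov] using ac_variance (ha i) (hb i)
  · simpa [diagCov, Matrix.diagonal_apply_ne _ hij] using ac_const (0 : ℝ)

/-- The action of the explicit curve. -/
theorem energy_diag (ha : ∀ i, 0 < a i) (hb : ∀ i, 0 < b i) :
    energy (diagMean δ a b) (diagCov δ a b) =
      ENNReal.ofReal ((1 / 2) * ∑ i, rate (δ i) (a i) (b i) ^ 2) := by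
  rw [energy_eq (v := fun t i => shiftRate (δ i) (a i) (b i) t)
    (X := fun t => Matrix.diagonal fun i =>
      logRate (δ i) (a i) (b i) t * variance (δ i) (a i) (b i) t)]
  · have : ∀ t ∈ Ioo (0 : ℝ) 1, ENNReal.ofReal (dens (diagCov δ a b t)⁻¹
        (fun i => shiftRate (δ i) (a i) (b i) t) (Matrix.diagonal fun i =>
        logRate (δ i) (a i) (b i) t * variance (δ i) (a i) (b i) t)) =
        ENNReal.ofReal ((1 / 2) * ∑ i, rate (δ i) (a i) (b i) ^ 2) := by
      intro t _
      have hv := fun i => variance_pos (δ := δ i) (ha i) (hb i) t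
      have hinv : (diagCov δ a b t)⁻¹ =
          Matrix.diagonal fun i => (variance (δ i) (a i) (b i) t)⁻¹ := by
        refine Matrix.inv_eq_left_inv ?_
        rw [diagCov, diagonal_mul_diagonal, ← diagonal_one]
        exact congrArg _ (funext fun i => inv_mul_cancel₀ (hv i).ne')
      congr 1
      rw [hinv, dens, diagonal_mul_diagonal, diagonal_mul_diagonal, diagonal_mul_diagonal,
        trace_diagonal, dotProduct, Finset.mul_sum, Finset.mul_sum, Finset.mul_sum,
        ← Finset.sum_add_distrib]
      refine Finset.sum_congr rfl fun i _ => ?_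
      rw [← explicit_density (ha i) (hb i) t, mulVec_diagonal]
      have := (hv i).ne'
      field_simp
    rw [setLIntegral_congr_fun measurableSet_Ioo this]
    simp
  · refine Eventually.of_forall fun t => ⟨fun i =>
      (hasDerivAt_shift _ _ _ t).hasDerivWithinAt, fun i j => ?_⟩
    refine HasDerivAt.hasDerivWithinAt ?_
    rcases eq_or_ne i j with rfl | hij
    · simpa [diagCov] using hasDerivAt_variance (ha i) (hb i) t
    · simpa [diagCov, Matrix.diagonal_apply_ne _ hij] using hasDerivAt_const t (0 : ℝ)

/-- The explicit curve has least action if the displacement has at most one non-zero coordinate. -/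
theorem isMinimal_diag (ha : ∀ i, 0 < a i) (hb : ∀ i, 0 < b i)
    (hδ : ∀ i j, δ i ≠ 0 → δ j ≠ 0 → i = j) :
    IsMinimal (diagMean δ a b) (diagCov δ a b) := by
  refine ⟨posCurve_diag ha hb, by rw [energy_diag ha hb]; exact ENNReal.ofReal_ne_top, ?_⟩
  intro n K h h0 h1 h2 h3
  rw [diagMean_zero] at h0
  rw [diagMean_one ha hb] at h1
  rw [diagCov_zero ha hb] at h2
  rw [diagCov_one ha hb] at h3
  rw [energy_diag ha hb]
  by_cases hex : ∃ l, δ l ≠ 0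
  · obtain ⟨l, hl⟩ := hex
    have h4 : n 1 l - n 0 l = δ l := by rw [h0, h1]; simp
    have h5 := h.le_energy_of_single l (by rwa [h4]) ha hb h2 h3
    rw [h4] at h5
    refine le_trans (le_of_eq ?_) h5
    congr 2
    rw [← Finset.add_sum_erase _ _ (Finset.mem_univ l), ← Finset.filter_ne']
    congr 1
    refine Finset.sum_congr rfl fun i hi => ?_
    have : δ i = 0 := by
      by_contra hi'
      exact (Finset.mem_filter.1 hi).2 (hδ i l hi' hl)
    rw [this]
  · have h4 : δ = 0 := funext fun l => by
      by_contra hl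
      exact hex ⟨l, hl⟩
    have h5 := h.le_energy_of_mean_eq (by rw [h0, h1, h4]) ha hb h2 h3
    refine le_trans (le_of_eq ?_) h5
    congr 1
    rw [Finset.mul_sum, Finset.mul_sum]
    refine Finset.sum_congr rfl fun i _ => ?_
    rw [h4, Pi.zero_apply, rate_of_eq_zero (ha i) (hb i)]
    ring

end Diagonal

/-! ### Coordinates on the image of the covariance -/

section Spectral

variable {d : ℕ}

/-- The spectral theorem together with the spectral calculus. -/
theorem exists_spectral {A : Matrix (Fin d) (Fin d) ℝ} (hA : Aᵀ = A) :
    ∃ (U : Matrix (Fin d) (Fin d) ℝ) (μ : Fin d → ℝ), Uᵀ * U = 1 ∧ U * Uᵀ = 1 ∧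
      A = U * Matrix.diagonal μ * Uᵀ ∧
      ∀ f : ℝ → ℝ, cfc f A = U * Matrix.diagonal (fun i => f (μ i)) * Uᵀ := by
  have hH : A.IsHermitian := by rwa [IsHermitian, conjTranspose_eq_transpose_of_trivial]
  have hc : ∀ f : ℝ → ℝ, cfc f A = (hH.eigenvectorUnitary : Matrix (Fin d) (Fin d) ℝ) *
      Matrix.diagonal (fun i => f (hH.eigenvalues i)) *
      (hH.eigenvectorUnitary : Matrix (Fin d) (Fin d) ℝ)ᵀ := by
    intro f
    rw [hH.cfc_eq, IsHermitian.cfc, Unitary.conjStarAlgAut_apply, star_eq_conjTranspose,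
      conjTranspose_eq_transpose_of_trivial]
    rfl
  have hU : (hH.eigenvectorUnitary : Matrix (Fin d) (Fin d) ℝ)ᵀ * hH.eigenvectorUnitary = 1 := by
    have := Unitary.coe_star_mul_self hH.eigenvectorUnitary
    rwa [star_eq_conjTranspose, conjTranspose_eq_transpose_of_trivial] at this
  refine ⟨hH.eigenvectorUnitary, hH.eigenvalues, hU, mul_eq_one_comm.1 hU, ?_, hc⟩
  have h1 : cfc (id : ℝ → ℝ) A = A := cfc_id ℝ A hH
  exact h1.symm.trans (hc id)

theorem spectral_mul {U : Matrix (Fin d) (Fin d) ℝ} (hU : Uᵀ * U = 1) (g h : Fin d → ℝ) :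
    (U * Matrix.diagonal g * Uᵀ) * (U * Matrix.diagonal h * Uᵀ) =
      U * Matrix.diagonal (fun i => g i * h i) * Uᵀ := by
  calc _ = U * Matrix.diagonal g * (Uᵀ * U) * Matrix.diagonal h * Uᵀ := by
        simp only [Matrix.mul_assoc]
    _ = _ := by rw [hU, Matrix.mul_one, Matrix.mul_assoc U, diagonal_mul_diagonal]

theorem spectral_transpose (U : Matrix (Fin d) (Fin d) ℝ) (g : Fin d → ℝ) :
    (U * Matrix.diagonal g * Uᵀ)ᵀ = U * Matrix.diagonal g * Uᵀ := by
  simp [transpose_mul, Matrix.mul_assoc]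

theorem spectral_nonneg {A U : Matrix (Fin d) (Fin d) ℝ} {μ : Fin d → ℝ} (hA : A.PosSemidef)
    (hU : Uᵀ * U = 1) (h : A = U * Matrix.diagonal μ * Uᵀ) (i : Fin d) : 0 ≤ μ i := by
  have h1 : Uᵀ * A * U = Matrix.diagonal μ := by
    calc _ = (Uᵀ * U) * Matrix.diagonal μ * (Uᵀ * U) := by rw [h]; simp only [Matrix.mul_assoc]
      _ = _ := by rw [hU, Matrix.one_mul, Matrix.mul_one]
  have h2 := (posSemidef_congr_mul hA U).diag_nonneg (i := i)
  rwa [h1, Matrix.diagonal_apply_eq] at h2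

theorem spectral_posSemidef {U : Matrix (Fin d) (Fin d) ℝ} {g : Fin d → ℝ} (hg : ∀ i, 0 ≤ g i) :
    (U * Matrix.diagonal g * Uᵀ).PosSemidef := by
  simpa using posSemidef_congr_mul (PosSemidef.diagonal hg) Uᵀ

/-- The defining properties of the Moore–Penrose inverse of a symmetric matrix. -/
theorem pinv_spec {C : Matrix (Fin d) (Fin d) ℝ} (hC : C.PosSemidef) :
    (pinv C).PosSemidef ∧ C * pinv C * C = C ∧ pinv C * C * pinv C = pinv C ∧
      C * pinv C = pinv C * C := by
  obtain ⟨U, μ, hU, -, h, hf⟩ := exists_spectral (posSemidef_transpose_eq hC)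
  have h0 := spectral_nonneg hC hU h
  have hp : pinv C = U * Matrix.diagonal (fun i => (μ i)⁻¹) * Uᵀ := hf _
  refine ⟨?_, ?_, ?_, ?_⟩
  · rw [hp]; exact spectral_posSemidef fun i => inv_nonneg.2 (h0 i)
  · rw [hp]; nth_rw 1 2 [h]
    rw [spectral_mul hU, spectral_mul hU]
    conv_rhs => rw [h]
    congr 3; ext i; exact mul_inv_mul_cancel _
  · rw [hp]; nth_rw 1 [h]
    rw [spectral_mul hU, spectral_mul hU]
    congr 3; ext i
    by_cases hi : μ i = 0
    · simp [hi]
    · field_simp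
  · rw [hp]; nth_rw 1 2 [h]
    rw [spectral_mul hU, spectral_mul hU]
    congr 3; ext i; exact mul_comm _ _

theorem mem_im {A : Matrix (Fin d) (Fin d) ℝ} {v : Fin d → ℝ} : v ∈ im A ↔ ∃ x, A *ᵥ x = v :=
  Iff.rfl

theorem mul_eq_of_im_le {P A B : Matrix (Fin d) (Fin d) ℝ} (h : im B ≤ im A) (hP : P * A = A) :
    P * B = B := by
  refine Matrix.ext_of_mulVec_single fun i => ?_
  obtain ⟨x, hx⟩ := mem_im.1 (h (mem_im.2 ⟨Pi.single i 1, rfl⟩))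
  rw [← mulVec_mulVec, ← hx, mulVec_mulVec, hP]

theorem im_le_of_mul {A P : Matrix (Fin d) (Fin d) ℝ} {B : Matrix (Fin d) (Fin d) ℝ}
    (h : A * P = B) : im B ≤ im A := by
  intro v hv
  obtain ⟨x, rfl⟩ := mem_im.1 hv
  exact mem_im.2 ⟨P *ᵥ x, by rw [mulVec_mulVec, h]⟩

end Spectral

section Chart

variable {d : ℕ} {ι : Type*} [Fintype ι] [DecidableEq ι]

/-- Linear coordinates on a subspace of `ℝ^d`: `V` parametrizes the subspace, `W` is a left inverse
of `V`, and `V * W` is the orthogonal projection onto the subspace. -/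
structure IsChart (V : Matrix (Fin d) ι ℝ) (W : Matrix ι (Fin d) ℝ) : Prop where
  left_inv : W * V = 1
  symm : (V * W)ᵀ = V * W

namespace IsChart

variable {V : Matrix (Fin d) ι ℝ} {W : Matrix ι (Fin d) ℝ} (h : IsChart V W)
include h

theorem transpose_mul_transpose : Vᵀ * Wᵀ = 1 := by
  rw [← transpose_mul, h.left_inv, transpose_one]

theorem transpose_symm : Wᵀ * Vᵀ = V * W := by
  rw [← transpose_mul, h.symm]

theorem mulVec_mulVec_cancel (w : ι → ℝ) : W *ᵥ (V *ᵥ w) = w := by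
  rw [mulVec_mulVec, h.left_inv, one_mulVec]

theorem congr_cancel (K : Matrix ι ι ℝ) : W * (V * K * Vᵀ) * Wᵀ = K := by
  calc _ = (W * V) * K * (Vᵀ * Wᵀ) := by simp only [Matrix.mul_assoc]
    _ = K := by rw [h.left_inv, h.transpose_mul_transpose, Matrix.one_mul, Matrix.mul_one]

theorem posSemidef {K : Matrix ι ι ℝ} (hK : K.PosSemidef) : (V * K * Vᵀ).PosSemidef := by
  simpa using posSemidef_congr_mul hK Vᵀ

theorem congr_mul {K : Matrix ι ι ℝ} (hK : K.PosDef) : V * K * Vᵀ * (Wᵀ * K⁻¹) = V := by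
  have hdet : IsUnit K.det := (isUnit_iff_isUnit_det _).1 hK.isUnit
  calc _ = V * K * (Vᵀ * Wᵀ) * K⁻¹ := by simp only [Matrix.mul_assoc]
    _ = V := by
      rw [h.transpose_mul_transpose, Matrix.mul_one, Matrix.mul_assoc, mul_nonsing_inv _ hdet,
        Matrix.mul_one]

theorem mem_im_congr {K : Matrix ι ι ℝ} (hK : K.PosDef) (w : ι → ℝ) :
    V *ᵥ w ∈ im (V * K * Vᵀ) :=
  mem_im.2 ⟨(Wᵀ * K⁻¹) *ᵥ w, by rw [mulVec_mulVec, h.congr_mul hK]⟩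

theorem im_le_congr {K : Matrix ι ι ℝ} (hK : K.PosDef) (Y : Matrix ι ι ℝ) :
    im (V * Y * Vᵀ) ≤ im (V * K * Vᵀ) :=
  im_le_of_mul (P := Wᵀ * K⁻¹ * (Y * Vᵀ)) (by
    rw [← Matrix.mul_assoc, h.congr_mul hK, Matrix.mul_assoc])

theorem proj_of_mem_im {K : Matrix ι ι ℝ} {v : Fin d → ℝ} (hv : v ∈ im (V * K * Vᵀ)) :
    V *ᵥ (W *ᵥ v) = v := by
  obtain ⟨x, rfl⟩ := mem_im.1 hv
  rw [Matrix.mul_assoc, ← mulVec_mulVec, h.mulVec_mulVec_cancel]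

theorem pinv_quad {K : Matrix ι ι ℝ} (hK : K.PosDef) : Vᵀ * pinv (V * K * Vᵀ) * V = K⁻¹ := by
  have hdet : IsUnit K.det := (isUnit_iff_isUnit_det _).1 hK.isUnit
  obtain ⟨-, h1, -, -⟩ := pinv_spec (h.posSemidef hK.posSemidef)
  set P := pinv (V * K * Vᵀ)
  have h2 : K * (Vᵀ * P * V) * K = K := by
    calc _ = (W * V) * K * Vᵀ * P * V * K * (Vᵀ * Wᵀ) := by
          rw [h.left_inv, h.transpose_mul_transpose, Matrix.one_mul, Matrix.mul_one]
          simp only [Matrix.mul_assoc]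
      _ = W * (V * K * Vᵀ * P * (V * K * Vᵀ)) * Wᵀ := by simp only [Matrix.mul_assoc]
      _ = K := by rw [h1, h.congr_cancel]
  calc Vᵀ * P * V = (K⁻¹ * K) * (Vᵀ * P * V) * (K * K⁻¹) := by
        rw [nonsing_inv_mul _ hdet, mul_nonsing_inv _ hdet, Matrix.one_mul, Matrix.mul_one]
    _ = K⁻¹ * (K * (Vᵀ * P * V) * K) * K⁻¹ := by simp only [Matrix.mul_assoc]
    _ = K⁻¹ := by rw [h2, nonsing_inv_mul _ hdet, Matrix.one_mul]

/-- The pseudo-inverse in coordinates. -/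
theorem pinv_mul {K : Matrix ι ι ℝ} (hK : K.PosDef) : pinv (V * K * Vᵀ) * V = Wᵀ * K⁻¹ := by
  have hdet : IsUnit K.det := (isUnit_iff_isUnit_det _).1 hK.isUnit
  have hq := h.pinv_quad hK
  obtain ⟨-, -, -, h1⟩ := pinv_spec (h.posSemidef hK.posSemidef)
  set P := pinv (V * K * Vᵀ)
  -- the commutation of the pseudo-inverse with the matrix shows that `P * V` has its columns
  -- in the range of `V`
  obtain ⟨Z, h2⟩ : ∃ Z : Matrix ι ι ℝ, P * V = V * Z := by
    refine ⟨K * Vᵀ * P * Wᵀ * K⁻¹, ?_⟩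
    calc P * V = P * V * K * (Vᵀ * Wᵀ) * K⁻¹ := by
          rw [h.transpose_mul_transpose, Matrix.mul_one, Matrix.mul_assoc (P * V),
            mul_nonsing_inv _ hdet, Matrix.mul_one]
      _ = (P * (V * K * Vᵀ)) * Wᵀ * K⁻¹ := by simp only [Matrix.mul_assoc]
      _ = _ := by rw [← h1]; simp only [Matrix.mul_assoc]
  rw [← hq, Matrix.mul_assoc Vᵀ, h2, ← Matrix.mul_assoc Wᵀ, h.transpose_symm, Matrix.mul_assoc,
    ← Matrix.mul_assoc W, h.left_inv, Matrix.one_mul]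

/-- The action density in coordinates. -/
theorem actionDensity_congr {K : Matrix ι ι ℝ} (hK : K.PosDef) (w : ι → ℝ) (Y : Matrix ι ι ℝ) :
    actionDensity (V * K * Vᵀ) (V *ᵥ w) (V * Y * Vᵀ) = ENNReal.ofReal (dens K⁻¹ w Y) := by
  rw [actionDensity, if_pos ⟨h.mem_im_congr hK w, h.im_le_congr hK Y⟩, ← h.pinv_quad hK,
    ← dens_congr]
  rfl

end IsChart

end Chart

section Transfer

variable {d : ℕ} {ι : Type*} [Fintype ι] [DecidableEq ι]
variable {V : Matrix (Fin d) ι ℝ} {W : Matrix ι (Fin d) ℝ}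
variable {m₀ m₁ : Fin d → ℝ} {C₀ C₁ : Matrix (Fin d) (Fin d) ℝ}
variable {m : ℝ → Fin d → ℝ} {C : ℝ → Matrix (Fin d) (Fin d) ℝ}

/-- The action only depends on the curve on `[0,1]`. -/
theorem action_congr {m' : ℝ → Fin d → ℝ} {C' : ℝ → Matrix (Fin d) (Fin d) ℝ}
    (h : ∀ t ∈ Icc (0 : ℝ) 1, m t = m' t ∧ C t = C' t) : action m C = action m' C' := by
  refine setLIntegral_congr_fun measurableSet_Ioo fun t ht => ?_
  have hn : Icc (0 : ℝ) 1 ∈ 𝓝 t := Icc_mem_nhds ht.1 ht.2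
  have h1 : deriv m t = deriv m' t := EventuallyEq.deriv_eq (by
    filter_upwards [hn] with s hs
    exact (h s hs).1)
  have h2 : matDeriv C t = matDeriv C' t := by
    ext i j
    refine EventuallyEq.deriv_eq ?_
    filter_upwards [hn] with s hs
    rw [(h s hs).2]
  show actionDensity _ _ _ = actionDensity _ _ _
  rw [h1, h2, (h t (Ioo_subset_Icc_self ht)).2]

theorem IsMomentCurve.congr {m' : ℝ → Fin d → ℝ} {C' : ℝ → Matrix (Fin d) (Fin d) ℝ}
    (hc : IsMomentCurve m₀ C₀ m₁ C₁ m C) (h : ∀ t ∈ Icc (0 : ℝ) 1, m t = m' t ∧ C t = C' t) :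
    IsMomentCurve m₀ C₀ m₁ C₁ m' C' := by
  have h0 := h 0 ⟨le_rfl, zero_le_one⟩
  have h1 := h 1 ⟨zero_le_one, le_rfl⟩
  have hu : uIcc (0 : ℝ) 1 = Icc 0 1 := uIcc_of_le zero_le_one
  exact ⟨ac_congr hc.ac_mean fun t ht => (h t (hu ▸ ht)).1,
    fun i j => ac_congr (hc.ac_cov i j) fun t ht => by rw [(h t (hu ▸ ht)).2],
    fun t ht => (h t ht).2 ▸ hc.posSemidef t ht, h0.1 ▸ hc.mean_zero, h1.1 ▸ hc.mean_one,
    h0.2 ▸ hc.cov_zero, h1.2 ▸ hc.cov_one⟩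

/-- Curves in coordinates give admissible curves with the same action. -/
theorem IsChart.lift (h : IsChart V W) {n : ℝ → ι → ℝ} {K : ℝ → Matrix ι ι ℝ}
    (hc : PosCurve n K) (m₀ : Fin d → ℝ) :
    IsMomentCurve (m₀ + V *ᵥ n 0) (V * K 0 * Vᵀ) (m₀ + V *ᵥ n 1) (V * K 1 * Vᵀ)
      (fun t => m₀ + V *ᵥ n t) (fun t => V * K t * Vᵀ) ∧
      action (fun t => m₀ + V *ᵥ n t) (fun t => V * K t * Vᵀ) = energy n K := by
  refine ⟨⟨ac_pi.2 fun i => ?_, fun i j => ?_, fun t ht => h.posSemidef (hc.posDef t ht).posSemidef,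
    rfl, rfl, rfl, rfl⟩, ?_⟩
  · simp only [Pi.add_apply, Matrix.mulVec, dotProduct]
    exact (ac_const (m₀ i)).fun_add (ac_sum _ fun j _ => (hc.ac_mean j).const_mul _)
  · simp only [Matrix.mul_apply, Matrix.transpose_apply]
    refine ac_sum _ fun k _ => ?_
    have := (ac_sum Finset.univ fun l _ => (hc.ac_cov l k).const_mul (V i l)).const_mul (V j k)
    simpa [mul_comm] using this
  · refine lintegral_congr_ae ?_
    filter_upwards [ae_hasMatDeriv hc.ac_cov, ae_hasVecDeriv hc.ac_mean, ae_Ioo_mem] with t h1 h2 ht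
    have e1 : deriv (fun t => m₀ + V *ᵥ n t) t = V *ᵥ vel n t := by
      refine HasDerivAt.deriv (hasDerivAt_pi.2 fun i => ?_)
      have := ((hasMatDeriv_const V (s := univ) (t := t)).mulVec h2 i).const_add (m₀ i)
      simpa using this
    have e2 : matDeriv (fun t => V * K t * Vᵀ) t = V * velMat K t * Vᵀ := by
      have := ((hasMatDeriv_const V (s := univ) (t := t)).mul h1).mul (hasMatDeriv_const Vᵀ)
      simp only [Matrix.zero_mul, zero_add, Matrix.mul_zero, add_zero] at this
      ext i j
      exact (hasDerivWithinAt_univ.1 (this i j)).deriv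
    rw [e1, e2, h.actionDensity_congr (hc.posDef t (Ioo_subset_Icc_self ht))]
    rfl

theorem IsMomentCurve.symm (hc : IsMomentCurve m₀ C₀ m₁ C₁ m C) {t : ℝ}
    (ht : t ∈ Icc (0 : ℝ) 1) : (C t)ᵀ = C t :=
  posSemidef_transpose_eq (hc.posSemidef t ht)

/-- Along a curve of finite action, covariances at different times are comparable. In particular
the kernel of the covariance is constant. -/
theorem IsMomentCurve.quad_le (hc : IsMomentCurve m₀ C₀ m₁ C₁ m C) {R : ℝ} (hR0 : 0 ≤ R)
    (hR : action m C ≤ ENNReal.ofReal R) (u : Fin d → ℝ) {s t : ℝ} (hs : s ∈ Icc (0 : ℝ) 1)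
    (ht : t ∈ Icc (0 : ℝ) 1) :
    u ⬝ᵥ (C t *ᵥ u) ≤ Real.exp √(8 * R * |t - s|) * (u ⬝ᵥ (C s *ᵥ u)) := by
  have hac : AbsolutelyContinuousOnInterval (fun t => u ⬝ᵥ (C t *ᵥ u)) 0 1 := by
    simp only [dotProduct, Matrix.mulVec]
    exact ac_sum _ fun i _ => (ac_sum _ fun j _ => by
      simpa [mul_comm] using (hc.ac_cov i j).const_mul (u j)).const_mul (u i)
  refine le_exp_mul_of_logDeriv_sq_le (f := fun t => u ⬝ᵥ (C t *ᵥ u)) hac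
    (fun r hr => posSemidef_nonneg (hc.posSemidef r hr) u) ?_ hR0 hR hs ht
  filter_upwards [ae_hasMatDeriv hc.ac_cov, ae_Ioo_mem] with r hr hr1
  have hr2 := Ioo_subset_Icc_self hr1
  have hd := (hasDerivWithinAt_univ.1 (hasDerivWithinAt_quad hr u u)).deriv
  rw [hd]
  rw [actionDensity]
  split_ifs with hcond
  · rw [← ENNReal.ofReal_mul (by norm_num)]
    refine ENNReal.ofReal_le_ofReal ?_
    have hC := hc.posSemidef r hr2
    obtain ⟨hP, hCPC, -, -⟩ := pinv_spec hC
    have hX : (velMat C r)ᵀ = velMat C r := velMat_transpose (by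
      filter_upwards [Icc_mem_nhds hr1.1 hr1.2] with s hs
      exact hc.symm hs)
    have hCPX : C r * pinv (C r) * velMat C r = velMat C r := mul_eq_of_im_le hcond.2 hCPC
    have h1 := dotProduct_mulVec_sq_le hC hP hX hCPC hCPX u u
    have h2 := trace_le_dens hP (deriv m r) (velMat C r)
    have h3 := dens_nonneg hP (deriv m r) hX
    have h4 := posSemidef_nonneg hC u
    show _ ≤ 8 * dens (pinv (C r)) (deriv m r) (velMat C r)
    rcases h4.eq_or_lt with h4 | h4
    · rw [← h4]; simp; exact h3
    · rw [div_pow, div_le_iff₀ (by positivity)]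
      refine h1.trans ?_
      rw [← pow_two]
      exact mul_le_mul_of_nonneg_right h2 (by positivity)
  · rw [ENNReal.mul_top (by simp)]
    exact le_top

theorem ae_eq_zero_of_lintegral_ne_top {g : ℝ → ℝ} {F : ℝ → ℝ≥0∞} (hg : Measurable g)
    (hF : ∀ᵐ t ∂volume.restrict (Ioo (0 : ℝ) 1), g t ≠ 0 → F t = ⊤)
    (h : ∫⁻ t in Ioo (0 : ℝ) 1, F t ≠ ⊤) :
    ∀ᵐ t ∂volume.restrict (Ioo (0 : ℝ) 1), g t = 0 := by
  have hm : MeasurableSet {t | g t ≠ 0} := hg (measurableSet_singleton 0).compl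
  have h1 : ∫⁻ t in Ioo (0 : ℝ) 1, ({t | g t ≠ 0} : Set ℝ).indicator (fun _ => ⊤) t ≤
      ∫⁻ t in Ioo (0 : ℝ) 1, F t := by
    refine lintegral_mono_ae ?_
    filter_upwards [hF] with t ht
    by_cases hgt : g t ≠ 0
    · rw [ht hgt]; exact le_top
    · rw [indicator_of_notMem (by simpa using hgt)]; exact zero_le
  have h2 := (h1.trans_lt h.lt_top).ne
  rw [lintegral_indicator hm, lintegral_const] at h2
  have h3 : (volume.restrict (Ioo (0 : ℝ) 1)) {t | g t ≠ 0} = 0 := by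
    by_contra h0
    refine h2 (ENNReal.top_mul ?_)
    rwa [Measure.restrict_apply_univ]
  exact h3

/-- An admissible curve of finite action is a curve of positive definite matrices in suitable
coordinates. -/
theorem IsChart.descend (h : IsChart V W) {K₀ : Matrix ι ι ℝ} (hK₀ : K₀.PosDef)
    (hC₀ : C₀ = V * K₀ * Vᵀ) (hc : IsMomentCurve m₀ C₀ m₁ C₁ m C) (hfin : action m C ≠ ⊤) :
    ∃ (n : ℝ → ι → ℝ) (K : ℝ → Matrix ι ι ℝ), PosCurve n K ∧
      (∀ t ∈ Icc (0 : ℝ) 1, m t = m₀ + V *ᵥ n t ∧ C t = V * K t * Vᵀ) ∧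
      n 0 = 0 ∧ n 1 = W *ᵥ (m₁ - m₀) ∧ K 0 = K₀ ∧ K 1 = W * C₁ * Wᵀ := by
  have h00 : (0 : ℝ) ∈ Icc (0 : ℝ) 1 := ⟨le_rfl, zero_le_one⟩
  have hR : action m C ≤ ENNReal.ofReal (action m C).toReal := by rw [ENNReal.ofReal_toReal hfin]
  have hquad := fun u {s t : ℝ} => hc.quad_le ENNReal.toReal_nonneg hR u (s := s) (t := t)
  -- the kernel of the covariance does not change
  have hker : ∀ u, C₀ *ᵥ u = 0 → ∀ t ∈ Icc (0 : ℝ) 1, C t *ᵥ u = 0 := by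
    intro u hu t ht
    have h1 := hquad u h00 ht
    rw [hc.cov_zero, hu, dotProduct_zero, mul_zero] at h1
    have h2 := posSemidef_nonneg (hc.posSemidef t ht) u
    have h3 : star u ⬝ᵥ (C t *ᵥ u) = 0 := by simpa using le_antisymm h1 h2
    exact ((hc.posSemidef t ht).dotProduct_mulVec_zero_iff u).1 h3
  have hVt : Vᵀ * (V * W) = Vᵀ := by
    rw [← h.symm, ← transpose_mul, Matrix.mul_assoc, h.left_inv, Matrix.mul_one]
  have hproj : ∀ t ∈ Icc (0 : ℝ) 1, C t * (V * W) = C t := by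
    intro t ht
    refine Matrix.ext_of_mulVec_single fun i => ?_
    have h1 := hker ((V * W) *ᵥ Pi.single i 1 - Pi.single i 1) (by
      rw [mulVec_sub, mulVec_mulVec, hC₀, Matrix.mul_assoc (V * K₀), hVt, sub_self]) t ht
    rw [mulVec_sub, sub_eq_zero, mulVec_mulVec] at h1
    exact h1
  have hproj' : ∀ t ∈ Icc (0 : ℝ) 1, V * W * C t = C t := by
    intro t ht
    have := congrArg transpose (hproj t ht)
    rwa [transpose_mul, h.symm, hc.symm ht] at this
  have hCov : ∀ t ∈ Icc (0 : ℝ) 1, C t = V * (W * C t * Wᵀ) * Vᵀ := by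
    intro t ht
    calc C t = (V * W) * C t * (V * W) := by rw [hproj' t ht, hproj t ht]
      _ = (V * W) * C t * (Wᵀ * Vᵀ) := by rw [h.transpose_symm]
      _ = _ := by simp only [Matrix.mul_assoc]
  have hacm := ac_pi.1 hc.ac_mean
  have hmean : ∀ t ∈ Icc (0 : ℝ) 1, m t = m₀ + V *ᵥ (W *ᵥ (m t - m₀)) := by
    -- the component of the mean orthogonal to the subspace has derivative zero
    set Q : Matrix (Fin d) (Fin d) ℝ := 1 - V * W with hQ
    have hz : ∀ i, ∀ t ∈ Icc (0 : ℝ) 1, (Q *ᵥ m t) i = (Q *ᵥ m 0) i := by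
      intro i t ht
      have hacQ : AbsolutelyContinuousOnInterval (fun t => (Q *ᵥ m t) i) 0 1 := by
        simp only [Matrix.mulVec, dotProduct]
        exact ac_sum _ fun j _ => (hacm j).const_mul _
      have hQv : ∀ᵐ t ∂volume.restrict (Ioo (0 : ℝ) 1), (Q *ᵥ vel m t) i = 0 := by
        refine ae_eq_zero_of_lintegral_ne_top
          (F := fun t => actionDensity (C t) (deriv m t) (matDeriv C t)) ?_ ?_ hfin
        · simp only [Matrix.mulVec, dotProduct]
          exact Finset.measurable_fun_sum _ fun j _ => (measurable_deriv _).const_mul _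
        · filter_upwards [ae_Ioo_mem, ae_hasVecDeriv hacm] with s hs hs1 hs2
          have e : deriv m s = vel m s :=
            (hasDerivAt_pi.2 fun j => hasDerivWithinAt_univ.1 (hs1 j)).deriv
          refine if_neg fun hcond => hs2 ?_
          rw [e] at hcond
          obtain ⟨x, hx⟩ := mem_im.1 hcond.1
          rw [← hx, mulVec_mulVec, hQ, Matrix.sub_mul, hproj' s (Ioo_subset_Icc_self hs),
            Matrix.one_mul, sub_self, zero_mulVec]
          rfl
      refine ac_eq_of_deriv_eq_zero hacQ ?_ ht
      filter_upwards [hQv, ae_hasVecDeriv hacm] with s hs hs1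
      have := (hasMatDeriv_const Q (s := univ) (t := s)).mulVec hs1 i
      rw [zero_mulVec, zero_add, hs] at this
      exact (hasDerivWithinAt_univ.1 this).deriv
    intro t ht
    have h1 : Q *ᵥ m t = Q *ᵥ m 0 := funext fun i => hz i t ht
    rw [hc.mean_zero, hQ, sub_mulVec, sub_mulVec, one_mulVec, one_mulVec] at h1
    rw [mulVec_mulVec, mulVec_sub]
    have h2 : m t = m₀ - (V * W) *ᵥ m₀ + (V * W) *ᵥ m t := by rw [← h1]; abel
    rw [add_sub, add_sub_right_comm]
    exact h2
  refine ⟨fun t => W *ᵥ (m t - m₀), fun t => W * C t * Wᵀ, ⟨fun i => ?_, fun i j => ?_,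
    fun t ht => ?_⟩, fun t ht => ⟨hmean t ht, hCov t ht⟩, ?_, ?_, ?_, ?_⟩
  · simp only [Matrix.mulVec, dotProduct, Pi.sub_apply, mul_sub]
    refine ac_sum _ fun j _ => ?_
    simpa [sub_eq_add_neg] using ((hacm j).const_mul (W i j)).fun_add (ac_const (-(W i j * m₀ j)))
  · simp only [Matrix.mul_apply, Matrix.transpose_apply]
    refine ac_sum _ fun k _ => ?_
    have := (ac_sum Finset.univ fun l _ => (hc.ac_cov l k).const_mul (W i l)).const_mul (W j k)
    simpa [mul_comm] using this
  · refine posDef_of_pos (by simp [transpose_mul, hc.symm ht, Matrix.mul_assoc]) fun w hw => ?_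
    have e : ∀ s, w ⬝ᵥ ((W * C s * Wᵀ) *ᵥ w) = (Wᵀ *ᵥ w) ⬝ᵥ (C s *ᵥ (Wᵀ *ᵥ w)) := fun s => by
      rw [dotProduct_congr, transpose_transpose]
    have h1 := hquad (Wᵀ *ᵥ w) ht h00
    have h2 : 0 < w ⬝ᵥ ((W * C 0 * Wᵀ) *ᵥ w) := by
      rw [hc.cov_zero, hC₀, h.congr_cancel]
      exact posDef_pos hK₀ hw
    rw [← e, ← e] at h1
    exact pos_of_mul_pos_right (h2.trans_le h1) (Real.exp_pos _).le
  · simp [hc.mean_zero]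
  · simp [hc.mean_one]
  · simp [hc.cov_zero, hC₀, h.congr_cancel]
  · simp [hc.cov_one]

end Transfer

section Optimality

variable {d : ℕ} {ι : Type*} [Fintype ι] [DecidableEq ι]
variable {V : Matrix (Fin d) ι ℝ} {W : Matrix ι (Fin d) ℝ}
variable {m₀ m₁ : Fin d → ℝ} {C₀ C₁ : Matrix (Fin d) (Fin d) ℝ}
variable {m : ℝ → Fin d → ℝ} {C : ℝ → Matrix (Fin d) (Fin d) ℝ}
variable {n : ℝ → ι → ℝ} {K : ℝ → Matrix ι ι ℝ} {η : ι → ℝ} {K₀ K₁ : Matrix ι ι ℝ}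

theorem distSq_le (hc : IsMomentCurve m₀ C₀ m₁ C₁ m C) : distSq m₀ C₀ m₁ C₁ ≤ action m C :=
  iInf_le_of_le m (iInf_le_of_le C (iInf_le _ hc))

/-- Curves of least action in coordinates are optimizers. -/
theorem IsChart.isOptimal (h : IsChart V W) (hC₀ : C₀ = V * K₀ * Vᵀ) (hC₁ : C₁ = V * K₁ * Vᵀ)
    (hm : m₁ = m₀ + V *ᵥ η) (hmin : IsMinimal n K) (hn0 : n 0 = 0) (hn1 : n 1 = η)
    (hK0 : K 0 = K₀) (hK1 : K 1 = K₁) :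
    IsOptimal m₀ C₀ m₁ C₁ (fun t => m₀ + V *ᵥ n t) (fun t => V * K t * Vᵀ) ∧
      distSq m₀ C₀ m₁ C₁ = energy n K := by
  obtain ⟨hc, hact⟩ := h.lift hmin.curve m₀
  rw [hn0, hn1, hK0, hK1, ← hC₀, ← hC₁, ← hm, mulVec_zero, add_zero] at hc
  have hd : distSq m₀ C₀ m₁ C₁ = energy n K := by
    refine le_antisymm ((distSq_le hc).trans hact.le) ?_
    refine le_iInf fun m' => le_iInf fun C' => le_iInf fun hc' => ?_
    by_cases hfin : action m' C' = ⊤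
    · rw [hfin]; exact le_top
    obtain ⟨n', K', hp, heq, h0, h1, h2, h3⟩ := h.descend
      (hK0 ▸ hmin.curve.posDef 0 ⟨le_rfl, zero_le_one⟩) hC₀ hc' hfin
    rw [action_congr heq, (h.lift hp m₀).2]
    refine hmin.le n' K' hp (h0.trans hn0.symm) ?_ (h2.trans hK0.symm) ?_
    · rw [h1, hn1, hm, add_sub_cancel_left, h.mulVec_mulVec_cancel]
    · rw [h3, hK1, hC₁, h.congr_cancel]
  exact ⟨⟨hc, hact.trans hd.symm⟩, hd⟩

/-- Optimizers are curves of least action in coordinates. -/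
theorem IsChart.isMinimal (h : IsChart V W) (hC₀ : C₀ = V * K₀ * Vᵀ) (hC₁ : C₁ = V * K₁ * Vᵀ)
    (hm : m₁ = m₀ + V *ᵥ η) (hK₀ : K₀.PosDef) (hopt : IsOptimal m₀ C₀ m₁ C₁ m C)
    (hfin : distSq m₀ C₀ m₁ C₁ ≠ ⊤) :
    ∃ n K, IsMinimal n K ∧ n 0 = 0 ∧ n 1 = η ∧ K 0 = K₀ ∧ K 1 = K₁ ∧
      ∀ t ∈ Icc (0 : ℝ) 1, m t = m₀ + V *ᵥ n t ∧ C t = V * K t * Vᵀ := by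
  have hfin' : action m C ≠ ⊤ := by rw [hopt.2]; exact hfin
  obtain ⟨n, K, hp, heq, h0, h1, h2, h3⟩ := h.descend hK₀ hC₀ hopt.1 hfin'
  have h1' : n 1 = η := by rw [h1, hm, add_sub_cancel_left, h.mulVec_mulVec_cancel]
  have h3' : K 1 = K₁ := by rw [h3, hC₁, h.congr_cancel]
  have hact : action m C = energy n K := (action_congr heq).trans (h.lift hp m₀).2
  refine ⟨n, K, ⟨hp, hact ▸ hfin', fun n' K' hp' e0 e1 e2 e3 => ?_⟩, h0, h1', h2, h3', heq⟩
  obtain ⟨hc, hact'⟩ := h.lift hp' m₀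
  rw [e0, e1, e2, e3, h0, h1', h2, h3', ← hC₀, ← hC₁, ← hm, mulVec_zero, add_zero] at hc
  rw [← hact, hopt.2, ← hact']
  exact distSq_le hc

/-- Curves of least action in coordinates solve the optimality conditions. -/
theorem IsChart.solvesOptimality (h : IsChart V W) (m₀ : Fin d → ℝ) (hmin : IsMinimal n K) :
    ∃ α, SolvesOptimality α (fun t => m₀ + V *ᵥ n t) (fun t => V * K t * Vᵀ) := by
  obtain ⟨α, n', K', hEL⟩ := hmin.eulerLagrange
  refine ⟨Wᵀ *ᵥ α, fun t => V *ᵥ n' t, fun t => V * K' t * Vᵀ, fun t ht => ?_⟩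
  obtain ⟨h1, h2, h3, h4⟩ := hEL t ht
  have hK := hmin.curve.posDef t ht
  have hlift : ∀ {L : ℝ → Matrix ι ι ℝ} {Y : Matrix ι ι ℝ}, HasMatDeriv L Y (Icc 0 1) t →
      HasMatDeriv (fun s => V * L s * Vᵀ) (V * Y * Vᵀ) (Icc 0 1) t := by
    intro L Y hL
    have := ((hasMatDeriv_const V (s := Icc (0 : ℝ) 1) (t := t)).mul hL).mul (hasMatDeriv_const Vᵀ)
    simpa only [Matrix.zero_mul, zero_add, Matrix.mul_zero, add_zero] using this
  refine ⟨hasDerivWithinAt_pi.2 fun i => ?_, hlift h2, h.mem_im_congr hK _, h.im_le_congr hK _,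
    ?_, ?_⟩
  · have := ((hasMatDeriv_const V (s := Icc (0 : ℝ) 1) (t := t)).mulVec h1 i).const_add (m₀ i)
    rw [zero_mulVec, zero_add] at this
    exact this
  · rw [mulVec_mulVec, h.pinv_mul hK, ← mulVec_mulVec, h3]
  · have e1 : V * K' t * Vᵀ * pinv (V * K t * Vᵀ) * (V * K' t * Vᵀ) =
        V * (K' t * (K t)⁻¹ * K' t) * Vᵀ := by
      rw [← h.pinv_quad hK]; simp only [Matrix.mul_assoc]
    have e2 : V * K t * Vᵀ * vecMulVec (Wᵀ *ᵥ α) (Wᵀ *ᵥ α) * (V * K t * Vᵀ) =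
        V * (K t * vecMulVec α α * K t) * Vᵀ := by
      have e3 : vecMulVec (Wᵀ *ᵥ α) (Wᵀ *ᵥ α) = Wᵀ * vecMulVec α α * W := by
        rw [mul_vecMulVec, vecMulVec_mul, ← mulVec_transpose]
      rw [e3]
      calc _ = V * K t * (Vᵀ * Wᵀ) * vecMulVec α α * (W * V) * K t * Vᵀ := by
            simp only [Matrix.mul_assoc]
        _ = _ := by
          rw [h.left_inv, h.transpose_mul_transpose, Matrix.mul_one, Matrix.mul_one]
          simp only [Matrix.mul_assoc]
    have h5 := hlift h4
    rw [Matrix.mul_sub, Matrix.sub_mul, Matrix.mul_smul, Matrix.smul_mul, ← e1, ← e2] at h5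
    exact h5

end Optimality

/-! ### The two choices of coordinates -/

section Coordinates

variable {d : ℕ} {C₀ C₁ : Matrix (Fin d) (Fin d) ℝ}

/-- Positive semidefinite matrices with the same image have the same kernel. -/
theorem mulVec_eq_zero_of_im_eq (hC₀ : C₀.PosSemidef) (hC₁ : C₁.PosSemidef) (him : im C₀ = im C₁)
    {u : Fin d → ℝ} (hu : C₁ *ᵥ u = 0) : C₀ *ᵥ u = 0 := by
  have h0 := posSemidef_transpose_eq hC₀
  have h1 := posSemidef_transpose_eq hC₁
  have hmem : C₀ *ᵥ u ∈ im C₁ := him ▸ mem_im.2 ⟨u, rfl⟩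
  obtain ⟨x, hx⟩ := mem_im.1 hmem
  have h2 : u ⬝ᵥ (C₀ *ᵥ u) = 0 := by
    rw [← hx, dotProduct_mulVec_comm h1, hu, dotProduct_zero]
  exact (hC₀.dotProduct_mulVec_zero_iff u).1 (by simpa using h2)

theorem sum_subtype_of_eq_zero {p : Fin d → Prop} [DecidablePred p] {F : Fin d → ℝ}
    (hF : ∀ i, ¬ p i → F i = 0) : ∑ i : {i // p i}, F i = ∑ i, F i := by
  rw [← Finset.sum_filter_of_ne (p := p) (fun i _ hi => by_contra fun h => hi (hF i h))]
  exact (Finset.sum_subtype _ (by simp) F).symm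

/-- The columns of a square matrix with an index that satisfies `p`. -/
def restrictCols (p : Fin d → Prop) (T : Matrix (Fin d) (Fin d) ℝ) : Matrix (Fin d) {i // p i} ℝ :=
  Matrix.of fun x i => T x i

theorem restrictCols_mul {p : Fin d → Prop} [DecidablePred p] {T : Matrix (Fin d) (Fin d) ℝ}
    (hT : ∀ i, ¬ p i → ∀ x, T x i = 0) (R : Matrix (Fin d) (Fin d) ℝ) :
    restrictCols p T * (restrictCols p R)ᵀ = T * Rᵀ := by
  ext x y
  exact sum_subtype_of_eq_zero (F := fun i => T x i * R y i) fun i hi => by rw [hT i hi, zero_mul]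

theorem restrictCols_congr {p : Fin d → Prop} [DecidablePred p] {T : Matrix (Fin d) (Fin d) ℝ}
    (hT : ∀ i, ¬ p i → ∀ x, T x i = 0) (g : Fin d → ℝ) :
    restrictCols p T * Matrix.diagonal (fun i : {i // p i} => g i) * (restrictCols p T)ᵀ =
      T * Matrix.diagonal g * Tᵀ := by
  ext x y
  rw [Matrix.mul_apply, Matrix.mul_apply]
  simp only [Matrix.mul_diagonal]
  exact sum_subtype_of_eq_zero (F := fun i => T x i * g i * T y i) fun i hi => by
    rw [hT i hi, zero_mul, zero_mul]

theorem hsNormSq_spectral {U : Matrix (Fin d) (Fin d) ℝ} (hU : Uᵀ * U = 1) (g : Fin d → ℝ) :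
    hsNormSq (U * Matrix.diagonal g * Uᵀ) = ∑ i, g i ^ 2 := by
  have h : hsNormSq (U * Matrix.diagonal g * Uᵀ) =
      ((U * Matrix.diagonal g * Uᵀ) * (U * Matrix.diagonal g * Uᵀ)ᵀ).trace := by
    simp only [hsNormSq, Matrix.trace, Matrix.diag, Matrix.mul_apply (M := _ * _ * _),
      Matrix.transpose_apply, pow_two]
  rw [h, spectral_transpose, spectral_mul hU, trace_mul_comm, ← Matrix.mul_assoc, hU,
    Matrix.one_mul, trace_diagonal]
  simp only [pow_two]

/-- Coordinates in which the initial covariance is the identity and the final one is diagonal. -/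
theorem exists_chart (hC₀ : C₀.PosSemidef) (hC₁ : C₁.PosSemidef) (him : im C₀ = im C₁) :
    ∃ (p : Fin d → Prop) (_ : DecidablePred p) (V : Matrix (Fin d) {i // p i} ℝ)
      (W : Matrix {i // p i} (Fin d) ℝ) (μ : {i // p i} → ℝ), IsChart V W ∧ (∀ i, 0 < μ i) ∧
      C₀ = V * Vᵀ ∧ C₁ = V * Matrix.diagonal μ * Vᵀ ∧
      (∀ t, affineGeodesic C₀ C₁ t = V * (Matrix.diagonal fun i => μ i ^ t) * Vᵀ) ∧
      hsNormSq (slog (spow C₀ (-1 / 2) * C₁ * spow C₀ (-1 / 2))) = ∑ i, Real.log (μ i) ^ 2 := by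
  obtain ⟨U₀, l, hU₀, -, hl, hf⟩ := exists_spectral (posSemidef_transpose_eq hC₀)
  have hl0 := spectral_nonneg hC₀ hU₀ hl
  have hC₁t := posSemidef_transpose_eq hC₁
  obtain ⟨B, hB⟩ : ∃ B, B = spow C₀ (1 / 2) := ⟨_, rfl⟩
  obtain ⟨N, hN⟩ : ∃ N, N = spow C₀ (-1 / 2) := ⟨_, rfl⟩
  have hBU : B = U₀ * Matrix.diagonal (fun i => l i ^ (1 / 2 : ℝ)) * U₀ᵀ := hB.trans (hf _)
  have hNU : N = U₀ * Matrix.diagonal (fun i => l i ^ (-1 / 2 : ℝ)) * U₀ᵀ := hN.trans (hf _)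
  have hBt : Bᵀ = B := by rw [hBU, spectral_transpose]
  have hNt : Nᵀ = N := by rw [hNU, spectral_transpose]
  have hBB : B * B = C₀ := by
    rw [hBU, spectral_mul hU₀, hl]
    congr 3; ext i
    rw [← Real.sqrt_eq_rpow, Real.mul_self_sqrt (hl0 i)]
  have hcancel : ∀ x : ℝ, 0 ≤ x → x ^ (1 / 2 : ℝ) * x ^ (-1 / 2 : ℝ) * x ^ (1 / 2 : ℝ)
      = x ^ (1 / 2 : ℝ) ∧ x ^ (-1 / 2 : ℝ) * x ^ (1 / 2 : ℝ) * x ^ (-1 / 2 : ℝ)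
      = x ^ (-1 / 2 : ℝ) := by
    intro x hx
    rcases hx.eq_or_lt with rfl | hx
    · norm_num
    · simp only [← Real.rpow_add hx]
      norm_num
  have hBNB : B * N * B = B := by
    rw [hBU, hNU, spectral_mul hU₀, spectral_mul hU₀]
    congr 3; ext i; exact (hcancel _ (hl0 i)).1
  have hNBN : N * B * N = N := by
    rw [hBU, hNU, spectral_mul hU₀, spectral_mul hU₀]
    congr 3; ext i; exact (hcancel _ (hl0 i)).2
  have hcomm : N * B = B * N := by
    rw [hBU, hNU, spectral_mul hU₀, spectral_mul hU₀]
    congr 3; ext i; exact mul_comm _ _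
  have hPC₁ : B * N * C₁ = C₁ := mul_eq_of_im_le him.ge (by
    rw [← hBB, ← Matrix.mul_assoc, hBNB])
  have hC₁P : C₁ * (B * N) = C₁ := by
    have := congrArg transpose hPC₁
    rwa [transpose_mul, transpose_mul, hBt, hNt, hC₁t, hcomm] at this
  set M := N * C₁ * N with hM
  have hMpos : M.PosSemidef := by
    have := posSemidef_congr_mul hC₁ N
    rwa [hNt] at this
  have hBMB : B * M * B = C₁ := by
    calc B * M * B = (B * N * C₁) * (N * B) := by rw [hM]; simp only [Matrix.mul_assoc]
      _ = C₁ := by rw [hPC₁, hcomm, hC₁P]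
  have hPM : B * N * M = M := by
    calc B * N * M = (B * N * N) * C₁ * N := by rw [hM]; simp only [Matrix.mul_assoc]
      _ = M := by rw [← hcomm, hNBN]
  obtain ⟨U, μ, hU, hU', hMU, hMf⟩ := exists_spectral (posSemidef_transpose_eq hMpos)
  have hμ0 := spectral_nonneg hMpos hU hMU
  have hcol : ∀ i, M *ᵥ (U *ᵥ Pi.single i 1) = μ i • (U *ᵥ Pi.single i 1) := by
    intro i
    have e : M * U = U * Matrix.diagonal μ := by
      rw [hMU, Matrix.mul_assoc, hU, Matrix.mul_one]
    rw [mulVec_mulVec, e, ← mulVec_mulVec, ← mulVec_smul]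
    congr 1
    ext j
    rw [mulVec_diagonal]
    by_cases hj : j = i
    · subst hj; simp
    · simp [hj]
  set T := B * U with hT
  have hTz : ∀ i, ¬ 0 < μ i → ∀ x, T x i = 0 := by
    intro i hi x
    have hμi : μ i = 0 := le_antisymm (not_lt.1 hi) (hμ0 i)
    set u := U *ᵥ Pi.single i 1 with hu
    have h1 : C₁ *ᵥ (N *ᵥ u) = 0 := by
      have h2 : (N *ᵥ u) ⬝ᵥ (C₁ *ᵥ (N *ᵥ u)) = 0 := by
        rw [dotProduct_congr, hNt, hcol i, hμi, zero_smul, dotProduct_zero]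
      exact (hC₁.dotProduct_mulVec_zero_iff _).1 (by simpa using h2)
    have h3 := mulVec_eq_zero_of_im_eq hC₀ hC₁ him h1
    have h4 : B *ᵥ u = 0 := by
      rw [← hBNB, Matrix.mul_assoc, hcomm, ← Matrix.mul_assoc, hBB, ← mulVec_mulVec, h3]
    have h5 : (T *ᵥ Pi.single i 1) x = 0 := by
      rw [hT, ← mulVec_mulVec, h4]; rfl
    simpa using h5
  have hPU : ∀ i, 0 < μ i → (B * N) *ᵥ (U *ᵥ Pi.single i 1) = U *ᵥ Pi.single i 1 := by
    intro i hi
    have h1 : U *ᵥ Pi.single i 1 = M *ᵥ ((μ i)⁻¹ • (U *ᵥ Pi.single i 1)) := by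
      rw [mulVec_smul, hcol, smul_smul, inv_mul_cancel₀ hi.ne', one_smul]
    rw [h1, mulVec_mulVec, hPM]
  refine ⟨fun i => 0 < μ i, inferInstance, restrictCols _ T,
    (restrictCols _ (N * U))ᵀ, fun i => μ i, ⟨?_, ?_⟩, fun i => i.2, ?_, ?_, ?_, ?_⟩
  · ext i j
    have h1 : ((restrictCols (fun i => 0 < μ i) (N * U))ᵀ *
        restrictCols (fun i => 0 < μ i) T) i j = ((N * U)ᵀ * T) i j := rfl
    have h2 : ((N * U)ᵀ * T) *ᵥ Pi.single (j : Fin d) 1 = Pi.single (j : Fin d) 1 := by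
      rw [transpose_mul, hNt]
      calc _ = Uᵀ *ᵥ ((N * B) *ᵥ (U *ᵥ Pi.single (j : Fin d) 1)) := by
            rw [hT]; simp only [mulVec_mulVec, Matrix.mul_assoc]
        _ = _ := by rw [hcomm, hPU j j.2, mulVec_mulVec, hU, one_mulVec]
    have h3 := congrFun h2 i
    rw [h1, Matrix.one_apply]
    simp only [mulVec_single, MulOpposite.op_one, one_smul] at h3
    refine h3.trans ?_
    rw [Pi.single_apply]
    simp [Subtype.ext_iff]
  · rw [restrictCols_mul hTz]
    have : T * (N * U)ᵀ = B * N := by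
      rw [transpose_mul, hNt]
      calc _ = B * (U * Uᵀ) * N := by rw [hT]; simp only [Matrix.mul_assoc]
        _ = _ := by rw [hU', Matrix.mul_one]
    rw [this, transpose_mul, hBt, hNt, hcomm]
  · rw [restrictCols_mul hTz, hT, transpose_mul, hBt, Matrix.mul_assoc, ← Matrix.mul_assoc U,
      hU', Matrix.one_mul, hBB]
  · rw [restrictCols_congr hTz μ, ← hBMB, hMU, hT, transpose_mul, hBt]
    simp only [Matrix.mul_assoc]
  · intro t
    rw [restrictCols_congr hTz fun i => μ i ^ t, affineGeodesic, ← hB, ← hN, ← hM,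
      spow, hMf, hT, transpose_mul, hBt]
    simp only [Matrix.mul_assoc]
  · rw [← hN, ← hM, slog, hMf, hsNormSq_spectral hU]
    refine (sum_subtype_of_eq_zero (p := fun i => 0 < μ i)
      (F := fun i => Real.log (μ i) ^ 2) fun i hi => ?_).symm
    rw [le_antisymm (not_lt.1 hi) (hμ0 i)]
    simp

end Coordinates

section Orthonormal

variable {d : ℕ} {e : Fin d → Fin d → ℝ} {a b : Fin d → ℝ}

/-- The vectors `eⁱ` with `0 < a i` as the columns of a matrix. -/
def basisCols (e : Fin d → Fin d → ℝ) (a : Fin d → ℝ) : Matrix (Fin d) {i // 0 < a i} ℝ :=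
  Matrix.of fun x i => e i x

theorem diagIn_apply (e : Fin d → Fin d → ℝ) (g : Fin d → ℝ) (x y : Fin d) :
    diagIn e g x y = ∑ i, g i * (e i x * e i y) := by
  simp [diagIn, Matrix.sum_apply, vecMulVec_apply]

theorem diagIn_eq (e : Fin d → Fin d → ℝ) {a g : Fin d → ℝ} (hg : ∀ i, ¬ 0 < a i → g i = 0) :
    diagIn e g = basisCols e a * (Matrix.diagonal fun i : {i // 0 < a i} => g i) *
      (basisCols e a)ᵀ := by
  ext x y
  rw [diagIn_apply, Matrix.mul_apply]
  simp only [Matrix.mul_diagonal]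
  refine (sum_subtype_of_eq_zero (p := fun i => 0 < a i)
    (F := fun i => g i * (e i x * e i y)) fun i hi => by rw [hg i hi, zero_mul]).symm.trans ?_
  refine Finset.sum_congr rfl fun i _ => ?_
  show g i * (e i x * e i y) = e i x * g i * e i y
  ring

theorem isChart_basisCols (he : ∀ i j, e i ⬝ᵥ e j = if i = j then 1 else 0) (a : Fin d → ℝ) :
    IsChart (basisCols e a) (basisCols e a)ᵀ := by
  refine ⟨?_, by rw [transpose_mul, transpose_transpose]⟩
  ext i j
  rw [Matrix.one_apply]
  refine (he i j).trans ?_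
  simp [Subtype.ext_iff]

theorem diagIn_mulVec (he : ∀ i j, e i ⬝ᵥ e j = if i = j then 1 else 0) (g : Fin d → ℝ)
    (j : Fin d) : diagIn e g *ᵥ e j = g j • e j := by
  rw [diagIn, Matrix.sum_mulVec, Finset.sum_eq_single j]
  · rw [smul_mulVec, vecMulVec_mulVec, he, if_pos rfl]; simp
  · intro i _ hi
    rw [smul_mulVec, vecMulVec_mulVec, he, if_neg hi]; simp
  · simp

theorem diagIn_quad (he : ∀ i j, e i ⬝ᵥ e j = if i = j then 1 else 0) (g : Fin d → ℝ)
    (j : Fin d) : e j ⬝ᵥ (diagIn e g *ᵥ e j) = g j := by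
  rw [diagIn_mulVec he, dotProduct_smul, he, if_pos rfl, smul_eq_mul, mul_one]

theorem diagIn_nonneg (he : ∀ i j, e i ⬝ᵥ e j = if i = j then 1 else 0)
    (h : (diagIn e a).PosSemidef) (j : Fin d) : 0 ≤ a j := by
  rw [← diagIn_quad he a j]
  exact posSemidef_nonneg h _

theorem diagIn_eq_zero (he : ∀ i j, e i ⬝ᵥ e j = if i = j then 1 else 0)
    (ha : (diagIn e a).PosSemidef) (hb : (diagIn e b).PosSemidef)
    (him : im (diagIn e a) = im (diagIn e b)) {j : Fin d} (hj : b j = 0) : a j = 0 := by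
  have h1 : diagIn e b *ᵥ e j = 0 := by rw [diagIn_mulVec he, hj, zero_smul]
  have h2 := mulVec_eq_zero_of_im_eq ha hb him h1
  rw [← diagIn_quad he a j, h2, dotProduct_zero]

end Orthonormal

section Explicit

variable {d : ℕ} {e : Fin d → Fin d → ℝ} {a b m₀ m₁ : Fin d → ℝ}

/-- The explicit curve in coordinates. -/
theorem explicit_eq_lift (hδ : ∀ i, ¬ 0 < a i → (m₁ - m₀) ⬝ᵥ e i = 0)
    (ha : ∀ i, ¬ 0 < a i → a i = 0) (hb : ∀ i, ¬ 0 < a i → b i = 0) :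
    explicitMean e m₀ m₁ a b = (fun t => m₀ + basisCols e a *ᵥ
      diagMean (fun i : {i // 0 < a i} => (m₁ - m₀) ⬝ᵥ e i) (fun i => a i) (fun i => b i) t) ∧
    explicitCov e m₀ m₁ a b = (fun t => basisCols e a *
      diagCov (fun i : {i // 0 < a i} => (m₁ - m₀) ⬝ᵥ e i) (fun i => a i) (fun i => b i) t *
      (basisCols e a)ᵀ) := by
  constructor
  · funext t
    rw [explicitMean]
    congr 1
    ext x
    rw [Finset.sum_apply]
    refine (sum_subtype_of_eq_zero (p := fun i => 0 < a i)
      (F := fun i => (shift ((m₁ - m₀) ⬝ᵥ e i) (a i) (b i) t • e i) x)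
      fun i hi => by rw [hδ i hi, shift_of_eq_zero, zero_smul]; rfl).symm.trans ?_
    refine Finset.sum_congr rfl fun i _ => ?_
    exact mul_comm _ _
  · funext t
    exact diagIn_eq e fun i hi => by rw [hδ i hi, ha i hi, hb i hi, variance_zero_zero]

end Explicit

end MomentOT

theorem theorem1p17 (d : ℕ) (m₀ m₁ : Fin d → ℝ) (C₀ C₁ : Matrix (Fin d) (Fin d) ℝ)
    (hC₀ : C₀.PosSemidef) (hC₁ : C₁.PosSemidef)
    (him : MomentOT.im C₀ = MomentOT.im C₁) (hm : m₁ - m₀ ∈ MomentOT.im C₀) :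
    -- existence of an optimizer which solves the optimality conditions
    (MomentOT.distSq m₀ C₀ m₁ C₁ ≠ ⊤ ∧
      ∃ m C, MomentOT.IsOptimal m₀ C₀ m₁ C₁ m C ∧
        ∃ α : Fin d → ℝ, MomentOT.SolvesOptimality α m C) ∧
    -- equal means
    (m₀ = m₁ →
      (∀ m C, MomentOT.IsOptimal m₀ C₀ m₁ C₁ m C ↔
        ∀ t ∈ Icc (0 : ℝ) 1, m t = m₀ ∧ C t = MomentOT.affineGeodesic C₀ C₁ t) ∧
      MomentOT.distSq m₀ C₀ m₁ C₁ =
        ENNReal.ofReal ((1 / 8) * MomentOT.hsNormSq (MomentOT.slog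
          (MomentOT.spow C₀ (-1 / 2) * C₁ * MomentOT.spow C₀ (-1 / 2))))) ∧
    -- covariances which are diagonal in a common orthonormal basis
    (∀ (e : Fin d → Fin d → ℝ) (a b : Fin d → ℝ),
      (∀ i j, e i ⬝ᵥ e j = if i = j then 1 else 0) →
      C₀ = MomentOT.diagIn e a → C₁ = MomentOT.diagIn e b →
      MomentOT.IsMomentCurve m₀ C₀ m₁ C₁
        (MomentOT.explicitMean e m₀ m₁ a b) (MomentOT.explicitCov e m₀ m₁ a b) ∧
      MomentOT.action (MomentOT.explicitMean e m₀ m₁ a b) (MomentOT.explicitCov e m₀ m₁ a b) =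
        ENNReal.ofReal ((1 / 2) *
          ∑ i with 0 < a i, MomentOT.rate ((m₁ - m₀) ⬝ᵥ e i) (a i) (b i) ^ 2) ∧
      (∀ (l : Fin d) (c : ℝ), m₁ - m₀ = c • e l →
        MomentOT.IsOptimal m₀ C₀ m₁ C₁
          (MomentOT.explicitMean e m₀ m₁ a b) (MomentOT.explicitCov e m₀ m₁ a b) ∧
        ∃ α : Fin d → ℝ, MomentOT.SolvesOptimality α
          (MomentOT.explicitMean e m₀ m₁ a b) (MomentOT.explicitCov e m₀ m₁ a b)) ∧
      MomentOT.distSq m₀ C₀ m₁ C₁ ≤ ENNReal.ofReal ((1 / 2) *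
        ∑ i with 0 < a i, Real.arcosh
          ((((m₁ - m₀) ⬝ᵥ e i) ^ 2 + a i + b i) / (2 * √(a i * b i))) ^ 2) ∧
      (a = b → MomentOT.distSq m₀ C₀ m₁ C₁ ≤ ENNReal.ofReal ((1 / 2) *
        ∑ i with 0 < a i, Real.arcosh
          (((m₁ - m₀) ⬝ᵥ e i) ^ 2 / (2 * a i) + 1) ^ 2))) := by
  open MomentOT in
  obtain ⟨p, _, V, W, μ, hV, hμ, hV₀, hV₁, hgeo, hlog⟩ := exists_chart hC₀ hC₁ him
  have hV₀' : C₀ = V * (1 : Matrix {i // p i} {i // p i} ℝ) * Vᵀ := by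
    rw [Matrix.mul_one]; exact hV₀
  have hη : m₁ = m₀ + V *ᵥ (W *ᵥ (m₁ - m₀)) := by
    rw [hV.proj_of_mem_im (K := 1) (by rwa [← hV₀']), add_sub_cancel]
  have h1 : ∀ i : {i // p i}, (0 : ℝ) < (fun _ => 1 : {i // p i} → ℝ) i := fun _ => one_pos
  -- the explicit curve joins the end points with finite action, so that a minimizer exists
  obtain ⟨n, K, hmin, hn0, hn1, hK0, hK1⟩ := exists_isMinimal
    (posCurve_diag (δ := W *ᵥ (m₁ - m₀)) h1 hμ)
    (by rw [energy_diag h1 hμ]; exact ENNReal.ofReal_ne_top)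
  rw [diagMean_zero] at hn0
  rw [diagMean_one h1 hμ] at hn1
  rw [diagCov_zero h1 hμ, diagonal_one] at hK0
  rw [diagCov_one h1 hμ] at hK1
  obtain ⟨hopt, hdist⟩ := hV.isOptimal hV₀' hV₁ hη hmin hn0 hn1 hK0 hK1
  have hfin : distSq m₀ C₀ m₁ C₁ ≠ ⊤ := hdist ▸ hmin.ne_top
  refine ⟨⟨hfin, _, _, hopt, hV.solvesOptimality m₀ hmin⟩, fun hmm => ?_, ?_⟩
  · have hη0 : W *ᵥ (m₁ - m₀) = 0 := by rw [hmm, sub_self, mulVec_zero]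
    have huniq : ∀ m C, IsOptimal m₀ C₀ m₁ C₁ m C →
        ∀ t ∈ Icc (0 : ℝ) 1, m t = m₀ ∧ C t = affineGeodesic C₀ C₁ t := by
      intro m C hmC t ht
      obtain ⟨n', K', hmin', e0, e1, e2, e3, heq⟩ :=
        hV.isMinimal hV₀' hV₁ hη PosDef.one hmC hfin
      obtain ⟨e4, e5⟩ := (hmin'.eq_diagonal_rpow (by rw [e0, e1, hη0]) e2 hμ e3).1 t ht
      rw [(heq t ht).1, (heq t ht).2, e4, e5, e0, hgeo, mulVec_zero, add_zero]
      exact ⟨rfl, rfl⟩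
    refine ⟨fun m C => ⟨huniq m C, fun h => ?_⟩, ?_⟩
    · have hcongr : ∀ t ∈ Icc (0 : ℝ) 1, m₀ + V *ᵥ n t = m t ∧ V * K t * Vᵀ = C t :=
        fun t ht => by
          obtain ⟨e1, e2⟩ := huniq _ _ hopt t ht
          exact ⟨e1.trans (h t ht).1.symm, e2.trans (h t ht).2.symm⟩
      exact ⟨hopt.1.congr hcongr, (action_congr hcongr).symm.trans hopt.2⟩
    · rw [hdist, hlog]
      exact (hmin.eq_diagonal_rpow (by rw [hn0, hn1, hη0]) hK0 hμ hK1).2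
  · intro e a b he ha hb
    have hpa : (diagIn e a).PosSemidef := ha ▸ hC₀
    have hpb : (diagIn e b).PosSemidef := hb ▸ hC₁
    have him' : im (diagIn e a) = im (diagIn e b) := by rw [← ha, ← hb, him]
    have ha0 : ∀ i, ¬ 0 < a i → a i = 0 := fun i hi =>
      le_antisymm (not_lt.1 hi) (diagIn_nonneg he hpa i)
    have hb0 : ∀ i, ¬ 0 < a i → b i = 0 := fun i hi =>
      diagIn_eq_zero he hpb hpa him'.symm (ha0 i hi)
    have hbpos : ∀ i : {i // 0 < a i}, 0 < b i := fun i =>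
      (diagIn_nonneg he hpb i).lt_of_ne' fun h => i.2.ne' (diagIn_eq_zero he hpa hpb him' h)
    have hapos : ∀ i : {i // 0 < a i}, 0 < a i := fun i => i.2
    have hδ : ∀ i, ¬ 0 < a i → (m₁ - m₀) ⬝ᵥ e i = 0 := by
      intro i hi
      obtain ⟨x, hx⟩ := mem_im.1 hm
      rw [← hx, dotProduct_comm, dotProduct_mulVec_comm (posSemidef_transpose_eq hC₀), ha,
        diagIn_mulVec he, ha0 i hi, zero_smul, dotProduct_zero]
    obtain ⟨hme, hce⟩ := explicit_eq_lift (e := e) hδ ha0 hb0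
    have hE := isChart_basisCols he a
    have hE₀ : C₀ = _ := ha.trans (diagIn_eq e ha0)
    have hE₁ : C₁ = _ := hb.trans (diagIn_eq e hb0)
    have hEm : m₁ = m₀ + basisCols e a *ᵥ fun i : {i // 0 < a i} => (m₁ - m₀) ⬝ᵥ e i := by
      have h2 : (basisCols e a)ᵀ *ᵥ (m₁ - m₀) =
          fun i : {i // 0 < a i} => (m₁ - m₀) ⬝ᵥ e i :=
        funext fun i => dotProduct_comm _ _
      rw [← h2, hE.proj_of_mem_im (by rwa [← hE₀]), add_sub_cancel]
    obtain ⟨hc, hact⟩ := hE.lift (posCurve_diag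
      (δ := fun i : {i // 0 < a i} => (m₁ - m₀) ⬝ᵥ e i) hapos hbpos) m₀
    rw [diagMean_zero, diagMean_one hapos hbpos, diagCov_zero hapos hbpos,
      diagCov_one hapos hbpos, ← hE₀, ← hE₁, ← hEm, mulVec_zero, add_zero, ← hme, ← hce] at hc
    have hact' : action (explicitMean e m₀ m₁ a b) (explicitCov e m₀ m₁ a b) =
        ENNReal.ofReal ((1 / 2) *
          ∑ i with 0 < a i, rate ((m₁ - m₀) ⬝ᵥ e i) (a i) (b i) ^ 2) := by
      rw [hme, hce, hact, energy_diag hapos hbpos,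
        Finset.sum_subtype (p := fun i => 0 < a i) _ (by simp)]
    have hle : distSq m₀ C₀ m₁ C₁ ≤ ENNReal.ofReal ((1 / 2) *
        ∑ i with 0 < a i, rate ((m₁ - m₀) ⬝ᵥ e i) (a i) (b i) ^ 2) := hact' ▸ distSq_le hc
    refine ⟨hc, hact', fun l c hl => ?_, hle, fun hab => ?_⟩
    · have hmin' := isMinimal_diag (δ := fun i : {i // 0 < a i} => (m₁ - m₀) ⬝ᵥ e i) hapos hbpos
        (by
          have h3 : ∀ i : {i // 0 < a i}, (m₁ - m₀) ⬝ᵥ e i ≠ 0 → (i : Fin d) = l := by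
            intro i hi
            by_contra hil
            refine hi ?_
            rw [hl, smul_dotProduct, he, if_neg (Ne.symm hil), smul_zero]
          exact fun i j hi hj => Subtype.ext ((h3 i hi).trans (h3 j hj).symm))
      rw [hme, hce]
      exact ⟨(hE.isOptimal hE₀ hE₁ hEm hmin' (diagMean_zero _ _ _) (diagMean_one hapos hbpos)
        (diagCov_zero hapos hbpos) (diagCov_one hapos hbpos)).1, hE.solvesOptimality m₀ hmin'⟩
    · subst hab
      refine hle.trans (le_of_eq ?_)
      congr 2
      refine Finset.sum_congr rfl fun i hi => ?_
      have hi' : 0 < a i := (Finset.mem_filter.1 hi).2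
      rw [rate, Real.sqrt_mul_self hi'.le]
      congr 2
      field_simp
      ring
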